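/- Let $V$ be a complex vector space of dimension $6$. A subspace $A\subset\wedge^3V$ is Lagrangian if it is Lagrangian for the symplectic form given by the wedge product $\wedge^3V\times\wedge^3V\to\wedge^6V\cong\mathbb{C}$, and one puts $$Y_A=\{v\in\mathbb{P}(V) : (v\wedge\wedge^2V)\cap A\neq 0\}.$$ Let $i:V\to V$ be a linear involution with eigenspaces $V^{\pm}$ for the eigenvalues $\pm1$, and suppose $\dim V^+=4$ (so $\dim V^-=2$). Let $A\subset\wedge^3V$ be a Lagrangian subspace with $i(A)=A$, and write $A=A^+\oplus A^-$ for its decomposition into eigenspaces of $i$. Assume that $A\in\mathbb{LG}(\wedge^3V)^*$, that is, there is a basis $f_1,f_2$ of $V^-$ such that $$A^+\cap\wedge^3V^+=0,\qquad A^+\cap(\wedge^2V^-\otimes V^+)=0,\qquad A^-\cap(\mathbb{C}f_j\otimes\wedge^2V^+)=0\quad(j=1,2),$$ and the operator $u$ on $\wedge^2V^+$ with $A^-=\{f_1\wedge x+f_2\wedge u(x) : x\in\wedge^2V^+\}$ has $6$ distinct eigenvalues and no decomposable eigenvector. Then the fixed locus of $i$ on $Y_A$ is the union of $6$ distinct points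 of $\mathbb{P}(V^-)$, each isolated in the fixed locus, a smooth quadric surface $Q\subset\mathbb{P}(V^+)\cong\mathbb{P}^3$, and a singular Kummer surface $S\subset\mathbb{P}(V^+)$ of degree $4$, i.e. an irreducible quartic surface whose singular locus consists of exactly $16$ points, all ordinary double points. Moreover $S$ is the Kummer surface associated to a quadric line complex: there is a smooth quadric $F\subset\mathbb{P}(\wedge^2V^+)\cong\mathbb{P}^5$, meeting the Plücker quadric $G=\{x : x\wedge x=0\}$ transversally, such that $S$ is the set of points $p\in\mathbb{P}(V^+)$ for which the conic $F\cap\sigma(p)$ is singular, where $\sigma(p)=\mathbb{P}(p\wedge V^+)\subset G$ is the plane of lines through $p$. -/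

import Mathlib

open scoped LinearAlgebra.Projectivization

noncomputable section

namespace EPWFix

section Projective

variable {W : Type*} [AddCommGroup W] [Module ℂ W]

/-- The common zero locus in `ℙ(W)` of a set of polynomials in the coordinates of a basis `b`
(only used for homogeneous polynomials, for which the choice of representatives is immaterial). -/
def zeroLocus {n : ℕ} (b : Module.Basis (Fin n) ℂ W) (T : Set (MvPolynomial (Fin n) ℂ)) :
    Set (ℙ ℂ W) :=
  {p | ∀ P ∈ T, MvPolynomial.eval (b.repr p.rep) P = 0}

/-- Zariski closed subsets of `ℙ(W)`. -/
def IsZariskiClosed (Z : Set (ℙ ℂ W)) : Prop :=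
  ∃ (n : ℕ) (b : Module.Basis (Fin n) ℂ W) (T : Set (MvPolynomial (Fin n) ℂ)),
    (∀ P ∈ T, ∃ d : ℕ, P.IsHomogeneous d) ∧ Z = zeroLocus b T

/-- `p` is an isolated point of `T`: some Zariski open neighbourhood of `p` (the complement of `Z`)
meets `T` only in `p`. -/
def IsIsolatedPoint (T : Set (ℙ ℂ W)) (p : ℙ ℂ W) : Prop :=
  p ∈ T ∧ ∃ Z : Set (ℙ ℂ W), IsZariskiClosed Z ∧ p ∉ Z ∧ T \ {p} ⊆ Z

/-- A quadratic form whose polar bilinear form is nondegenerate, i.e. one that defines a smooth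
quadric. -/
def IsSmoothForm (q : QuadraticForm ℂ W) : Prop :=
  ∀ x : W, (∀ y : W, QuadraticMap.polar q x y = 0) → x = 0

/-- Smooth quadric hypersurfaces in `ℙ(W)`. -/
def IsSmoothQuadric (Q : Set (ℙ ℂ W)) : Prop :=
  ∃ q : QuadraticForm ℂ W, IsSmoothForm q ∧ Q = {p | q p.rep = 0}

/-- The singular points of the hypersurface `P = 0` in `ℙ(W)`, for `P` homogeneous of positive
degree: the points where all partial derivatives vanish (by Euler's relation `P` vanishes too). -/
def singularPoints {n : ℕ} (b : Module.Basis (Fin n) ℂ W) (P : MvPolynomial (Fin n) ℂ) :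
    Set (ℙ ℂ W) :=
  zeroLocus b (Set.range fun j => MvPolynomial.pderiv j P)

/-- The Hessian matrix of `P` at a representative of `p`, in the coordinates of `b`. -/
def hessian {n : ℕ} (b : Module.Basis (Fin n) ℂ W) (P : MvPolynomial (Fin n) ℂ) (p : ℙ ℂ W) :
    Matrix (Fin n) (Fin n) ℂ :=
  Matrix.of fun j k =>
    MvPolynomial.eval (b.repr p.rep) (MvPolynomial.pderiv j (MvPolynomial.pderiv k P))

/-- Singular Kummer surfaces of degree `4` in a projective 3-space `ℙ(W)`: irreducible quartic
surfaces whose singular locus consists of exactly 16 points, all of them ordinary double points.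
(At a singular point `p` of `P = 0` the representative of `p` lies in the kernel of the Hessian, so
the quadratic part of a local equation at `p` is nondegenerate if and only if the Hessian has
rank `3`.) -/
def IsKummerQuartic (S : Set (ℙ ℂ W)) : Prop :=
  ∃ (b : Module.Basis (Fin 4) ℂ W) (P : MvPolynomial (Fin 4) ℂ),
    P.IsHomogeneous 4 ∧ Irreducible P ∧ S = zeroLocus b {P} ∧
    (singularPoints b P).ncard = 16 ∧
    ∀ p ∈ singularPoints b P, (hessian b P p).rank = 3

/-- For a point `p` of `ℙ(W)`, the subspace `p ∧ W` of `⋀² W`.  Its projectivization is the plane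
`σ(p)` of (Plücker coordinates of) lines of `ℙ(W)` through `p`. -/
def sigma (p : ℙ ℂ W) : Submodule ℂ (⋀[ℂ]^2 W) :=
  (p.submodule.map (ExteriorAlgebra.ι ℂ) * LinearMap.range (ExteriorAlgebra.ι ℂ : W →ₗ[ℂ] _)).comap
    (⋀[ℂ]^2 W).subtype

/-- The form `F` on `⋀² W` (`W` of dimension `4`) defines a smooth quadric that cuts the Plücker
quadric `G = {x ∧ x = 0}` in a smooth quadric line complex `F ∩ G`: at each point `x` of `F ∩ G` the
tangent hyperplanes `{y | x ∧ y = 0}` of `G` and `{y | polar F x y = 0}` of `F` are different. -/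
def IsQuadricLineComplex (F : QuadraticForm ℂ (⋀[ℂ]^2 W)) : Prop :=
  IsSmoothForm F ∧
  ∀ x : ⋀[ℂ]^2 W, x ≠ 0 → (x : ExteriorAlgebra ℂ W) * x = 0 → F x = 0 →
    ∃ y : ⋀[ℂ]^2 W, (x : ExteriorAlgebra ℂ W) * y = 0 ∧ QuadraticMap.polar F x y ≠ 0

/-- The surface associated to the quadric line complex of `F`: the points `p` such that the conic
`F ∩ σ(p)` is singular, i.e. the restriction of `F` to `p ∧ W` is a degenerate quadratic form. -/
def associatedKummer (F : QuadraticForm ℂ (⋀[ℂ]^2 W)) : Set (ℙ ℂ W) :=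
  {p | ∃ x ∈ sigma p, x ≠ 0 ∧ ∀ y ∈ sigma p, QuadraticMap.polar F x y = 0}

end Projective

section EPW

variable {V : Type*} [AddCommGroup V] [Module ℂ V]

/-- For a subspace `W` of `V`, the subspace `⋀ⁿ W` of `⋀ⁿ V` (inside the exterior algebra). -/
def extPow (W : Submodule ℂ V) (n : ℕ) : Submodule ℂ (ExteriorAlgebra ℂ V) :=
  (W.map (ExteriorAlgebra.ι ℂ)) ^ n

/-- The set `Y_A = {v ∈ ℙ(V) | (v ∧ ⋀² V) ∩ A ≠ 0}`. -/
def EPW (A : Submodule ℂ (ExteriorAlgebra ℂ V)) : Set (ℙ ℂ V) :=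
  {p | (extPow p.submodule 1 * ⋀[ℂ]^2 V) ⊓ A ≠ ⊥}

/-- `A` is a Lagrangian subspace of `⋀³ V` for the wedge product `⋀³ V × ⋀³ V → ⋀⁶ V`
(`V` of dimension `6`): an isotropic subspace of half the dimension. -/
def IsLagrangian (A : Submodule ℂ (ExteriorAlgebra ℂ V)) : Prop :=
  A ≤ ⋀[ℂ]^3 V ∧ (∀ α ∈ A, ∀ β ∈ A, α * β = 0) ∧
    2 * Module.finrank ℂ A = Module.finrank ℂ (⋀[ℂ]^3 V)

/-- The eigenspace `V⁺` of `i`. -/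
abbrev Vplus (i : V ≃ₗ[ℂ] V) : Submodule ℂ V :=
  Module.End.eigenspace (i : V →ₗ[ℂ] V) 1

/-- The eigenspace `V⁻` of `i`. -/
abbrev Vminus (i : V ≃ₗ[ℂ] V) : Submodule ℂ V :=
  Module.End.eigenspace (i : V →ₗ[ℂ] V) (-1)

/-- The endomorphism of the exterior algebra of `V` induced by `i`. -/
def extMap (i : V ≃ₗ[ℂ] V) : Module.End ℂ (ExteriorAlgebra ℂ V) :=
  (ExteriorAlgebra.map (i : V →ₗ[ℂ] V)).toLinearMap

/-- `A⁺ = A ∩ (⋀³ V)⁺`, for `A ⊆ ⋀³ V`. -/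
def plusPart (i : V ≃ₗ[ℂ] V) (A : Submodule ℂ (ExteriorAlgebra ℂ V)) :
    Submodule ℂ (ExteriorAlgebra ℂ V) :=
  A ⊓ Module.End.eigenspace (extMap i) 1

/-- `A⁻ = A ∩ (⋀³ V)⁻`, for `A ⊆ ⋀³ V`. -/
def minusPart (i : V ≃ₗ[ℂ] V) (A : Submodule ℂ (ExteriorAlgebra ℂ V)) :
    Submodule ℂ (ExteriorAlgebra ℂ V) :=
  A ⊓ Module.End.eigenspace (extMap i) (-1)

/-- `A ∈ LG(⋀³ V)^*` (relative to the involution `i`): `A` is Lagrangian, `A = A⁺ ⊕ A⁻`, and there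
is a basis `f₁, f₂` of `V⁻` such that `A⁺ ∩ ⋀³ V⁺ = 0`, `A⁺ ∩ (⋀² V⁻ ⊗ V⁺) = 0`,
`A⁻ ∩ (ℂ fⱼ ⊗ ⋀² V⁺) = 0` for `j = 1, 2`, and the operator `u` on `⋀² V⁺` whose graph
`{f₁ ∧ x + f₂ ∧ u(x)}` is `A⁻` has `6` distinct eigenvalues and no decomposable eigenvector. -/
def IsLGStar (i : V ≃ₗ[ℂ] V) (A : Submodule ℂ (ExteriorAlgebra ℂ V)) : Prop :=
  IsLagrangian A ∧ A = plusPart i A ⊔ minusPart i A ∧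
  ∃ f : Module.Basis (Fin 2) ℂ (Vminus i),
    plusPart i A ⊓ extPow (Vplus i) 3 = ⊥ ∧
    plusPart i A ⊓ (extPow (Vminus i) 2 * extPow (Vplus i) 1) = ⊥ ∧
    (∀ j, minusPart i A ⊓ (extPow (ℂ ∙ (f j : V)) 1 * extPow (Vplus i) 2) = ⊥) ∧
    ∃ u : Module.End ℂ (extPow (Vplus i) 2),
      (minusPart i A : Set (ExteriorAlgebra ℂ V)) =
        {α | ∃ x : extPow (Vplus i) 2,
          α = ExteriorAlgebra.ι ℂ (f 0 : V) * (x : ExteriorAlgebra ℂ V) +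
            ExteriorAlgebra.ι ℂ (f 1 : V) * (u x : ExteriorAlgebra ℂ V)} ∧
      {μ : ℂ | u.HasEigenvalue μ}.ncard = 6 ∧
      ∀ (μ : ℂ) (x : extPow (Vplus i) 2), u.HasEigenvector μ x →
        ¬ ∃ w₁ ∈ Vplus i, ∃ w₂ ∈ Vplus i,
          (x : ExteriorAlgebra ℂ V) = ExteriorAlgebra.ι ℂ w₁ * ExteriorAlgebra.ι ℂ w₂

/-- The fixed locus on `Y_A` of the projective transformation induced by `i`. -/
def fixedLocus (i : V ≃ₗ[ℂ] V) (A : Submodule ℂ (ExteriorAlgebra ℂ V)) : Set (ℙ ℂ V) :=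
  {p ∈ EPW A | Projectivization.map (i : V →ₗ[ℂ] V) i.injective p = p}

/-- The inclusion `ℙ(W) → ℙ(V)` for a subspace `W` of `V`. -/
def projIncl (W : Submodule ℂ V) : ℙ ℂ W → ℙ ℂ V :=
  Projectivization.map W.subtype W.injective_subtype

end EPW

end EPWFix

end

noncomputable section

namespace EPWFix

/-! Write W = V⁺, so that V = W ⊕ ℂf₁ ⊕ ℂf₂ and ⋀³V = ⋀³W ⊕ f₁⋀²W ⊕ f₂⋀²W ⊕ f₁f₂W, with i acting by
+, −, −, +. The graph A⁻ of u has dimension 6, which leaves dimension 4 for A⁺, and transversality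
makes A⁺ the graph of an injective φ : W → ⋀³W (`IsLGStar.exists_isGraphPair`). Isotropy of A says
that a ∧ φ(c) is symmetric in a, c and that u is self-adjoint for the wedge pairing B on ⋀²W
(`IsGraphPair.φ_symm`, `IsGraphPair.u_adj`).

A fixed point lies in ℙ(V⁻) or in ℙ(W). For v = s f₁ + t f₂, lying on Y_A means that t/s is an
eigenvalue of u: six points. For a ∈ W the condition a ∧ τ ∈ A decouples by parity
(`IsGraphPair.mk_mem_EPW_of_mem`): either a ∧ φ(a) = 0, a quadric that is smooth because φ is
injective, or u sends some nonzero x ∈ a ∧ W into a ∧ W. As a ∧ W is its own orthogonal complement,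
the second case says that F(x) = B(ux, x) degenerates on a ∧ W. Tangency of F and G would produce an
isotropic eigenvector of u, which a simple spectrum excludes.

An equation P of S comes from the 4 × 4 Gram matrix of F on the vectors v ∧ bⱼ: its entries are
quadratic in v and v lies in its kernel, so its adjugate is P(v) v vᵗ with deg P = 6 − 2 = 4
(`exists_kummerQuartic`). Expanding the discriminant to second order shows that v is singular on S
exactly when x, ux, u²x all lie in v ∧ W for some x ≠ 0, and that the Hessian then has rank 3
(`IsDiscriminant.exists_threeIn`, `IsDiscriminant.singular_of_node`).

Such an x satisfies B(uᵐx, x) = 0 for m < 5. In an eigenbasis this fixes the squares of its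
coordinates up to a common factor, so x is determined up to scalar by 2⁵ = 32 choices of signs.
Changing one sign gives a plane sharing a pencil with the old one, hence in the other family of
isotropic planes; so exactly 16 of the 32 planes are of the form v ∧ W (`mem_nodeSigns_flip`,
`ncard_nodeSigns`). Finally P is irreducible, since two factors would meet along a curve of singular
points (`irreducible_of_finite_singular`). -/

/-! ### Common zeros of polynomials, and irreducibility from a finite singular locus -/

open MvPolynomial in
theorem le_height_vanishingIdeal_zero (n : ℕ) :
    (n : ℕ∞) ≤ (vanishingIdeal ℂ ({0} : Set (Fin n → ℂ))).height := by
  -- Translations act transitively on points, so all maximal ideals have the same height, which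
  -- therefore bounds the Krull dimension n.
  have key : ∀ a : Fin n → ℂ, (vanishingIdeal ℂ ({a} : Set (Fin n → ℂ))).height =
      (vanishingIdeal ℂ ({0} : Set (Fin n → ℂ))).height := by
    intro a
    let f : MvPolynomial (Fin n) ℂ →ₐ[ℂ] MvPolynomial (Fin n) ℂ := aeval fun i => X i + C (a i)
    let g : MvPolynomial (Fin n) ℂ →ₐ[ℂ] MvPolynomial (Fin n) ℂ := aeval fun i => X i - C (a i)
    let τ : MvPolynomial (Fin n) ℂ ≃ₐ[ℂ] MvPolynomial (Fin n) ℂ :=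
      AlgEquiv.ofAlgHom f g (by ext i; simp [f, g]) (by ext i; simp [f, g])
    have h : vanishingIdeal ℂ ({a} : Set (Fin n → ℂ)) =
        (vanishingIdeal ℂ ({0} : Set (Fin n → ℂ))).comap τ.toRingEquiv := by
      ext p
      have h2 : eval (0 : Fin n → ℂ) (f p) = eval a p := by
        have : ((aeval (0 : Fin n → ℂ)).comp f) = aeval a := by
          ext i; simp [f]
        simpa [aeval_eq_eval] using DFunLike.congr_fun this p
      simp only [Ideal.mem_comap, mem_vanishingIdeal_singleton_iff]
      change aeval a p = 0 ↔ aeval (0 : Fin n → ℂ) (f p) = 0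
      rw [aeval_eq_eval, aeval_eq_eval]
      exact iff_of_eq (congrArg (· = 0) h2.symm)
    rw [h, RingEquiv.height_comap]
  have hdim : ringKrullDim (MvPolynomial (Fin n) ℂ) = (n : WithBot ℕ∞) := by
    simp [ringKrullDim_eq_zero_of_field]
  have h := (ringKrullDim_le_iff_isMaximal_height_le (R := MvPolynomial (Fin n) ℂ)
    ((vanishingIdeal ℂ ({0} : Set (Fin n → ℂ))).height : WithBot ℕ∞)).2 (by
      intro I hI
      obtain ⟨a, rfl⟩ := isMaximal_iff_eq_vanishingIdeal_singleton.1 hI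
      rw [key a])
  rw [hdim] at h
  exact_mod_cast h

-- If 0 were the only common zero, the Nullstellensatz would make the maximal ideal of 0 minimal
-- over the ideal generated by `s`, against Krull's height theorem.
open MvPolynomial in
theorem exists_common_zero {n : ℕ} (s : Finset (MvPolynomial (Fin n) ℂ)) (hs : s.card < n)
    (h0 : ∀ p ∈ s, eval 0 p = 0) : ∃ v : Fin n → ℂ, v ≠ 0 ∧ ∀ p ∈ s, eval v p = 0 := by
  by_contra! hcon
  have hz : MvPolynomial.zeroLocus ℂ (Ideal.span (s : Set (MvPolynomial (Fin n) ℂ))) = {0} := by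
    rw [zeroLocus_span]
    ext v
    simp only [Set.mem_ofPred_eq, Set.mem_singleton_iff, aeval_eq_eval]
    constructor
    · intro h
      by_contra hv
      obtain ⟨p, hp, hpv⟩ := hcon v hv
      exact hpv (h p hp)
    · rintro rfl p hp
      exact h0 p hp
  have hrad := vanishingIdeal_zeroLocus_eq_radical (k := ℂ) (K := ℂ)
    (Ideal.span (s : Set (MvPolynomial (Fin n) ℂ)))
  rw [hz] at hrad
  have hmax : (vanishingIdeal ℂ ({0} : Set (Fin n → ℂ))).IsMaximal :=
    isMaximal_iff_eq_vanishingIdeal_singleton.2 ⟨0, rfl⟩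
  have hmin : vanishingIdeal ℂ ({0} : Set (Fin n → ℂ)) ∈
      (Ideal.span (s : Set (MvPolynomial (Fin n) ℂ))).minimalPrimes := by
    refine ⟨⟨hmax.isPrime, hrad ▸ Ideal.le_radical⟩, fun J hJ _ => ?_⟩
    rw [hrad]
    exact hJ.1.radical_le_iff.2 hJ.2
  have h1 := Ideal.height_le_card_of_mem_minimalPrimes_span_finset hmin
  have h2 := (le_height_vanishingIdeal_zero n).trans h1
  exact absurd (by exact_mod_cast h2) (not_le.2 hs)

open MvPolynomial in
theorem eval_smul_of_isHomogeneous {n d : ℕ} {P : MvPolynomial (Fin n) ℂ} (hP : P.IsHomogeneous d)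
    (t : ℂ) (v : Fin n → ℂ) : eval (t • v) P = t ^ d * eval v P := by
  rw [eval_eq, eval_eq, Finset.mul_sum]
  refine Finset.sum_congr rfl fun m hm => ?_
  have hdeg := hP.degree_eq_sum_deg_support hm
  simp only [Pi.smul_apply, smul_eq_mul, mul_pow, Finset.prod_mul_distrib, Finset.prod_pow_eq_pow_sum]
  rw [show ∑ i ∈ m.support, m i = d from hdeg.symm]
  ring

-- On a line through the origin P becomes a multiple of t^d, so wherever P(v) ≠ 0 the factor G
-- restricts to a divisor of a power of t that does not vanish at t = 0, a constant. This handles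
-- factors of a form without first proving that they are homogeneous.
open MvPolynomial in
theorem eq_C_of_mul_isHomogeneous {n d : ℕ} {P G H : MvPolynomial (Fin n) ℂ}
    (hP : P.IsHomogeneous d) (hP0 : P ≠ 0) (h : P = G * H) (hG : eval 0 G ≠ 0) :
    G = C (eval 0 G) := by
  have key : ∀ v, eval v P ≠ 0 → eval v G = eval 0 G := by
    intro v hv
    let φ : MvPolynomial (Fin n) ℂ →ₐ[ℂ] Polynomial ℂ := aeval fun i => Polynomial.C (v i) * Polynomial.X
    have hφ : ∀ (Q : MvPolynomial (Fin n) ℂ) (t : ℂ), (φ Q).eval t = eval (t • v) Q := by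
      intro Q t
      have : ((Polynomial.aeval t).comp φ) = aeval (t • v) := by
        ext i
        simp only [φ, AlgHom.comp_apply, aeval_X, map_mul, Polynomial.aeval_C, Polynomial.aeval_X]
        simp only [Algebra.algebraMap_self, RingHom.id_apply, Pi.smul_apply, smul_eq_mul]
        exact mul_comm _ _
      have h1 := DFunLike.congr_fun this Q
      rwa [AlgHom.comp_apply, Polynomial.coe_aeval_eq_eval, aeval_eq_eval] at h1
    have hPX : φ P = Polynomial.C (eval v P) * Polynomial.X ^ d := by
      refine Polynomial.funext fun t => ?_
      rw [hφ, eval_smul_of_isHomogeneous hP, Polynomial.eval_mul, Polynomial.eval_C,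
        Polynomial.eval_pow, Polynomial.eval_X, mul_comm]
    have hdvd : φ G ∣ Polynomial.X ^ d := by
      refine ⟨Polynomial.C (eval v P)⁻¹ * φ H, ?_⟩
      rw [mul_left_comm, ← map_mul, ← h, hPX, ← mul_assoc, ← Polynomial.C_mul, inv_mul_cancel₀ hv]
      simp
    obtain ⟨k, -, hk⟩ := (dvd_prime_pow Polynomial.prime_X d).1 hdvd
    have hk0 : k = 0 := by
      by_contra hk0
      have h1 : (Polynomial.X : Polynomial ℂ) ∣ φ G := (dvd_pow_self _ hk0).trans hk.symm.dvd
      rw [Polynomial.X_dvd_iff, Polynomial.coeff_zero_eq_eval_zero, hφ, zero_smul] at h1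
      exact hG h1
    rw [hk0, pow_zero] at hk
    obtain ⟨c, -, hc⟩ := Polynomial.isUnit_iff.1 (associated_one_iff_isUnit.1 hk)
    have e1 := hφ G 1
    have e0 := hφ G 0
    rw [← hc, Polynomial.eval_C] at e1 e0
    rw [one_smul] at e1
    rw [zero_smul] at e0
    exact e1.symm.trans e0
  -- G is constant off the zero set of P, so this product vanishes at every point.
  have : P * (G - C (eval 0 G)) = 0 := by
    refine MvPolynomial.funext fun v => ?_
    rw [map_mul, map_sub, eval_C, map_zero]
    by_cases hv : eval v P = 0
    · rw [hv, zero_mul]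
    · rw [key v hv, sub_self, mul_zero]
  exact sub_eq_zero.1 ((mul_eq_zero.1 this).resolve_left hP0)

/-- Coefficient vectors on the moment curve (1, t, t², …) suffice: each nonzero vector of S excludes
only the finitely many roots t of a nonzero polynomial. -/
theorem exists_linearForm_ne_zero {n : ℕ} {S : Set (Fin n → ℂ)} (hS : S.Finite) (h0 : 0 ∉ S) :
    ∃ a : Fin n → ℂ, ∀ s ∈ S, ∑ j, a j * s j ≠ 0 := by
  let f : (Fin n → ℂ) → Polynomial ℂ := fun s => ∑ j, Polynomial.C (s j) * Polynomial.X ^ (j : ℕ)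
  have hf : ∀ s ∈ S, f s ≠ 0 := by
    intro s hs h
    refine h0 ?_
    convert hs
    funext j
    have := congrArg (fun p => Polynomial.coeff p (j : ℕ)) h
    simp only [f, Polynomial.finsetSum_coeff, Polynomial.coeff_C_mul, Polynomial.coeff_X_pow,
      Polynomial.coeff_zero, Fin.val_inj] at this
    simpa using this.symm
  have hfin : (⋃ s ∈ S, {t : ℂ | (f s).IsRoot t}).Finite :=
    hS.biUnion fun s hs => Polynomial.finite_setOfPred_isRoot (hf s hs)
  obtain ⟨t, ht⟩ := hfin.exists_notMem
  refine ⟨fun j => t ^ (j : ℕ), fun s hs h => ht ?_⟩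
  simp only [Set.mem_iUnion]
  refine ⟨s, hs, ?_⟩
  simp only [Set.mem_ofPred_eq, Polynomial.IsRoot.def, f, Polynomial.eval_finsetSum]
  rw [← h]
  exact Finset.sum_congr rfl fun j _ => by
    rw [Polynomial.eval_mul, Polynomial.eval_C, Polynomial.eval_pow, Polynomial.eval_X, mul_comm]

open MvPolynomial in
/-- A quaternary form whose singular locus is a finite set of points is irreducible. -/
theorem irreducible_of_finite_singular {d : ℕ} {P : MvPolynomial (Fin 4) ℂ} (hd : d ≠ 0)
    (hP : P.IsHomogeneous d) (hP0 : P ≠ 0) {S : Set (Fin 4 → ℂ)} (hS : S.Finite) (h0 : 0 ∉ S)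
    (hsing : ∀ v : Fin 4 → ℂ, v ≠ 0 → (∀ j, eval v (pderiv j P) = 0) → ∃ s ∈ S, ∃ c : ℂ, v = c • s) :
    Irreducible P := by
  have hPz : eval 0 P = 0 := by
    have := eval_smul_of_isHomogeneous hP 0 0
    rwa [zero_smul, zero_pow hd, zero_mul] at this
  have unit : ∀ {G : MvPolynomial (Fin 4) ℂ}, G = C (eval 0 G) → eval 0 G ≠ 0 → IsUnit G := by
    intro G hG h
    rw [hG]
    exact (isUnit_iff_ne_zero.2 h).map C
  refine ⟨fun hu => ?_, fun G H h => ?_⟩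
  · have := (hu.map (eval (0 : Fin 4 → ℂ)))
    rw [hPz] at this
    exact not_isUnit_zero this
  by_cases hG : eval 0 G = 0
  swap
  · exact Or.inl (unit (eq_C_of_mul_isHomogeneous hP hP0 h hG) hG)
  by_cases hH : eval 0 H = 0
  swap
  · exact Or.inr (unit (eq_C_of_mul_isHomogeneous hP hP0 (h.trans (mul_comm _ _)) hH) hH)
  exfalso
  obtain ⟨a, ha⟩ := exists_linearForm_ne_zero hS h0
  let l : MvPolynomial (Fin 4) ℂ := ∑ j, C (a j) * X j
  have hl : ∀ v, eval v l = ∑ j, a j * v j := fun v => by simp [l]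
  classical
  -- Three equations in four unknowns: v is singular on GH = 0 because both factors vanish there,
  -- yet it lies on a plane that misses S.
  obtain ⟨v, hv, hz⟩ := exists_common_zero ({G, H, l} : Finset (MvPolynomial (Fin 4) ℂ))
    (lt_of_le_of_lt Finset.card_le_three (by norm_num)) (by
      intro p hp
      simp only [Finset.mem_insert, Finset.mem_singleton] at hp
      rcases hp with rfl | rfl | rfl
      · exact hG
      · exact hH
      · rw [hl]; simp)
  have hGv := hz G (by simp)
  have hHv := hz H (by simp)
  have hlv := hz l (by simp)
  obtain ⟨s, hs, c, rfl⟩ := hsing v hv fun j => by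
    rw [h, pderiv_mul, map_add, map_mul, map_mul, hGv, hHv, zero_mul, mul_zero, add_zero]
  rw [hl] at hlv
  have : c * ∑ j, a j * s j = 0 := by
    rw [← hlv, Finset.mul_sum]
    exact Finset.sum_congr rfl fun j _ => by simp; ring
  rcases mul_eq_zero.1 this with hc | hc
  · exact hv (by rw [hc, zero_smul])
  · exact ha s hs hc

/-! ### Derivatives along lines -/

/-- The restriction of `P` to the line `t ↦ v + t w`. -/
def linePoly {n : ℕ} (P : MvPolynomial (Fin n) ℂ) (v w : Fin n → ℂ) : Polynomial ℂ :=
  MvPolynomial.aeval (fun j => Polynomial.C (v j) + Polynomial.C (w j) * Polynomial.X) P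

theorem eval_linePoly {n : ℕ} (P : MvPolynomial (Fin n) ℂ) (v w : Fin n → ℂ) (t : ℂ) :
    (linePoly P v w).eval t = MvPolynomial.eval (v + t • w) P := by
  have : ((Polynomial.aeval t).comp (MvPolynomial.aeval fun j =>
      Polynomial.C (v j) + Polynomial.C (w j) * Polynomial.X) :
      MvPolynomial (Fin n) ℂ →ₐ[ℂ] ℂ) = MvPolynomial.aeval (v + t • w) := by
    ext j
    simp only [AlgHom.comp_apply, MvPolynomial.aeval_X, map_add, map_mul, Polynomial.aeval_C,
      Polynomial.aeval_X, Pi.add_apply, Pi.smul_apply, smul_eq_mul, Algebra.algebraMap_self,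
      RingHom.id_apply]
    rw [mul_comm]
  have h := DFunLike.congr_fun this P
  rwa [AlgHom.comp_apply, Polynomial.coe_aeval_eq_eval, MvPolynomial.aeval_eq_eval] at h

theorem derivative_linePoly {n : ℕ} (P : MvPolynomial (Fin n) ℂ) (v w : Fin n → ℂ) :
    Polynomial.derivative (linePoly P v w) =
      ∑ j, Polynomial.C (w j) * linePoly (MvPolynomial.pderiv j P) v w := by
  induction P using MvPolynomial.induction_on with
  | C a => simp [linePoly]
  | add p q hp hq =>
    simp only [linePoly, map_add] at *
    rw [hp, hq, ← Finset.sum_add_distrib]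
    exact Finset.sum_congr rfl fun j _ => by ring
  | mul_X p k hp =>
    have h1 : linePoly (p * MvPolynomial.X k) v w =
        linePoly p v w * (Polynomial.C (v k) + Polynomial.C (w k) * Polynomial.X) := by
      simp [linePoly]
    have h2 : ∀ j, linePoly (MvPolynomial.pderiv j (p * MvPolynomial.X k)) v w =
        linePoly (MvPolynomial.pderiv j p) v w *
          (Polynomial.C (v k) + Polynomial.C (w k) * Polynomial.X) +
        if j = k then linePoly p v w else 0 := by
      intro j
      rw [MvPolynomial.pderiv_mul, MvPolynomial.pderiv_X]
      by_cases hjk : j = k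
      · subst hjk
        simp [linePoly]
      · simp [linePoly, hjk, Ne.symm hjk]
    rw [h1, Polynomial.derivative_mul, hp]
    simp only [h2, mul_add, Finset.sum_add_distrib, mul_ite, mul_zero, Finset.sum_ite_eq',
      Finset.mem_univ, if_true]
    simp only [Polynomial.derivative_add, Polynomial.derivative_C, Polynomial.derivative_mul,
      Polynomial.derivative_X, Finset.sum_mul, ← Finset.sum_add_distrib]
    simp only [zero_mul, mul_one, zero_add]
    exact congrArg₂ (· + ·) (Finset.sum_congr rfl fun j _ => by
      simp only [← mul_add, mul_assoc]) (mul_comm _ _)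

theorem eval_derivative_linePoly {n : ℕ} (P : MvPolynomial (Fin n) ℂ) (v w : Fin n → ℂ) :
    (Polynomial.derivative (linePoly P v w)).eval 0 =
      ∑ j, w j * MvPolynomial.eval v (MvPolynomial.pderiv j P) := by
  simp [derivative_linePoly, Polynomial.eval_finsetSum, eval_linePoly]

theorem eval_derivative_derivative_linePoly {n : ℕ} (P : MvPolynomial (Fin n) ℂ)
    (v w : Fin n → ℂ) :
    (Polynomial.derivative (Polynomial.derivative (linePoly P v w))).eval 0 =
      ∑ j, w j * ∑ k, w k * MvPolynomial.eval v
        (MvPolynomial.pderiv k (MvPolynomial.pderiv j P)) := by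
  simp [derivative_linePoly, Polynomial.eval_finsetSum, eval_linePoly]

/-! ### The discriminant quartic of a family of conics -/

theorem adjugate_of_zero_row_col {R : Type*} [CommRing R] {n : ℕ}
    (N : Matrix (Fin (n + 1)) (Fin (n + 1)) R) (hr : ∀ k, N 0 k = 0) (hc : ∀ k, N k 0 = 0) :
    N.adjugate = Matrix.of fun j k =>
      if j = 0 ∧ k = 0 then (N.submatrix Fin.succ Fin.succ).det else 0 := by
  ext j k
  rw [Matrix.of_apply]
  split_ifs with h
  · obtain ⟨rfl, rfl⟩ := h
    rw [Matrix.adjugate_fin_succ_eq_det_submatrix]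
    simp [Fin.succAbove_zero]
  · rw [Matrix.adjugate_apply]
    by_cases hk : k = 0
    · subst hk
      have hj : j ≠ 0 := fun hj => h ⟨hj, rfl⟩
      refine Matrix.det_eq_zero_of_column_eq_zero 0 fun l => ?_
      rw [Matrix.updateRow_apply]
      split_ifs
      · simp [Ne.symm hj]
      · exact hc l
    · refine Matrix.det_eq_zero_of_row_eq_zero 0 fun l => ?_
      rw [Matrix.updateRow_ne (Ne.symm hk)]
      exact hr l

section Quartic

variable {W L : Type*} [AddCommGroup W] [Module ℂ W] [AddCommGroup L] [Module ℂ L]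

/-- The Gram matrix of `Φ` at the vectors `v ∧ b j`. -/
def gramAt (b : Module.Basis (Fin 4) ℂ W) (w : W →ₗ[ℂ] W →ₗ[ℂ] L) (Φ : L →ₗ[ℂ] L →ₗ[ℂ] ℂ) (v : W) :
    Matrix (Fin 4) (Fin 4) ℂ :=
  Matrix.of fun j k => Φ (w v (b j)) (w v (b k))

/-- In the basis v, y₀, y₁, y₂ the Gram matrix has zero first row and column because v ∧ v = 0, so
its adjugate has a single possibly nonzero entry. Transporting back leaves that entry times the
product of the coordinates of v. -/
theorem det_sq_smul_adjugate_gramAt (b : Module.Basis (Fin 4) ℂ W) (w : W →ₗ[ℂ] W →ₗ[ℂ] L)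
    (hw : ∀ v, w v v = 0) (Φ : L →ₗ[ℂ] L →ₗ[ℂ] ℂ) (v : W) (y : Fin 3 → W) (j k : Fin 4) :
    (b.det (Fin.cons v y : Fin 4 → W)) ^ 2 * (gramAt b w Φ v).adjugate j k =
      (Matrix.of fun i j => Φ (w v (y i)) (w v (y j))).det * (b.repr v j * b.repr v k) := by
  set z : Fin 4 → W := Fin.cons v y with hz
  set Y := b.toMatrix z with hY
  have hN : Y.transpose * gramAt b w Φ v * Y = Matrix.of fun i j => Φ (w v (z i)) (w v (z j)) := by
    ext i j
    have e : ∀ i, z i = ∑ k, Y k i • b k := fun i => (b.sum_repr (z i)).symm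
    rw [Matrix.of_apply, e i, e j]
    simp only [Matrix.mul_apply, Matrix.transpose_apply, gramAt, Matrix.of_apply, map_sum, map_smul,
      LinearMap.sum_apply, LinearMap.smul_apply, smul_eq_mul, Finset.sum_mul, Finset.mul_sum]
    refine Finset.sum_congr rfl fun a _ => Finset.sum_congr rfl fun c _ => by ring
  have hadj := adjugate_of_zero_row_col (Matrix.of fun i j => Φ (w v (z i)) (w v (z j)))
    (fun k => by simp [hz, hw]) (fun k => by simp [hz, hw])
  rw [← hN, Matrix.adjugate_mul_distrib, Matrix.adjugate_mul_distrib, hN] at hadj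
  have hsub : (Matrix.of fun i j => Φ (w v (z i)) (w v (z j))).submatrix Fin.succ Fin.succ =
      Matrix.of fun i j => Φ (w v (y i)) (w v (y j)) := by
    ext i j; simp [hz]
  rw [hsub] at hadj
  have h2 := congrArg (fun T => Y * T * Y.transpose) hadj
  have h3 : Y * (Y.adjugate * ((gramAt b w Φ v).adjugate * Y.transpose.adjugate)) * Y.transpose =
      (Y.det ^ 2) • (gramAt b w Φ v).adjugate := by
    rw [← Matrix.mul_assoc, Matrix.mul_adjugate, Matrix.mul_assoc, Matrix.mul_assoc,
      Matrix.adjugate_mul, Matrix.det_transpose]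
    simp [smul_smul, sq]
  replace h2 := h3.symm.trans h2
  have h4 := Matrix.ext_iff.mpr h2 j k
  rw [Matrix.smul_apply, smul_eq_mul] at h4
  rw [Module.Basis.det_apply, ← hY, h4]
  rw [Matrix.mul_apply]
  simp [Matrix.mul_apply, Fin.sum_univ_four, Matrix.transpose_apply, hY, Module.Basis.toMatrix_apply, hz]
  ring

theorem exists_cons_det_ne_zero (b : Module.Basis (Fin 4) ℂ W) {v : W} (hv : v ≠ 0) :
    ∃ y : Fin 3 → W, b.det (Fin.cons v y : Fin 4 → W) ≠ 0 := by
  have hli : LinearIndepOn ℂ id ({v} : Set W) := (linearIndepOn_singleton_iff ℂ).2 hv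
  let c := Module.Basis.extend hli
  have hvmem : v ∈ hli.extend (Set.subset_univ _) := hli.subset_extend _ rfl
  let e : hli.extend (Set.subset_univ _) ≃ Fin 4 := c.indexEquiv b
  let c' : Module.Basis (Fin 4) ℂ W := c.reindex (e.trans (Equiv.swap (e ⟨v, hvmem⟩) 0))
  have hc0 : c' 0 = v := by
    simp [c', c, Module.Basis.reindex_apply]
  refine ⟨fun j => c' j.succ, ?_⟩
  have : (Fin.cons v fun j => c' j.succ : Fin 4 → W) = c' := by
    rw [← hc0]; exact Fin.cons_self_tail c'
  rw [this]
  exact (b.isUnit_det c').ne_zero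

/-- The adjugate of the generic Gram matrix is symmetric of rank at most 1 with image spanned by v,
so it equals P·XⱼXₖ. Its entries are cubic minors of quadratic entries, which gives P degree 6 − 2.
-/
theorem exists_kummerQuartic (b : Module.Basis (Fin 4) ℂ W) (w : W →ₗ[ℂ] W →ₗ[ℂ] L)
    (hw : ∀ v, w v v = 0) (Φ : L →ₗ[ℂ] L →ₗ[ℂ] ℂ) (hΦ : ∀ x y, Φ x y = Φ y x) :
    ∃ P : MvPolynomial (Fin 4) ℂ, P.IsHomogeneous 4 ∧ ∀ (v : W) (y : Fin 3 → W),
      (Matrix.of fun i j => Φ (w v (y i)) (w v (y j))).det =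
        MvPolynomial.eval (b.repr v) P * (b.det (Fin.cons v y : Fin 4 → W)) ^ 2 := by
  let M : Matrix (Fin 4) (Fin 4) (MvPolynomial (Fin 4) ℂ) := Matrix.of fun j k =>
    ∑ a, ∑ c, MvPolynomial.C (Φ (w (b a) (b j)) (w (b c) (b k))) *
      (MvPolynomial.X a * MvPolynomial.X c)
  have hMh : ∀ j k, (M j k).IsHomogeneous 2 := fun j k => by
    change (∑ a, ∑ c, MvPolynomial.C (Φ (w (b a) (b j)) (w (b c) (b k))) *
      (MvPolynomial.X a * MvPolynomial.X c)).IsHomogeneous (1 + 1)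
    exact
    MvPolynomial.IsHomogeneous.sum _ _ _ fun a _ => MvPolynomial.IsHomogeneous.sum _ _ _ fun c _ =>
      ((MvPolynomial.isHomogeneous_X _ a).mul (MvPolynomial.isHomogeneous_X _ c)).C_mul _
  have hMe : ∀ v : W, (MvPolynomial.eval (b.repr v)).mapMatrix M = gramAt b w Φ v := by
    intro v
    ext j k
    conv_rhs => rw [gramAt, Matrix.of_apply, ← b.sum_repr v]
    simp only [M, RingHom.mapMatrix_apply, Matrix.map_apply, Matrix.of_apply, map_sum, map_mul,
      MvPolynomial.eval_C, MvPolynomial.eval_X, LinearMap.sum_apply, map_smul,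
      LinearMap.smul_apply, smul_eq_mul, Finset.mul_sum]
    rw [Finset.sum_comm]
    refine Finset.sum_congr rfl fun a _ => Finset.sum_congr rfl fun c _ => by ring
  have hAe : ∀ (v : W) j k, MvPolynomial.eval (b.repr v) (M.adjugate j k) =
      (gramAt b w Φ v).adjugate j k := by
    intro v j k
    rw [← hMe, ← RingHom.map_adjugate]
    rfl
  -- Each column of the adjugate is proportional to the vector of variables; this may be checked
  -- pointwise.
  have hcross : ∀ j k l, M.adjugate j k * MvPolynomial.X l = M.adjugate l k * MvPolynomial.X j := by
    intro j k l
    refine MvPolynomial.funext fun c => ?_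
    obtain ⟨v, rfl⟩ : ∃ v : W, (b.repr v : Fin 4 → ℂ) = c :=
      ⟨b.equivFun.symm c, by rw [← b.equivFun_apply, LinearEquiv.apply_symm_apply]⟩
    rw [map_mul, map_mul, hAe, hAe, MvPolynomial.eval_X, MvPolynomial.eval_X]
    by_cases hv : v = 0
    · simp [hv]
    obtain ⟨y, hy⟩ := exists_cons_det_ne_zero b hv
    have e1 := det_sq_smul_adjugate_gramAt b w hw Φ v y j k
    have e2 := det_sq_smul_adjugate_gramAt b w hw Φ v y l k
    refine mul_left_cancel₀ (pow_ne_zero 2 hy) ?_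
    linear_combination (b.repr v l) * e1 - (b.repr v j) * e2
  have hMs : M.transpose = M := by
    ext1 j k
    simp only [M, Matrix.transpose_apply, Matrix.of_apply]
    rw [Finset.sum_comm]
    refine Finset.sum_congr rfl fun a _ => Finset.sum_congr rfl fun c _ => ?_
    rw [hΦ, mul_comm (MvPolynomial.X a)]
  have hsymm : ∀ j k, M.adjugate j k = M.adjugate k j := by
    intro j k
    conv_lhs => rw [← hMs, ← Matrix.adjugate_transpose]
    rfl
  have hX : ∀ i : Fin 4, (MvPolynomial.X i : MvPolynomial (Fin 4) ℂ) ≠ 0 :=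
    fun i => MvPolynomial.X_ne_zero i
  -- X₃ is prime and does not divide X₀, so the cross relations allow X₃ to be divided out twice.
  have hdvd : ¬ (MvPolynomial.X 3 : MvPolynomial (Fin 4) ℂ) ∣ MvPolynomial.X 0 := by
    rw [MvPolynomial.X_dvd_X]; decide
  have hpr : Prime (MvPolynomial.X 3 : MvPolynomial (Fin 4) ℂ) := MvPolynomial.X_prime
  obtain ⟨g, hg⟩ : (MvPolynomial.X 3 : MvPolynomial (Fin 4) ℂ) ∣ M.adjugate 3 3 :=
    (hpr.dvd_or_dvd ⟨_, (hcross 3 3 0).trans (mul_comm _ _)⟩).resolve_right hdvd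
  have h03 : M.adjugate 0 3 = g * MvPolynomial.X 0 := by
    refine mul_right_cancel₀ (hX 3) ?_
    rw [hcross 0 3 3, hg]; ring
  obtain ⟨P, hP⟩ : (MvPolynomial.X 3 : MvPolynomial (Fin 4) ℂ) ∣ g := by
    have h1 := hcross 3 0 0
    rw [hsymm 3 0, h03] at h1
    have h2 := (hpr.dvd_or_dvd (a := g * MvPolynomial.X 0) ⟨_, h1.trans (mul_comm _ _)⟩).resolve_right hdvd
    exact (hpr.dvd_or_dvd h2).resolve_right hdvd
  have hA : ∀ j k, M.adjugate j k = P * (MvPolynomial.X j * MvPolynomial.X k) := by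
    intro j k
    have h1 := hcross j k 3
    have h2 := hcross k 3 3
    rw [hsymm 3 k] at h1
    refine mul_right_cancel₀ (hX 3) (mul_right_cancel₀ (hX 3) ?_)
    rw [h1, mul_right_comm, h2, hg, hP]
    ring
  refine ⟨P, ?_, ?_⟩
  · have h6 : (M.adjugate 3 3).IsHomogeneous 6 := by
      rw [Matrix.adjugate_fin_succ_eq_det_submatrix, Matrix.det_fin_three]
      have h3 : ∀ a b c d e f : Fin 4, (M a b * M c d * M e f).IsHomogeneous 6 := fun a b c d e f =>
        ((hMh a b).mul (hMh c d)).mul (hMh e f)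
      have : ((-1 : MvPolynomial (Fin 4) ℂ) ^ ((3 : Fin 4) + (3 : Fin 4) : ℕ)) = 1 := by
        norm_num
      rw [this, one_mul]
      simp only [Matrix.submatrix_apply]
      exact (((((h3 _ _ _ _ _ _).sub (h3 _ _ _ _ _ _)).sub (h3 _ _ _ _ _ _)).add
        (h3 _ _ _ _ _ _)).add (h3 _ _ _ _ _ _)).sub (h3 _ _ _ _ _ _)
    rw [hA] at h6
    intro m hm
    -- Multiplication by X₃² shifts exponents, so the degrees of the monomials of P are read off
    -- from those of the adjugate entry.
    have h7 : MvPolynomial.coeff (m + Finsupp.single 3 1 + Finsupp.single 3 1)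
        (P * (MvPolynomial.X 3 * MvPolynomial.X 3)) ≠ 0 := by
      rwa [← mul_assoc, MvPolynomial.coeff_mul_X, MvPolynomial.coeff_mul_X]
    have h8 := h6 h7
    rw [map_add, map_add] at h8
    simp [Finsupp.weight_apply] at h8 ⊢
    omega
  · intro v y
    by_cases hv : v = 0
    · subst hv
      have : b.det (Fin.cons 0 y : Fin 4 → W) = 0 := by
        exact b.det.map_coord_zero (0 : Fin 4) rfl
      rw [this]
      simp [Matrix.det_fin_three]
    obtain ⟨j, hj⟩ : ∃ j, b.repr v j ≠ 0 := by
      by_contra! h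
      exact hv (b.repr.map_eq_zero_iff.1 (Finsupp.ext h))
    have e := det_sq_smul_adjugate_gramAt b w hw Φ v y j j
    rw [← hAe, hA, map_mul, map_mul, MvPolynomial.eval_X] at e
    refine mul_right_cancel₀ (mul_ne_zero hj hj) ?_
    rw [← e]; ring

end Quartic

/-! ### Self-adjoint operators with simple spectrum and their 32 sign vectors -/

section Diagonal

variable {L : Type*} [AddCommGroup L] [Module ℂ L]

/-- `u` is self-adjoint for the nondegenerate symmetric form `B`, with eigenbasis `e` and distinct
eigenvalues `lam`. -/
structure IsDiag (B : L →ₗ[ℂ] L →ₗ[ℂ] ℂ) (u : Module.End ℂ L) (e : Module.Basis (Fin 6) ℂ L)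
    (lam : Fin 6 → ℂ) : Prop where
  symm : ∀ x y, B x y = B y x
  nondeg : ∀ x, (∀ y, B x y = 0) → x = 0
  adj : ∀ x y, B (u x) y = B x (u y)
  eig : ∀ k, u (e k) = lam k • e k
  inj : Function.Injective lam

namespace IsDiag

variable {B : L →ₗ[ℂ] L →ₗ[ℂ] ℂ} {u : Module.End ℂ L} {e : Module.Basis (Fin 6) ℂ L}
  {lam : Fin 6 → ℂ}

theorem ortho (h : IsDiag B u e lam) {j k : Fin 6} (hjk : j ≠ k) : B (e j) (e k) = 0 := by
  have h1 := h.adj (e j) (e k)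
  rw [h.eig, h.eig, map_smul, map_smul, LinearMap.smul_apply, smul_eq_mul, smul_eq_mul] at h1
  have h2 : (lam j - lam k) * B (e j) (e k) = 0 := by rw [sub_mul, h1, sub_self]
  exact (mul_eq_zero.1 h2).resolve_left (sub_ne_zero.2 (h.inj.ne hjk))

theorem apply_eq_sum (h : IsDiag B u e lam) (x y : L) :
    B x y = ∑ k, e.repr x k * e.repr y k * B (e k) (e k) := by
  conv_lhs => rw [← e.sum_repr x, ← e.sum_repr y]
  simp only [map_sum, map_smul, LinearMap.sum_apply, LinearMap.smul_apply, smul_eq_mul]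
  refine Finset.sum_congr rfl fun k _ => ?_
  rw [Finset.sum_eq_single k]
  · ring
  · intro j _ hj
    rw [h.ortho hj, mul_zero]
  · simp

theorem self_ne_zero (h : IsDiag B u e lam) (k : Fin 6) : B (e k) (e k) ≠ 0 := by
  intro hk
  refine e.ne_zero k (h.nondeg _ fun y => ?_)
  rw [h.apply_eq_sum]
  refine Finset.sum_eq_zero fun j _ => ?_
  by_cases hj : j = k
  · rw [hj, hk, mul_zero]
  · simp [Ne.symm hj]

theorem repr_apply (h : IsDiag B u e lam) (x : L) (k : Fin 6) :
    e.repr (u x) k = lam k * e.repr x k := by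
  conv_lhs => rw [← e.sum_repr x]
  simp only [map_sum, map_smul, h.eig, e.repr_self, Finsupp.coe_finsetSum, Finset.sum_apply,
    Finsupp.smul_apply, Finsupp.single_apply, smul_eq_mul]
  simp [mul_comm]

/-- As the spectrum is simple, an eigenvector is a multiple of some `e k`, and B is diagonal in this
basis with nonzero entries. -/
theorem not_isotropic_eigenvector (h : IsDiag B u e lam) {x : L} {μ : ℂ} (hx : x ≠ 0)
    (hu : u x = μ • x) : B x x ≠ 0 := by
  have h1 : ∀ k, (lam k - μ) * e.repr x k = 0 := fun k => by
    rw [sub_mul, ← h.repr_apply, hu]; simp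
  obtain ⟨k, hk⟩ : ∃ k, e.repr x k ≠ 0 := by
    by_contra! hc
    exact hx (e.repr.map_eq_zero_iff.1 (Finsupp.ext hc))
  have hμ : lam k = μ := sub_eq_zero.1 ((mul_eq_zero.1 (h1 k)).resolve_right hk)
  rw [h.apply_eq_sum, Finset.sum_eq_single k]
  · exact mul_ne_zero (mul_ne_zero hk hk) (h.self_ne_zero k)
  · intro j _ hj
    have : e.repr x j = 0 := (mul_eq_zero.1 (h1 j)).resolve_left
      (sub_ne_zero.2 fun hc => hj (h.inj (hc.trans hμ.symm)))
    rw [this]; ring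
  · simp

end IsDiag

/-- The nodal weights of six points. -/
def nodalWt (lam : Fin 6 → ℂ) (k : Fin 6) : ℂ := (∏ j ∈ Finset.univ.erase k, (lam k - lam j))⁻¹

theorem nodalWt_ne_zero {lam : Fin 6 → ℂ} (hl : Function.Injective lam) (k : Fin 6) :
    nodalWt lam k ≠ 0 := by
  refine inv_ne_zero (Finset.prod_ne_zero_iff.2 fun j hj => sub_ne_zero.2 (hl.ne ?_))
  exact (Finset.ne_of_mem_erase hj).symm

/-- By Lagrange interpolation at the six nodes, the sum is the coefficient of X⁵ in Xᵐ. -/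
theorem sum_pow_mul_nodalWt {lam : Fin 6 → ℂ} (hl : Function.Injective lam) {m : ℕ} (hm : m < 6) :
    ∑ k, lam k ^ m * nodalWt lam k = if m = 5 then 1 else 0 := by
  have h := Lagrange.coeff_eq_sum (s := (Finset.univ : Finset (Fin 6))) (v := lam) hl.injOn
    (P := Polynomial.X ^ m) (by
      rw [Polynomial.degree_X_pow]; simpa using hm)
  simp only [Finset.card_univ, Fintype.card_fin, Polynomial.coeff_X_pow, Polynomial.eval_pow,
    Polynomial.eval_X, div_eq_mul_inv] at h
  rw [show (6 - 1 : ℕ) = 5 from rfl] at h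
  rw [show (∑ k, lam k ^ m * nodalWt lam k) = _ from h.symm]
  simp [eq_comm]

theorem eq_zero_of_sum_pow_mul {n : ℕ} {lam c : Fin n → ℂ} (hl : Function.Injective lam)
    (h : ∀ m < n, ∑ k, lam k ^ m * c k = 0) : c = 0 := by
  have hdet : (Matrix.vandermonde lam).transpose.det ≠ 0 := by
    rw [Matrix.det_transpose]; exact Matrix.det_vandermonde_ne_zero_iff.2 hl
  refine Matrix.eq_zero_of_mulVec_eq_zero hdet ?_
  funext m
  simpa [Matrix.mulVec, dotProduct, Matrix.vandermonde_apply] using h m m.2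

/-- The first five moments cut out a line, since the 6 × 6 Vandermonde matrix is invertible. The
nodal weights lie on it with fifth moment 1, so the factor is the fifth moment of c. -/
theorem eq_mul_nodalWt {lam c : Fin 6 → ℂ} (hl : Function.Injective lam)
    (h : ∀ m < 5, ∑ k, lam k ^ m * c k = 0) : ∃ s, ∀ k, c k = s * nodalWt lam k := by
  refine ⟨∑ k, lam k ^ 5 * c k, fun k => ?_⟩
  set s := ∑ k, lam k ^ 5 * c k with hs
  have : (fun k => c k - s * nodalWt lam k) = 0 := by
    refine eq_zero_of_sum_pow_mul hl fun m hm => ?_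
    have e1 : ∑ k, lam k ^ m * (c k - s * nodalWt lam k) =
        ∑ k, lam k ^ m * c k - s * ∑ k, lam k ^ m * nodalWt lam k := by
      rw [Finset.mul_sum, ← Finset.sum_sub_distrib]
      exact Finset.sum_congr rfl fun j _ => by ring
    rw [e1, sum_pow_mul_nodalWt hl hm]
    split_ifs with h5
    · rw [h5, ← hs]; ring
    · rw [h m (by omega)]; ring
  exact sub_eq_zero.1 (congrFun this k)

/-- A quadratic polynomial vanishing at three distinct points vanishes. -/
theorem quadratic_eq_zero {lam : Fin 6 → ℂ} (hl : Function.Injective lam) {a b c : ℂ}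
    (h : ∀ k, a + b * lam k + c * lam k ^ 2 = 0) : a = 0 ∧ b = 0 ∧ c = 0 := by
  have h01 : lam 0 - lam 1 ≠ 0 := sub_ne_zero.2 (hl.ne (by decide))
  have h02 : lam 0 - lam 2 ≠ 0 := sub_ne_zero.2 (hl.ne (by decide))
  have h12 : lam 1 - lam 2 ≠ 0 := sub_ne_zero.2 (hl.ne (by decide))
  have e1 : b + c * (lam 0 + lam 1) = 0 := mul_left_cancel₀ h01 (by linear_combination h 0 - h 1)
  have e2 : b + c * (lam 0 + lam 2) = 0 := mul_left_cancel₀ h02 (by linear_combination h 0 - h 2)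
  have hc : c = 0 := mul_left_cancel₀ h12 (by linear_combination e1 - e2)
  subst hc
  have hb : b = 0 := by linear_combination e1
  subst hb
  exact ⟨by linear_combination h 0, rfl, rfl⟩

/-- Six signs, the first of which is `1`. -/
def signs (ε : Fin 5 → ℤˣ) : Fin 6 → ℂ := Fin.cons 1 fun i => ((ε i : ℤ) : ℂ)

theorem signs_sq (ε : Fin 5 → ℤˣ) (k : Fin 6) : signs ε k ^ 2 = 1 := by
  refine Fin.cases ?_ (fun i => ?_) k
  · simp [signs]
  · simp only [signs, Fin.cons_succ]
    rcases Int.units_eq_one_or (ε i) with h | h <;> rw [h] <;> simp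

theorem signs_injective : Function.Injective signs := by
  intro ε ε' h
  funext i
  have := congrFun h i.succ
  simp only [signs, Fin.cons_succ] at this
  exact Units.ext (by exact_mod_cast this)

theorem exists_signs {s : Fin 6 → ℂ} (h0 : s 0 = 1) (hs : ∀ k, s k ^ 2 = 1) :
    ∃ ε, s = signs ε := by
  refine ⟨fun i => if s i.succ = 1 then 1 else -1, ?_⟩
  funext k
  refine Fin.cases ?_ (fun i => ?_) k
  · simp [signs, h0]
  · simp only [signs, Fin.cons_succ]
    rcases (sq_eq_sq_iff_eq_or_eq_neg.1 ((hs i.succ).trans (one_pow 2).symm)) with h | h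
    · simp [h]
    · have : (-1 : ℂ) ≠ 1 := by norm_num
      simp [h, this]

/-- Change of the second of six signs. -/
def flip (ε : Fin 5 → ℤˣ) : Fin 5 → ℤˣ := Function.update ε 0 (-ε 0)

theorem flip_flip (ε : Fin 5 → ℤˣ) : flip (flip ε) = ε := by
  simp [flip]

theorem signs_flip_of_ne (ε : Fin 5 → ℤˣ) {k : Fin 6} (hk : k ≠ 1) :
    signs (flip ε) k = signs ε k := by
  revert hk
  refine Fin.cases ?_ (fun i => ?_) k
  · simp [signs]
  · intro hi
    have : i ≠ 0 := by rintro rfl; exact hi rfl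
    simp [signs, flip, this]

theorem flip_ne (ε : Fin 5 → ℤˣ) : flip ε ≠ ε := by
  intro h
  have := congrFun h 0
  simp only [flip, Function.update_self] at this
  rcases Int.units_eq_one_or (ε 0) with h | h <;> rw [h] at this <;> revert this <;> decide

/-- A square root of `nodalWt lam k / B (e k) (e k)`. -/
def rootWt (B : L →ₗ[ℂ] L →ₗ[ℂ] ℂ) (e : Module.Basis (Fin 6) ℂ L) (lam : Fin 6 → ℂ) (k : Fin 6) : ℂ :=
  (IsAlgClosed.exists_pow_nat_eq (nodalWt lam k / B (e k) (e k)) (n := 2) two_pos).choose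

/-- The vectors generating the isotropic planes `⟨x, u x, u² x⟩`. -/
def nodeVec (B : L →ₗ[ℂ] L →ₗ[ℂ] ℂ) (e : Module.Basis (Fin 6) ℂ L) (lam : Fin 6 → ℂ)
    (ε : Fin 5 → ℤˣ) : L :=
  ∑ k, (signs ε k * rootWt B e lam k) • e k

theorem repr_nodeVec (B : L →ₗ[ℂ] L →ₗ[ℂ] ℂ) (e : Module.Basis (Fin 6) ℂ L) (lam : Fin 6 → ℂ)
    (ε : Fin 5 → ℤˣ) (k : Fin 6) :
    e.repr (nodeVec B e lam ε) k = signs ε k * rootWt B e lam k := by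
  simp only [nodeVec, map_sum, map_smul, e.repr_self, Finsupp.coe_finsetSum, Finset.sum_apply,
    Finsupp.smul_apply, Finsupp.single_apply, smul_eq_mul]
  simp

namespace IsDiag

variable {B : L →ₗ[ℂ] L →ₗ[ℂ] ℂ} {u : Module.End ℂ L} {e : Module.Basis (Fin 6) ℂ L}
  {lam : Fin 6 → ℂ}

theorem rootWt_sq (h : IsDiag B u e lam) (k : Fin 6) :
    rootWt B e lam k ^ 2 * B (e k) (e k) = nodalWt lam k := by
  rw [rootWt, (IsAlgClosed.exists_pow_nat_eq (nodalWt lam k / B (e k) (e k)) two_pos).choose_spec]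
  exact div_mul_cancel₀ _ (h.self_ne_zero k)

theorem rootWt_ne_zero (h : IsDiag B u e lam) (k : Fin 6) : rootWt B e lam k ≠ 0 := by
  intro hk
  have := h.rootWt_sq k
  rw [hk] at this
  exact nodalWt_ne_zero h.inj k (by rw [← this]; ring)

theorem repr_nodeVec_ne_zero (h : IsDiag B u e lam) (ε : Fin 5 → ℤˣ) (k : Fin 6) :
    e.repr (nodeVec B e lam ε) k ≠ 0 := by
  rw [repr_nodeVec]
  refine mul_ne_zero (fun hc => ?_) (h.rootWt_ne_zero k)
  have := signs_sq ε k
  rw [hc] at this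
  norm_num at this

theorem repr_pow_apply (h : IsDiag B u e lam) (m : ℕ) (x : L) (k : Fin 6) :
    e.repr ((u ^ m) x) k = lam k ^ m * e.repr x k := by
  induction m with
  | zero => simp
  | succ m ih => rw [pow_succ', Module.End.mul_apply, h.repr_apply, ih]; ring

/-- The squared coordinates weighted by B are the nodal weights. The value 1 at m = 5 later makes
the double points ordinary. -/
theorem isotropic_nodeVec (h : IsDiag B u e lam) (ε : Fin 5 → ℤˣ) {m : ℕ} (hm : m < 6) :
    B ((u ^ m) (nodeVec B e lam ε)) (nodeVec B e lam ε) = if m = 5 then 1 else 0 := by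
  rw [h.apply_eq_sum, ← sum_pow_mul_nodalWt h.inj hm]
  refine Finset.sum_congr rfl fun k _ => ?_
  rw [h.repr_pow_apply, repr_nodeVec, ← h.rootWt_sq]
  linear_combination (lam k ^ m * rootWt B e lam k ^ 2 * B (e k) (e k)) * signs_sq ε k

/-- The five conditions are moment equations for the weighted squares of the coordinates of x, so
these squares are known up to one common factor and only signs remain free. -/
theorem exists_eq_smul_nodeVec (h : IsDiag B u e lam) {x : L} (hx : x ≠ 0)
    (hB : ∀ m < 5, B ((u ^ m) x) x = 0) : ∃ ε, ∃ c : ℂ, c ≠ 0 ∧ x = c • nodeVec B e lam ε := by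
  obtain ⟨s, hs⟩ := eq_mul_nodalWt (c := fun k => e.repr x k ^ 2 * B (e k) (e k)) h.inj (by
    intro m hm
    rw [← hB m hm, h.apply_eq_sum]
    refine Finset.sum_congr rfl fun k _ => ?_
    rw [h.repr_pow_apply]; ring)
  have hs2 : ∀ k, e.repr x k ^ 2 = s * rootWt B e lam k ^ 2 := fun k => by
    refine mul_right_cancel₀ (h.self_ne_zero k) ?_
    rw [hs k, mul_assoc, h.rootWt_sq]
  have hs0 : s ≠ 0 := by
    rintro rfl
    refine hx (e.repr.map_eq_zero_iff.1 (Finsupp.ext fun k => ?_))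
    have := hs2 k
    rw [zero_mul] at this
    simpa using this
  have hx0 : e.repr x 0 ≠ 0 := by
    intro hc
    have := hs2 0
    rw [hc, zero_pow two_ne_zero] at this
    exact mul_ne_zero hs0 (pow_ne_zero 2 (h.rootWt_ne_zero 0)) this.symm
  -- Of the two square roots of s, this one makes the first sign equal to 1.
  set c := e.repr x 0 / rootWt B e lam 0 with hc
  have hc2 : c ^ 2 = s := by
    rw [hc, div_pow, hs2, mul_div_assoc, div_self (pow_ne_zero 2 (h.rootWt_ne_zero 0)), mul_one]
  have hc0 : c ≠ 0 := div_ne_zero hx0 (h.rootWt_ne_zero 0)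
  obtain ⟨ε, hε⟩ := exists_signs (s := fun k => e.repr x k / (c * rootWt B e lam k)) (by
      have := h.rootWt_ne_zero 0
      rw [hc]; field_simp) (fun k => by
      have := h.rootWt_ne_zero k
      rw [div_pow, hs2, mul_pow, hc2]
      exact div_self (mul_ne_zero hs0 (pow_ne_zero 2 this)))
  refine ⟨ε, c, hc0, e.repr.injective (Finsupp.ext fun k => ?_)⟩
  rw [map_smul, Finsupp.smul_apply, repr_nodeVec, ← hε, smul_eq_mul]
  have := h.rootWt_ne_zero k
  field_simp

theorem linearIndependent_nodeVec (h : IsDiag B u e lam) (ε : Fin 5 → ℤˣ) {a b c : ℂ}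
    (h0 : a • nodeVec B e lam ε + b • u (nodeVec B e lam ε) + c • u (u (nodeVec B e lam ε)) = 0) :
    a = 0 ∧ b = 0 ∧ c = 0 := by
  refine quadratic_eq_zero h.inj fun k => ?_
  have h1 := congrArg (fun x => e.repr x k) h0
  simp only [map_add, map_smul, Finsupp.add_apply, Finsupp.smul_apply, h.repr_apply, smul_eq_mul,
    map_zero, Finsupp.zero_apply] at h1
  refine mul_right_cancel₀ (h.repr_nodeVec_ne_zero ε k) ?_
  linear_combination h1

/-- The operator u − λ₁ kills the `e 1` component, the only one that the flip changes. Hence the two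
isotropic planes share the pencil spanned by n = (u − λ₁)x and u n. -/
theorem sub_smul_nodeVec_flip (h : IsDiag B u e lam) (ε : Fin 5 → ℤˣ) :
    u (nodeVec B e lam (flip ε)) - lam 1 • nodeVec B e lam (flip ε) =
      u (nodeVec B e lam ε) - lam 1 • nodeVec B e lam ε := by
  refine e.repr.injective (Finsupp.ext fun k => ?_)
  simp only [map_sub, map_smul, Finsupp.sub_apply, Finsupp.smul_apply, h.repr_apply, smul_eq_mul,
    repr_nodeVec]
  by_cases hk : k = 1
  · subst hk; ring
  · rw [signs_flip_of_ne ε hk]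

/-- The plane `⟨x, u x, u² x⟩` determines the signs of `x`. -/
theorem eq_of_mem_span (h : IsDiag B u e lam) {ε ε' : Fin 5 → ℤˣ} {a b c : ℂ}
    (h0 : nodeVec B e lam ε' =
      a • nodeVec B e lam ε + b • u (nodeVec B e lam ε) + c • u (u (nodeVec B e lam ε))) :
    ε' = ε := by
  have h1 : ∀ k, signs ε' k = (a + b * lam k + c * lam k ^ 2) * signs ε k := by
    intro k
    have h1 := congrArg (fun x => e.repr x k) h0
    simp only [map_add, map_smul, Finsupp.add_apply, Finsupp.smul_apply, h.repr_apply, smul_eq_mul,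
      repr_nodeVec] at h1
    refine mul_right_cancel₀ (h.rootWt_ne_zero k) ?_
    linear_combination h1
  have h2 : ∀ k, (a + b * lam k + c * lam k ^ 2) ^ 2 = 1 := fun k => by
    have := signs_sq ε' k
    rw [h1, mul_pow, signs_sq, mul_one] at this
    exact this
  let p : Polynomial ℂ := (Polynomial.C a + Polynomial.C b * Polynomial.X +
    Polynomial.C c * Polynomial.X ^ 2)
  have hp : p.natDegree ≤ 2 := by simp only [p]; compute_degree
  -- The quotients of the two sign vectors are the values of the quadratic p at the eigenvalues, so
  -- p² − 1 has degree at most 4 and six roots. Hence p = ±1, and the first sign decides.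
  have hp2 : (p - 1) * (p + 1) = 0 := by
    refine Polynomial.eq_zero_of_natDegree_lt_card_of_eval_eq_zero _ h.inj (fun k => ?_) ?_
    · have : p.eval (lam k) = a + b * lam k + c * lam k ^ 2 := by simp [p]
      rw [Polynomial.eval_mul, Polynomial.eval_sub, Polynomial.eval_add (p := p), this, Polynomial.eval_one]
      linear_combination h2 k
    · refine lt_of_le_of_lt (Polynomial.natDegree_mul_le.trans (add_le_add
        ((Polynomial.natDegree_sub_le _ _).trans (max_le hp ?_))
        ((Polynomial.natDegree_add_le _ _).trans (max_le hp ?_)))) (?_ : 2 + 2 < _) <;> simp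
  have h3 : ∃ s : ℂ, ∀ k, signs ε' k = s * signs ε k := by
    rcases mul_eq_zero.1 hp2 with hq | hq
    · refine ⟨1, fun k => ?_⟩
      rw [h1]
      have := congrArg (Polynomial.eval (lam k)) (sub_eq_zero.1 hq)
      simp only [p, Polynomial.eval_add, Polynomial.eval_mul, Polynomial.eval_C, Polynomial.eval_X,
        Polynomial.eval_pow, Polynomial.eval_one] at this
      rw [this]
    · refine ⟨-1, fun k => ?_⟩
      rw [h1]
      have := congrArg (Polynomial.eval (lam k)) (eq_neg_of_add_eq_zero_left hq)
      simp only [p, Polynomial.eval_add, Polynomial.eval_mul, Polynomial.eval_C, Polynomial.eval_X,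
        Polynomial.eval_pow, Polynomial.eval_one, Polynomial.eval_neg] at this
      rw [this]
  obtain ⟨s, hs⟩ := h3
  have hs1 : s = 1 := by
    have := hs 0
    simpa [signs] using this.symm
  refine signs_injective (funext fun k => ?_)
  rw [hs k, hs1, one_mul]

end IsDiag
end Diagonal

/-! ### Line geometry of a 3-space on the Plücker quadric -/

section Plucker

variable {W L : Type*} [AddCommGroup W] [Module ℂ W] [AddCommGroup L] [Module ℂ L]

theorem exists_linearIndependent_cons [FiniteDimensional ℂ W] {n : ℕ}
    (hn : n < Module.finrank ℂ W) {v : Fin n → W} (hv : LinearIndependent ℂ v) :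
    ∃ x, LinearIndependent ℂ (Matrix.vecCons x v) := by
  obtain ⟨x, hx⟩ : ∃ x, x ∉ Submodule.span ℂ (Set.range v) := by
    by_contra! h
    have h1 : Submodule.span ℂ (Set.range v) = ⊤ := Submodule.eq_top_iff'.2 h
    have h2 := finrank_range_le_card (R := ℂ) v
    rw [Set.finrank, h1, finrank_top, Fintype.card_fin] at h2
    omega
  exact ⟨x, linearIndependent_finCons.2 ⟨hv, hx⟩⟩

/-- `w : W × W → L` is a second exterior power of the four-dimensional space `W`, with the wedge
pairing `B` normalized by the basis `b`. -/
structure IsPlucker (b : Module.Basis (Fin 4) ℂ W) (w : W →ₗ[ℂ] W →ₗ[ℂ] L)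
    (B : L →ₗ[ℂ] L →ₗ[ℂ] ℂ) : Prop where
  self : ∀ v, w v v = 0
  pair : ∀ a c d e, B (w a c) (w d e) = b.det ![a, c, d, e]
  span : Submodule.span ℂ {x | ∃ a c, x = w a c} = ⊤

theorem det_ne_zero_of_linearIndependent (b : Module.Basis (Fin 4) ℂ W) {z : Fin 4 → W}
    (hz : LinearIndependent ℂ z) : b.det z ≠ 0 := by
  have h := (Module.Basis.is_basis_iff_det b (v := z)).1 ⟨hz, hz.span_eq_top_of_card_eq_finrank (by
    rw [Module.finrank_eq_card_basis b])⟩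
  exact h.ne_zero

theorem linearIndependent_of_det_ne_zero (b : Module.Basis (Fin 4) ℂ W) {z : Fin 4 → W}
    (hz : b.det z ≠ 0) : LinearIndependent ℂ z :=
  ((Module.Basis.is_basis_iff_det b (v := z)).2 (isUnit_iff_ne_zero.2 hz)).1

namespace IsPlucker

variable {b : Module.Basis (Fin 4) ℂ W} {w : W →ₗ[ℂ] W →ₗ[ℂ] L} {B : L →ₗ[ℂ] L →ₗ[ℂ] ℂ}

theorem swap (h : IsPlucker b w B) (a c : W) : w a c = -w c a := by
  have h1 := h.self (a + c)
  simp only [map_add, LinearMap.add_apply, h.self, zero_add, add_zero] at h1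
  exact eq_neg_of_add_eq_zero_right h1

theorem ext_linearMap {M : Type*} [AddCommGroup M] [Module ℂ M] (h : IsPlucker b w B)
    {f g : L →ₗ[ℂ] M} (hfg : ∀ a c, f (w a c) = g (w a c)) : f = g := by
  refine LinearMap.ext_on h.span ?_
  rintro _ ⟨a, c, rfl⟩
  exact hfg a c

theorem symm (h : IsPlucker b w B) (x y : L) : B x y = B y x := by
  have : B = B.flip := by
    refine h.ext_linearMap fun a c => h.ext_linearMap fun d e => ?_
    rw [LinearMap.flip_apply, h.pair, h.pair]
    have h1 := b.det.map_swap ![a, c, d, e] (i := 0) (j := 2) (by decide)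
    have h2 := b.det.map_swap (![a, c, d, e] ∘ Equiv.swap (0 : Fin 4) 2) (i := 1) (j := 3) (by decide)
    have h3 : (![a, c, d, e] ∘ Equiv.swap (0 : Fin 4) 2) ∘ Equiv.swap (1 : Fin 4) 3 = ![d, e, a, c] := by
      funext k
      fin_cases k <;> rfl
    rw [h3, h1, neg_neg] at h2
    exact h2.symm
  conv_lhs => rw [this]
  rfl

/-- Plücker coordinates with respect to a basis `z`. -/
theorem expand (h : IsPlucker b w B) {z : Fin 4 → W} (hz : b.det z ≠ 0) (x : L) :
    b.det z • x = B x (w (z 2) (z 3)) • w (z 0) (z 1) - B x (w (z 1) (z 3)) • w (z 0) (z 2) +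
      B x (w (z 1) (z 2)) • w (z 0) (z 3) + B x (w (z 0) (z 3)) • w (z 1) (z 2) -
      B x (w (z 0) (z 2)) • w (z 1) (z 3) + B x (w (z 0) (z 1)) • w (z 2) (z 3) := by
  obtain ⟨b', hb'⟩ : ∃ b' : Module.Basis (Fin 4) ℂ W, ⇑b' = z :=
    ⟨Module.Basis.mk (linearIndependent_of_det_ne_zero b hz)
      ((Module.Basis.is_basis_iff_det b (v := z)).2 (isUnit_iff_ne_zero.2 hz)).2.ge, Module.Basis.coe_mk _ _⟩
  subst hb'
  have hD : ∀ i j k l, B (w (b' i) (b' j)) (w (b' k) (b' l)) =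
      b.det b' * b'.det ![b' i, b' j, b' k, b' l] := by
    intro i j k l
    rw [h.pair]
    conv_lhs => rw [AlternatingMap.eq_smul_basis_det b' b.det]
    rfl
  have sw01 : ∀ x y s t, b'.det ![x, y, s, t] = - b'.det ![y, x, s, t] := fun x y s t => by
    rw [← b'.det.map_swap ![y, x, s, t] (i := 0) (j := 1) (by decide)]
    congr 1; funext k; fin_cases k <;> rfl
  have sw12 : ∀ x y s t, b'.det ![x, y, s, t] = - b'.det ![x, s, y, t] := fun x y s t => by
    rw [← b'.det.map_swap ![x, s, y, t] (i := 1) (j := 2) (by decide)]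
    congr 1; funext k; fin_cases k <;> rfl
  have sw23 : ∀ x y s t, b'.det ![x, y, s, t] = - b'.det ![x, y, t, s] := fun x y s t => by
    rw [← b'.det.map_swap ![x, y, t, s] (i := 2) (j := 3) (by decide)]
    congr 1; funext k; fin_cases k <;> rfl
  have z02 : ∀ x y s, b'.det ![x, y, x, s] = 0 := fun x y s =>
    b'.det.map_eq_zero_of_eq _ (i := 0) (j := 2) rfl (by decide)
  have z03 : ∀ x y s, b'.det ![x, y, s, x] = 0 := fun x y s =>
    b'.det.map_eq_zero_of_eq _ (i := 0) (j := 3) rfl (by decide)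
  have z12 : ∀ x y s, b'.det ![x, y, y, s] = 0 := fun x y s =>
    b'.det.map_eq_zero_of_eq _ (i := 1) (j := 2) rfl (by decide)
  have z13 : ∀ x y s, b'.det ![x, y, s, y] = 0 := fun x y s =>
    b'.det.map_eq_zero_of_eq _ (i := 1) (j := 3) rfl (by decide)
  have d0123 : b'.det ![b' 0, b' 1, b' 2, b' 3] = 1 := by
    rw [← b'.det_self]
    congr 1; funext k; fin_cases k <;> rfl
  have d0213 : b'.det ![b' 0, b' 2, b' 1, b' 3] = -1 := by rw [sw12, d0123]
  have d0312 : b'.det ![b' 0, b' 3, b' 1, b' 2] = 1 := by rw [sw12, sw23, d0123, neg_neg]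
  have d1203 : b'.det ![b' 1, b' 2, b' 0, b' 3] = 1 := by rw [sw12, sw01, d0123, neg_neg]
  have d1302 : b'.det ![b' 1, b' 3, b' 0, b' 2] = -1 := by
    rw [sw12, sw01, sw23, d0123, neg_neg]
  have d2301 : b'.det ![b' 2, b' 3, b' 0, b' 1] = 1 := by
    rw [sw12, sw01, sw23, sw12, d0123, neg_neg, neg_neg]
  let f (i j k l : Fin 4) : L →ₗ[ℂ] L := (B.flip (w (b' i) (b' j))).smulRight (w (b' k) (b' l))
  -- Both sides are linear in x, so they need only be compared on the six products of basis vectors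
  -- with increasing indices.
  suffices hfg : (b.det b') • (LinearMap.id : L →ₗ[ℂ] L) = f 2 3 0 1 - f 1 3 0 2 + f 1 2 0 3 +
      f 0 3 1 2 - f 0 2 1 3 + f 0 1 2 3 from DFunLike.congr_fun hfg x
  refine h.ext_linearMap fun a c => ?_
  suffices hw : w.compr₂ ((b.det b') • (LinearMap.id : L →ₗ[ℂ] L)) = w.compr₂ (f 2 3 0 1 -
      f 1 3 0 2 + f 1 2 0 3 + f 0 3 1 2 - f 0 2 1 3 + f 0 1 2 3) from
    DFunLike.congr_fun (DFunLike.congr_fun hw a) c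
  have hanti : ∀ (g : L →ₗ[ℂ] L) (i j : Fin 4), g (w (b' i) (b' j)) = - g (w (b' j) (b' i)) :=
    fun g i j => by rw [h.swap, map_neg]
  refine b'.ext fun i => b'.ext fun j => ?_
  simp only [LinearMap.compr₂_apply]
  wlog hij : i ≤ j generalizing i j
  · rw [hanti _ i j, hanti (_ + _) i j, this j i (le_of_not_ge hij)]
  rcases hij.eq_or_lt with rfl | hij
  · rw [h.self, map_zero, map_zero]
  have hf : ∀ i j k l x, f i j k l x = B x (w (b' i) (b' j)) • w (b' k) (b' l) :=
    fun _ _ _ _ _ => rfl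
  have hcase : (i = 0 ∧ j = 1) ∨ (i = 0 ∧ j = 2) ∨ (i = 0 ∧ j = 3) ∨ (i = 1 ∧ j = 2) ∨
      (i = 1 ∧ j = 3) ∨ (i = 2 ∧ j = 3) := by
    revert i j; decide
  simp only [LinearMap.add_apply, LinearMap.sub_apply, hf, hD, LinearMap.smul_apply,
    LinearMap.id_apply]
  rcases hcase with ⟨rfl, rfl⟩ | ⟨rfl, rfl⟩ | ⟨rfl, rfl⟩ | ⟨rfl, rfl⟩ | ⟨rfl, rfl⟩ | ⟨rfl, rfl⟩ <;>
    simp only [z02, z03, z12, z13, d0123, d0213, d0312, d1203, d1302, d2301, mul_zero, zero_smul,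
      mul_one, mul_neg, neg_smul, sub_zero, add_zero, zero_add, zero_sub, neg_neg]

theorem nondeg (h : IsPlucker b w B) {x : L} (hx : ∀ y, B x y = 0) : x = 0 := by
  have h1 := h.expand (z := b) (by rw [b.det_self]; exact one_ne_zero) x
  rw [b.det_self] at h1
  simpa [hx] using h1

theorem linearIndependent_of_wedge_ne_zero (h : IsPlucker b w B) {c d : W} (hcd : w c d ≠ 0) :
    LinearIndependent ℂ ![c, d] := by
  have hc : c ≠ 0 := by rintro rfl; exact hcd (by simp)
  rw [LinearIndependent.pair_iff' hc]
  rintro a rfl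
  exact hcd (by rw [map_smul, h.self, smul_zero])

theorem exists_det_ne_zero_two (b : Module.Basis (Fin 4) ℂ W) {v a : W}
    (hva : LinearIndependent ℂ ![v, a]) : ∃ y z, b.det ![v, a, y, z] ≠ 0 := by
  have : Module.Finite ℂ W := Module.Finite.of_basis b
  have hr : Module.finrank ℂ W = 4 := by simpa using Module.finrank_eq_card_basis b
  obtain ⟨z, hz⟩ := exists_linearIndependent_cons (by rw [hr]; norm_num) hva
  obtain ⟨y, hy⟩ := exists_linearIndependent_cons (by rw [hr]; norm_num) hz
  refine ⟨y, z, det_ne_zero_of_linearIndependent b ?_⟩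
  have := hy.comp (![2, 3, 0, 1] : Fin 4 → Fin 4) (by decide)
  convert this using 1
  funext k; fin_cases k <;> rfl

theorem exists_det_ne_zero_three (b : Module.Basis (Fin 4) ℂ W) {v a c : W}
    (hva : LinearIndependent ℂ ![v, a, c]) : ∃ d, b.det ![v, a, c, d] ≠ 0 := by
  have : Module.Finite ℂ W := Module.Finite.of_basis b
  have hr : Module.finrank ℂ W = 4 := by simpa using Module.finrank_eq_card_basis b
  obtain ⟨y, hy⟩ := exists_linearIndependent_cons (by rw [hr]; norm_num) hva
  refine ⟨y, det_ne_zero_of_linearIndependent b ?_⟩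
  have := hy.comp (![1, 2, 3, 0] : Fin 4 → Fin 4) (by decide)
  convert this using 1
  funext k; fin_cases k <;> rfl

theorem exists_det_ne_zero_one (b : Module.Basis (Fin 4) ℂ W) {v : W} (hv : v ≠ 0) :
    ∃ a c d, b.det ![v, a, c, d] ≠ 0 := by
  obtain ⟨y, hy⟩ := exists_cons_det_ne_zero b hv
  refine ⟨y 0, y 1, y 2, ?_⟩
  convert hy using 2
  funext k; fin_cases k <;> rfl

theorem exists_eq_smul (h : IsPlucker b w B) {v y : W} (hv : v ≠ 0) (hy : w v y = 0) :
    ∃ c : ℂ, y = c • v := by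
  by_contra! hc
  have hli : LinearIndependent ℂ ![v, y] := (LinearIndependent.pair_iff' hv).2 fun a ha => hc a ha.symm
  obtain ⟨s, t, hst⟩ := exists_det_ne_zero_two b hli
  rw [← h.pair, hy, map_zero, LinearMap.zero_apply] at hst
  exact hst rfl

theorem exists_eq_add (b : Module.Basis (Fin 4) ℂ W) {v a c : W} (hva : LinearIndependent ℂ ![v, a])
    (hd : ∀ y, b.det ![v, a, c, y] = 0) : ∃ s t : ℂ, c = s • v + t • a := by
  by_contra! hc
  have hli : LinearIndependent ℂ ![c, v, a] := by
    refine linearIndependent_finCons.2 ⟨hva, fun hm => ?_⟩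
    rw [Matrix.range_cons, Matrix.range_cons, Matrix.range_empty, Set.union_empty,
      Set.singleton_union, Submodule.mem_span_pair] at hm
    obtain ⟨s, t, hst⟩ := hm
    exact hc s t hst.symm
  obtain ⟨d, hd'⟩ := exists_det_ne_zero_three b (v := v) (a := a) (c := c) (by
    have := hli.comp (![1, 2, 0] : Fin 3 → Fin 3) (by decide)
    convert this using 1
    funext k; fin_cases k <;> rfl)
  exact hd' (hd d)

/-- The space `v ∧ W` is its own orthogonal complement. -/
theorem exists_eq_wedge (h : IsPlucker b w B) {v : W} {x : L} (hv : v ≠ 0)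
    (hx : ∀ y, B x (w v y) = 0) : ∃ z, x = w v z := by
  obtain ⟨p, q, r, hd⟩ := exists_det_ne_zero_one b hv
  have h1 := h.expand hd x
  set δ := b.det ![v, p, q, r]
  simp only [Matrix.cons_val] at h1
  rw [hx, hx, hx, zero_smul, zero_smul, zero_smul, sub_zero, add_zero, add_zero] at h1
  refine ⟨δ⁻¹ • (B x (w q r) • p - B x (w p r) • q + B x (w p q) • r), ?_⟩
  rw [map_smul, map_add, map_sub, map_smul, map_smul, map_smul, ← h1, smul_smul, inv_mul_cancel₀ hd,
    one_smul]

theorem wedge_wedge (h : IsPlucker b w B) (v y z : W) : B (w v y) (w v z) = 0 := by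
  rw [h.pair]
  exact b.det.map_eq_zero_of_eq _ (i := 0) (j := 2) rfl (by decide)

/-- With a nonzero Plücker coordinate at hand, the Plücker relation B(x, x) = 0 allows x to be
factored explicitly. -/
theorem exists_wedge_of_isotropic (h : IsPlucker b w B) {x : L} (hx : x ≠ 0) (hxx : B x x = 0) :
    ∃ p q, x = w p q := by
  obtain ⟨c, d, hcd⟩ : ∃ c d, B x (w c d) ≠ 0 := by
    by_contra! hc
    refine hx (h.nondeg fun y => ?_)
    have : B x = 0 := h.ext_linearMap fun a c => by rw [hc]; rfl
    rw [this]; rfl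
  obtain ⟨p, q, hd⟩ := exists_det_ne_zero_two b
    (h.linearIndependent_of_wedge_ne_zero (c := c) (d := d) fun h0 => hcd (by rw [h0, map_zero]))
  have h1 := h.expand hd x
  have h2 := congrArg (fun t => B t x) h1
  set δ := b.det ![c, d, p, q]
  simp only [Matrix.cons_val] at h1 h2
  simp only [map_add, map_sub, map_smul, LinearMap.add_apply, LinearMap.sub_apply,
    LinearMap.smul_apply, smul_eq_mul, hxx, h.symm _ x] at h2
  set C01 := B x (w c d)
  set C02 := B x (w c p)
  set C03 := B x (w c q)
  set C12 := B x (w d p)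
  set C13 := B x (w d q)
  set C23 := B x (w p q)
  -- The Plücker relation, obtained by pairing the expansion of x with x itself.
  have h3 : C23 * C01 = C13 * C02 - C12 * C03 := by linear_combination -(1 / 2 : ℂ) * h2
  have h4 : (C01 * δ) • x = w (C01 • p + C12 • c - C02 • d) (C01 • q + C13 • c - C03 • d) := by
    simp only [map_add, map_sub, map_smul, LinearMap.add_apply, LinearMap.sub_apply,
      LinearMap.smul_apply, h.self, h.swap p c, h.swap p d, h.swap d c]
    linear_combination (norm := module) C01 • h1 + h3 • w c d
  have h5 : C01 * δ ≠ 0 := mul_ne_zero hcd hd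
  refine ⟨(C01 * δ)⁻¹ • (C01 • p + C12 • c - C02 • d), C01 • q + C13 • c - C03 • d, ?_⟩
  rw [map_smul, LinearMap.smul_apply, ← h4, smul_smul, inv_mul_cancel₀ h5, one_smul]

theorem exists_wedge_of_mem (h : IsPlucker b w B) {p q : W} {s t : ℂ} (hv : s • p + t • q ≠ 0) :
    ∃ a, w p q = w (s • p + t • q) a := by
  by_cases hs : s = 0
  · subst hs
    have ht : t ≠ 0 := by rintro rfl; exact hv (by simp)
    refine ⟨-t⁻¹ • p, ?_⟩
    rw [zero_smul, zero_add, map_smul, map_smul, LinearMap.smul_apply, h.swap q p, smul_smul,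
      neg_mul, inv_mul_cancel₀ ht, neg_smul, one_smul, neg_neg]
  · refine ⟨s⁻¹ • q, ?_⟩
    rw [map_smul, map_add, LinearMap.add_apply, map_smul, map_smul, LinearMap.smul_apply,
      LinearMap.smul_apply, h.self, smul_zero, add_zero, smul_smul, inv_mul_cancel₀ hs, one_smul]

/-- Two lines that meet have a common point. -/
theorem exists_common_wedge (h : IsPlucker b w B) {x y : L} (hx : x ≠ 0) (hy : y ≠ 0)
    (hxx : B x x = 0) (hxy : B x y = 0) (hyy : B y y = 0) :
    ∃ v a c, v ≠ 0 ∧ x = w v a ∧ y = w v c := by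
  obtain ⟨p, q, rfl⟩ := h.exists_wedge_of_isotropic hx hxx
  obtain ⟨r, s, rfl⟩ := h.exists_wedge_of_isotropic hy hyy
  have hpq := h.linearIndependent_of_wedge_ne_zero hx
  have hrs := h.linearIndependent_of_wedge_ne_zero hy
  rw [LinearIndependent.pair_iff] at hpq hrs
  -- B(x, y) is the determinant of p, q, r, s, so a dependency exists; its p, q part is the common
  -- point of the two lines.
  have hdep : ¬ LinearIndependent ℂ ![p, q, r, s] := fun hli =>
    det_ne_zero_of_linearIndependent b hli (by rw [← h.pair, hxy])
  rw [Fintype.not_linearIndependent_iff] at hdep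
  obtain ⟨g, hg, k, hk⟩ := hdep
  simp only [Fin.sum_univ_four, Matrix.cons_val] at hg
  have hg2 : g 0 • p + g 1 • q = (-g 2) • r + (-g 3) • s := by
    linear_combination (norm := module) hg
  have hv : g 0 • p + g 1 • q ≠ 0 := by
    intro h0
    obtain ⟨h1, h2⟩ := hpq _ _ h0
    obtain ⟨h3, h4⟩ := hrs _ _ (hg2.symm.trans h0)
    apply hk
    fin_cases k
    · exact h1
    · exact h2
    · exact neg_eq_zero.1 h3
    · exact neg_eq_zero.1 h4
  obtain ⟨a, ha⟩ := h.exists_wedge_of_mem hv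
  obtain ⟨c, hc⟩ := h.exists_wedge_of_mem (p := r) (q := s) (by rwa [hg2] at hv)
  exact ⟨_, a, c, hv, ha, by rw [hg2]; exact hc⟩

/-- For distinct points v, v' the planes v ∧ W and v' ∧ W of ⋀²W intersect only in multiples of v ∧
v', too little for two independent vectors. -/
theorem eq_smul_of_pencil (h : IsPlucker b w B) {v v' : W} {x y : L} (hv : v ≠ 0)
    (hli : LinearIndependent ℂ ![x, y]) (hx : ∃ a, x = w v a) (hy : ∃ a, y = w v a)
    (hx' : ∃ a, x = w v' a) (hy' : ∃ a, y = w v' a) : ∃ c : ℂ, v' = c • v := by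
  by_contra! hc
  have hvv : LinearIndependent ℂ ![v, v'] := (LinearIndependent.pair_iff' hv).2 fun a ha => hc a ha.symm
  have key : ∀ z, (∃ a, z = w v a) → (∃ a, z = w v' a) → ∃ t : ℂ, z = t • w v v' := by
    rintro z ⟨a, rfl⟩ ⟨a', ha'⟩
    obtain ⟨s, t, rfl⟩ := exists_eq_add b (c := a) hvv fun y => by
      have h1 : B (w v a) (w v' y) = 0 := by rw [ha', h.wedge_wedge]
      rw [h.pair] at h1
      have h2 := b.det.map_swap ![v, a, v', y] (i := 1) (j := 2) (by decide)
      rw [h1, neg_zero] at h2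
      rw [← h2]
      congr 1
      funext k; fin_cases k <;> rfl
    exact ⟨t, by rw [map_add, map_smul, map_smul, h.self, smul_zero, zero_add]⟩
  obtain ⟨s, hs⟩ := key x hx hx'
  obtain ⟨t, ht⟩ := key y hy hy'
  rw [LinearIndependent.pair_iff] at hli
  obtain ⟨h1, h2⟩ := hli t (-s) (by rw [hs, ht, smul_smul, smul_smul, ← add_smul]; ring_nf; simp)
  rw [h1, zero_smul] at ht
  have := (hli 0 1 (by rw [ht]; simp)).2
  exact one_ne_zero this

/-- A pencil of lines lies in exactly two isotropic planes, one of which is of the form `v ∧ W`. -/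
theorem pencil_dichotomy (h : IsPlucker b w B) {x y z z' : L} (hli : LinearIndependent ℂ ![x, y])
    (hxx : B x x = 0) (hxy : B x y = 0) (hyy : B y y = 0)
    (hxz : B z x = 0) (hyz : B z y = 0) (hzz : B z z = 0)
    (hxz' : B z' x = 0) (hyz' : B z' y = 0) (hzz' : B z' z' = 0) :
    (∃ v, v ≠ 0 ∧ (∃ a, x = w v a) ∧ (∃ a, y = w v a) ∧ ((∃ a, z = w v a) ∨ ∃ a, z' = w v a)) ∨
      ∃ r s t : ℂ, z' = r • z + s • x + t • y := by
  have hx : x ≠ 0 := hli.ne_zero 0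
  have hy : y ≠ 0 := hli.ne_zero 1
  obtain ⟨v, a, c, hv, rfl, rfl⟩ := h.exists_common_wedge hx hy hxx hxy hyy
  have hvac : LinearIndependent ℂ ![c, v, a] := by
    refine linearIndependent_finCons.2 ⟨h.linearIndependent_of_wedge_ne_zero hx, fun hm => ?_⟩
    rw [Matrix.range_cons, Matrix.range_cons, Matrix.range_empty, Set.union_empty,
      Set.singleton_union, Submodule.mem_span_pair] at hm
    obtain ⟨s, t, rfl⟩ := hm
    rw [LinearIndependent.pair_iff] at hli
    have := (hli t (-1) (by rw [map_add, map_smul, map_smul, h.self]; simp)).2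
    norm_num at this
  obtain ⟨d, hd⟩ := exists_det_ne_zero_three b (v := v) (a := a) (c := c) (by
    have := hvac.comp (![1, 2, 0] : Fin 3 → Fin 3) (by decide)
    convert this using 1
    funext k; fin_cases k <;> rfl)
  -- Orthogonality to the pencil leaves the coordinates of z on va, vc, vd and ac, and isotropy
  -- kills the product of the last two. So z lies in v ∧ W or in the span of va, vc, ac, which is
  -- the second exterior power of ⟨v, a, c⟩.
  have key : ∀ z : L, B z (w v a) = 0 → B z (w v c) = 0 → B z z = 0 →
      (∃ a', z = w v a') ∨ ∃ r s t : ℂ, r ≠ 0 ∧ z = r • w a c + s • w v a + t • w v c := by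
    intro z h1 h2 h3
    have h4 := h.expand hd z
    have h5 := congrArg (fun t => B t z) h4
    set δ := b.det ![v, a, c, d]
    simp only [Matrix.cons_val] at h4 h5
    simp only [h1, h2, h3, map_add, map_sub, map_smul, LinearMap.add_apply, LinearMap.sub_apply,
      LinearMap.smul_apply, smul_eq_mul, h.symm _ z, zero_smul, sub_zero, add_zero] at h4 h5
    have h6 : B z (w v d) * B z (w a c) = 0 := by linear_combination -(1 / 2 : ℂ) * h5
    rcases mul_eq_zero.1 h6 with h7 | h7
    · left
      rw [h7, zero_smul, add_zero] at h4
      refine ⟨δ⁻¹ • (B z (w c d) • a - B z (w a d) • c + B z (w a c) • d), ?_⟩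
      rw [map_smul, map_add, map_sub, map_smul, map_smul, map_smul, ← h4, smul_smul,
        inv_mul_cancel₀ hd, one_smul]
    · by_cases h8 : B z (w v d) = 0
      · left
        rw [h8, zero_smul, add_zero] at h4
        refine ⟨δ⁻¹ • (B z (w c d) • a - B z (w a d) • c + B z (w a c) • d), ?_⟩
        rw [map_smul, map_add, map_sub, map_smul, map_smul, map_smul, ← h4, smul_smul,
          inv_mul_cancel₀ hd, one_smul]
      · right
        refine ⟨δ⁻¹ * B z (w v d), δ⁻¹ * B z (w c d), -(δ⁻¹ * B z (w a d)),
          mul_ne_zero (inv_ne_zero hd) h8, ?_⟩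
        have h9 : z = δ⁻¹ • (δ • z) := by rw [smul_smul, inv_mul_cancel₀ hd, one_smul]
        refine h9.trans ?_
        rw [h4, h7]
        module
  rcases key z hxz hyz hzz with hz | ⟨r, s, t, hr, hz⟩
  · exact Or.inl ⟨v, hv, ⟨a, rfl⟩, ⟨c, rfl⟩, Or.inl hz⟩
  rcases key z' hxz' hyz' hzz' with hz' | ⟨r', s', t', hr', hz'⟩
  · exact Or.inl ⟨v, hv, ⟨a, rfl⟩, ⟨c, rfl⟩, Or.inr hz'⟩
  right
  refine ⟨r' * r⁻¹, s' - r' * r⁻¹ * s, t' - r' * r⁻¹ * t, ?_⟩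
  have h1 : r' * r⁻¹ * r = r' := by rw [mul_assoc, inv_mul_cancel₀ hr, mul_one]
  rw [hz', hz]
  linear_combination (norm := module) (-h1) • w a c

end IsPlucker
end Plucker

/-! ### Second-order expansion of a degenerate Gram determinant -/

section DetExpansion

-- The right-hand side is the determinant of a symmetric 3 × 3 matrix a + tb + t²c whose first row
-- and column vanish at t = 0. The derivative at 0 is thus b₁₁ times a minor of a, and if a₂₂ = a₂₃
-- = 0 the second derivative only involves a₃₃ and the upper left 2 × 2 block of b.
open Polynomial in
theorem deriv_of_degenerate_gram {g : ℂ[X]} {δ₀ δ₁ : ℂ} (hδ : δ₀ ≠ 0)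
    {a22 a23 a33 b11 b12 b13 b22 b23 b33 c11 c12 c13 c22 c23 c33 : ℂ}
    (h : ∀ t : ℂ, g.eval t * (δ₀ + t * δ₁) ^ 2 =
      (t * b11 + t ^ 2 * c11) * ((a22 + t * b22 + t ^ 2 * c22) * (a33 + t * b33 + t ^ 2 * c33) -
        (a23 + t * b23 + t ^ 2 * c23) ^ 2) -
      (t * b12 + t ^ 2 * c12) * ((t * b12 + t ^ 2 * c12) * (a33 + t * b33 + t ^ 2 * c33) -
        (a23 + t * b23 + t ^ 2 * c23) * (t * b13 + t ^ 2 * c13)) +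
      (t * b13 + t ^ 2 * c13) * ((t * b12 + t ^ 2 * c12) * (a23 + t * b23 + t ^ 2 * c23) -
        (a22 + t * b22 + t ^ 2 * c22) * (t * b13 + t ^ 2 * c13))) :
    g.eval 0 = 0 ∧ (derivative g).eval 0 * δ₀ ^ 2 = b11 * (a22 * a33 - a23 ^ 2) ∧
    (a22 = 0 → a23 = 0 → (derivative g).eval 0 = 0 ∧
      (derivative (derivative g)).eval 0 * δ₀ ^ 2 = 2 * a33 * (b11 * b22 - b12 ^ 2)) := by
  have hp : g * (C δ₀ + X * C δ₁) ^ 2 =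
      (X * C b11 + X ^ 2 * C c11) * ((C a22 + X * C b22 + X ^ 2 * C c22) *
        (C a33 + X * C b33 + X ^ 2 * C c33) - (C a23 + X * C b23 + X ^ 2 * C c23) ^ 2) -
      (X * C b12 + X ^ 2 * C c12) * ((X * C b12 + X ^ 2 * C c12) *
        (C a33 + X * C b33 + X ^ 2 * C c33) -
        (C a23 + X * C b23 + X ^ 2 * C c23) * (X * C b13 + X ^ 2 * C c13)) +
      (X * C b13 + X ^ 2 * C c13) * ((X * C b12 + X ^ 2 * C c12) *
        (C a23 + X * C b23 + X ^ 2 * C c23) -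
        (C a22 + X * C b22 + X ^ 2 * C c22) * (X * C b13 + X ^ 2 * C c13)) := by
    refine Polynomial.funext fun t => ?_
    simpa only [eval_add, eval_sub, eval_mul, eval_pow, eval_C, eval_X] using h t
  have h0 : g.eval 0 = 0 := by
    have := h 0
    simp only [zero_mul, add_zero, ne_eq, OfNat.ofNat_ne_zero, not_false_eq_true, zero_pow,
      sub_zero] at this
    exact (mul_eq_zero.1 this).resolve_right (pow_ne_zero 2 hδ)
  have h1 : (derivative g).eval 0 * δ₀ ^ 2 = b11 * (a22 * a33 - a23 ^ 2) := by
    have := congrArg (fun p => (derivative p).eval 0) hp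
    simp only [derivative_mul, derivative_add, derivative_sub, derivative_C, derivative_X,
      derivative_pow, eval_add, eval_sub, eval_mul, eval_pow, eval_C, eval_X, h0,
      eval_zero, eval_one] at this
    simp only [Nat.cast_ofNat] at this
    linear_combination this
  refine ⟨h0, h1, ?_⟩
  rintro rfl rfl
  have h1' : (derivative g).eval 0 = 0 := by
    rw [zero_mul, zero_pow two_ne_zero, sub_zero, mul_zero] at h1
    exact (mul_eq_zero.1 h1).resolve_right (pow_ne_zero 2 hδ)
  refine ⟨h1', ?_⟩
  have := congrArg (fun p => (derivative (derivative p)).eval 0) hp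
  simp only [derivative_mul, derivative_add, derivative_sub, derivative_C, derivative_X,
    derivative_pow, eval_add, eval_sub, eval_mul, eval_pow, eval_C, eval_X, h0, h1',
    eval_zero, eval_one, derivative_zero, derivative_one] at this
  simp only [Nat.cast_ofNat] at this
  linear_combination this

end DetExpansion

theorem pderiv_comm {n : ℕ} (P : MvPolynomial (Fin n) ℂ) (j k : Fin n) :
    MvPolynomial.pderiv j (MvPolynomial.pderiv k P) =
      MvPolynomial.pderiv k (MvPolynomial.pderiv j P) := by
  let D (j : Fin n) : Derivation ℂ (MvPolynomial (Fin n) ℂ) (MvPolynomial (Fin n) ℂ) :=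
    MvPolynomial.pderiv j
  have : ⁅D j, D k⁆ = 0 := by
    refine MvPolynomial.derivation_ext fun i => ?_
    rw [Derivation.commutator_apply]
    simp [D, MvPolynomial.pderiv_X, Pi.single_apply, apply_ite]
  have h := DFunLike.congr_fun this P
  rw [Derivation.commutator_apply, Derivation.zero_apply] at h
  exact sub_eq_zero.1 h

/-- After the change of basis T the form involves three variables and is nondegenerate in them.
Polarization recovers the matrix entries from the values. -/
theorem rank_eq_three_of_form {H T : Matrix (Fin 4) (Fin 4) ℂ} (hH : H.transpose = H)
    (hT : T.det ≠ 0) {κ : ℂ} (hκ : κ ≠ 0)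
    (h : ∀ y : Fin 4 → ℂ, dotProduct (T.mulVec y) (H.mulVec (T.mulVec y)) =
      2 * κ * (4 * y 1 * y 3 - y 2 ^ 2)) : H.rank = 3 := by
  set N := T.transpose * H * T with hN
  have hNs : N.transpose = N := by
    rw [hN, Matrix.transpose_mul, Matrix.transpose_mul, Matrix.transpose_transpose, hH,
      Matrix.mul_assoc]
  have hq : ∀ y : Fin 4 → ℂ, dotProduct y (N.mulVec y) = 2 * κ * (4 * y 1 * y 3 - y 2 ^ 2) := by
    intro y
    rw [← h y, hN, ← Matrix.mulVec_mulVec, ← Matrix.mulVec_mulVec, Matrix.dotProduct_mulVec,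
      ← Matrix.mulVec_transpose, Matrix.transpose_transpose]
  have hent : ∀ i j, 2 * N i j = dotProduct (Pi.single i 1 + Pi.single j 1) (N.mulVec
      (Pi.single i 1 + Pi.single j 1)) - dotProduct (Pi.single i 1) (N.mulVec (Pi.single i 1)) -
      dotProduct (Pi.single j 1) (N.mulVec (Pi.single j 1)) := by
    intro i j
    have : N j i = N i j := by conv_lhs => rw [← hNs, Matrix.transpose_apply]
    simp only [Matrix.mulVec_add, add_dotProduct, dotProduct_add, single_one_dotProduct,
      Matrix.mulVec_single_one, Matrix.col_apply, this]
    ring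
  -- The entry 1 in the corner completes the left factor to an invertible matrix, so the diagonal
  -- factor carries the rank.
  have hD : N = Matrix.of ![![1, 0, 0, 0], ![0, 0, 0, 4 * κ], ![0, 0, -2 * κ, 0], ![0, 4 * κ, 0, 0]] *
      Matrix.diagonal ![0, 1, 1, 1] := by
    ext i j
    have := hent i j
    rw [hq, hq, hq] at this
    refine mul_left_cancel₀ (two_ne_zero (α := ℂ)) (this.trans ?_)
    rw [Matrix.mul_diagonal]
    fin_cases i <;> fin_cases j <;> simp <;> ring
  have hE : IsUnit (Matrix.of ![![1, 0, 0, 0], ![0, 0, 0, 4 * κ], ![0, 0, -2 * κ, 0],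
      ![0, 4 * κ, 0, 0]]).det := by
    rw [isUnit_iff_ne_zero]
    simp [Matrix.det_succ_row_zero, Fin.sum_univ_succ, Fin.succAbove, hκ]
  have hrk : N.rank = 3 := by
    rw [hD, Matrix.rank_mul_eq_right_of_isUnit_det _ _ hE, Matrix.rank_diagonal]
    rw [Fintype.card_subtype]
    have : ({x | (![0, 1, 1, 1] : Fin 4 → ℂ) x ≠ 0} : Finset (Fin 4)) = {1, 2, 3} := by
      ext i; fin_cases i <;> simp
    rw [this]; rfl
  rw [← hrk, hN, Matrix.rank_mul_eq_left_of_isUnit_det _ _ (isUnit_iff_ne_zero.2 hT),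
    Matrix.rank_mul_eq_right_of_isUnit_det _ _ (by
      rw [Matrix.det_transpose]; exact isUnit_iff_ne_zero.2 hT)]

/-! ### Zeros and singular points of the discriminant -/

section Kummer

variable {W L : Type*} [AddCommGroup W] [Module ℂ W] [AddCommGroup L] [Module ℂ L]

/-- `P` computes the discriminant of the quadratic form `B (u x) x` on the planes `v ∧ W`. -/
def IsDiscriminant (b : Module.Basis (Fin 4) ℂ W) (w : W →ₗ[ℂ] W →ₗ[ℂ] L)
    (B : L →ₗ[ℂ] L →ₗ[ℂ] ℂ) (u : Module.End ℂ L) (P : MvPolynomial (Fin 4) ℂ) : Prop :=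
  P.IsHomogeneous 4 ∧ ∀ (v : W) (y : Fin 3 → W),
    (Matrix.of fun i j => B (u (w v (y i))) (w v (y j))).det =
      MvPolynomial.eval (b.repr v) P * (b.det (Fin.cons v y : Fin 4 → W)) ^ 2

/-- `x`, `u x`, `u² x` all lie in `v ∧ W`. -/
def ThreeIn (w : W →ₗ[ℂ] W →ₗ[ℂ] L) (u : Module.End ℂ L) (v : W) (x : L) : Prop :=
  (∃ a, x = w v a) ∧ (∃ a, u x = w v a) ∧ ∃ a, u (u x) = w v a

variable {b : Module.Basis (Fin 4) ℂ W} {w : W →ₗ[ℂ] W →ₗ[ℂ] L} {B : L →ₗ[ℂ] L →ₗ[ℂ] ℂ}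
  {u : Module.End ℂ L} {e : Module.Basis (Fin 6) ℂ L} {lam : Fin 6 → ℂ}
  {P : MvPolynomial (Fin 4) ℂ}

theorem exists_isDiscriminant (h : IsPlucker b w B) (hd : IsDiag B u e lam) :
    ∃ P, IsDiscriminant b w B u P := by
  obtain ⟨P, h4, hP⟩ := exists_kummerQuartic b w h.self (B.comp u) (fun x y => by
    rw [LinearMap.comp_apply, LinearMap.comp_apply, hd.adj, hd.symm])
  exact ⟨P, h4, hP⟩

/-- A kernel vector x of the form B(u·, ·) on v ∧ W is one with ux orthogonal to v ∧ W, and v ∧ W is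
its own orthogonal complement. -/
theorem IsDiscriminant.eval_eq_zero_iff (hP : IsDiscriminant b w B u P) (h : IsPlucker b w B)
    (hd : IsDiag B u e lam) {v : W} (hv : v ≠ 0) :
    MvPolynomial.eval (b.repr v) P = 0 ↔ ∃ x, x ≠ 0 ∧ (∃ a, x = w v a) ∧ ∃ a, u x = w v a := by
  constructor
  · intro h0
    obtain ⟨y, hy⟩ := exists_cons_det_ne_zero b hv
    have hdet := hP.2 v y
    rw [h0, zero_mul] at hdet
    obtain ⟨c, hc, hM⟩ := Matrix.exists_mulVec_eq_zero_iff.2 hdet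
    have hli := linearIndependent_of_det_ne_zero b hy
    set a := ∑ i, c i • y i with ha
    have hx : ∀ i, B (u (w v a)) (w v (y i)) = 0 := by
      intro i
      have := congrFun hM i
      simp only [Matrix.mulVec, dotProduct, Matrix.of_apply, Pi.zero_apply] at this
      rw [hd.adj, hd.symm, ha]
      simp only [map_sum, map_smul, smul_eq_mul]
      rw [← this]
      exact Finset.sum_congr rfl fun j _ => mul_comm _ _
    refine ⟨w v a, fun h1 => hc ?_, ⟨a, rfl⟩, h.exists_eq_wedge hv fun z => ?_⟩
    · obtain ⟨s, hs⟩ := h.exists_eq_smul hv h1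
      have h2 := Fintype.linearIndependent_iff.1 hli (Fin.cons (-s) c) (by
        rw [Fin.sum_univ_succ]
        simp only [Fin.cons_zero, Fin.cons_succ]
        rw [← ha, hs, neg_smul, neg_add_cancel])
      funext i
      simpa using h2 i.succ
    · have hspan : z ∈ Submodule.span ℂ (Set.range (Fin.cons v y : Fin 4 → W)) := by
        rw [hli.span_eq_top_of_card_eq_finrank (by rw [Module.finrank_eq_card_basis b])]
        trivial
      obtain ⟨t, rfl⟩ := (Submodule.mem_span_range_iff_exists_fun ℂ).1 hspan
      rw [Fin.sum_univ_succ]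
      simp only [Fin.cons_zero, Fin.cons_succ, map_add, map_smul, map_sum, h.self, hx, smul_zero,
        add_zero, Finset.sum_const_zero, map_zero]
  · rintro ⟨x, hx, ⟨a, rfl⟩, ⟨c, hc⟩⟩
    obtain ⟨y, z, hd'⟩ := IsPlucker.exists_det_ne_zero_two b (h.linearIndependent_of_wedge_ne_zero hx)
    have := hP.2 v ![a, y, z]
    rw [Matrix.det_eq_zero_of_row_eq_zero 0 (fun j => by
      simp only [Matrix.of_apply, Matrix.cons_val_zero]
      rw [hc, h.wedge_wedge])] at this
    exact (mul_eq_zero.1 this.symm).resolve_right (pow_ne_zero 2 hd')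

/-- First and second order behaviour of the discriminant at a degenerate plane. -/
theorem IsDiscriminant.deriv (hP : IsDiscriminant b w B u P) (hd : IsDiag B u e lam) {v a c d : W}
    (hδ : b.det ![v, a, c, d] ≠ 0) (haa : B (u (w v a)) (w v a) = 0)
    (hac : B (u (w v a)) (w v c) = 0) (had : B (u (w v a)) (w v d) = 0) (z : W) :
    let g := linePoly P (b.repr v) (b.repr z)
    g.eval 0 = 0 ∧ (Polynomial.derivative g).eval 0 * b.det ![v, a, c, d] ^ 2 =
      2 * B (u (w v a)) (w z a) * (B (u (w v c)) (w v c) * B (u (w v d)) (w v d) -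
        B (u (w v c)) (w v d) ^ 2) ∧
    (B (u (w v c)) (w v c) = 0 → B (u (w v c)) (w v d) = 0 →
      (Polynomial.derivative g).eval 0 = 0 ∧
      (Polynomial.derivative (Polynomial.derivative g)).eval 0 * b.det ![v, a, c, d] ^ 2 =
        2 * B (u (w v d)) (w v d) * (4 * B (u (w v a)) (w z a) * B (u (w v c)) (w z c) -
          (B (u (w v a)) (w z c) + B (u (w v c)) (w z a)) ^ 2)) := by
  intro g
  have hs : ∀ x y, B (u x) y = B (u y) x := fun x y => by rw [hd.adj, hd.symm]
  have key := deriv_of_degenerate_gram (g := g) (δ₁ := b.det ![z, a, c, d]) hδ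
    (a22 := B (u (w v c)) (w v c)) (a23 := B (u (w v c)) (w v d)) (a33 := B (u (w v d)) (w v d))
    (b11 := 2 * B (u (w v a)) (w z a)) (b12 := B (u (w v a)) (w z c) + B (u (w v c)) (w z a))
    (b13 := B (u (w v a)) (w z d) + B (u (w v d)) (w z a))
    (b22 := 2 * B (u (w v c)) (w z c)) (b23 := B (u (w v c)) (w z d) + B (u (w v d)) (w z c))
    (b33 := 2 * B (u (w v d)) (w z d))
    (c11 := B (u (w z a)) (w z a)) (c12 := B (u (w z a)) (w z c)) (c13 := B (u (w z a)) (w z d))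
    (c22 := B (u (w z c)) (w z c)) (c23 := B (u (w z c)) (w z d)) (c33 := B (u (w z d)) (w z d))
    (by
      intro t
      have h1 := hP.2 (v + t • z) ![a, c, d]
      have h2 : b.det (Fin.cons (v + t • z) ![a, c, d] : Fin 4 → W) =
          b.det ![v, a, c, d] + t * b.det ![z, a, c, d] := by
        refine (b.det.map_vecCons_add ![a, c, d] v (t • z)).trans ?_
        rw [b.det.map_vecCons_smul]
        rfl
      have h3 : g.eval t = MvPolynomial.eval (b.repr (v + t • z)) P := by
        rw [eval_linePoly, map_add, map_smul]
        rfl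
      rw [h2, ← h3, Matrix.det_fin_three] at h1
      rw [← h1]
      simp only [Matrix.of_apply, Matrix.cons_val, map_add, map_smul, LinearMap.add_apply,
        LinearMap.smul_apply, smul_eq_mul, haa, hac, had, hs (w v c) (w v a), hs (w v d) (w v a),
        hs (w v d) (w v c), hs (w z a) (w v a), hs (w z a) (w v c), hs (w z a) (w v d),
        hs (w z c) (w v a), hs (w z c) (w v c), hs (w z c) (w v d),
        hs (w z d) (w v a), hs (w z d) (w v c), hs (w z d) (w v d),
        hs (w z c) (w z a), hs (w z d) (w z a), hs (w z d) (w z c)]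
      ring)
  refine ⟨key.1, key.2.1, fun h1 h2 => ⟨(key.2.2 h1 h2).1, ?_⟩⟩
  rw [(key.2.2 h1 h2).2]
  ring

theorem det_cycle (b : Module.Basis (Fin 4) ℂ W) (v a c d : W) :
    b.det ![v, c, d, a] = b.det ![v, a, c, d] := by
  have h1 := b.det.map_perm ![v, a, c, d] (Equiv.swap 1 2 * Equiv.swap 2 3)
  rw [Equiv.Perm.sign_mul, Equiv.Perm.sign_swap (by decide), Equiv.Perm.sign_swap (by decide)] at h1
  rw [show (-1 : ℤˣ) * -1 = 1 by decide, one_smul] at h1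
  rw [← h1]
  congr 1
  funext k; fin_cases k <;> rfl

theorem det_swap_last (b : Module.Basis (Fin 4) ℂ W) (v a c d : W) :
    b.det ![v, a, d, c] = -b.det ![v, a, c, d] := by
  rw [← b.det.map_swap ![v, a, c, d] (i := 2) (j := 3) (by decide)]
  congr 1
  funext k; fin_cases k <;> rfl

/-- At a singular point the form has a kernel K of dimension at least 2 in v ∧ W, with uK ⊂ v ∧ W.
As v ∧ W has dimension 3, some nonzero y ∈ K has uy ∈ K, whence u²y ∈ v ∧ W as well. -/
theorem IsDiscriminant.exists_threeIn (hP : IsDiscriminant b w B u P) (h : IsPlucker b w B)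
    (hd : IsDiag B u e lam) {v : W} (hv : v ≠ 0)
    (hs : ∀ j, MvPolynomial.eval (b.repr v) (MvPolynomial.pderiv j P) = 0) :
    ∃ x, x ≠ 0 ∧ ThreeIn w u v x := by
  have hP0 : MvPolynomial.eval (b.repr v) P = 0 := by
    have := congrArg (MvPolynomial.eval (b.repr v)) hP.1.sum_X_mul_pderiv
    rw [map_sum, Finset.sum_eq_zero (fun j _ => by rw [map_mul, hs, mul_zero])] at this
    simpa using this.symm
  obtain ⟨_, hx, ⟨a, rfl⟩, ⟨c, hc⟩⟩ := (hP.eval_eq_zero_iff h hd hv).1 hP0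
  have hva := h.linearIndependent_of_wedge_ne_zero hx
  have hcva : LinearIndependent ℂ ![c, v, a] := by
    refine linearIndependent_finCons.2 ⟨hva, fun hm => ?_⟩
    rw [Matrix.range_cons, Matrix.range_cons, Matrix.range_empty, Set.union_empty,
      Set.singleton_union, Submodule.mem_span_pair] at hm
    obtain ⟨s, t, rfl⟩ := hm
    refine hd.not_isotropic_eigenvector hx (μ := t) ?_ (h.wedge_wedge v a a)
    rw [hc, map_add, map_smul, map_smul, h.self, smul_zero, zero_add]
  obtain ⟨d, hδ⟩ := IsPlucker.exists_det_ne_zero_three b (v := v) (a := a) (c := c) (by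
    have := hcva.comp (![1, 2, 0] : Fin 3 → Fin 3) (by decide)
    convert this using 1
    funext k; fin_cases k <;> rfl)
  have ha : ∀ z, B (u (w v a)) (w v z) = 0 := fun z => by rw [hc, h.wedge_wedge]
  -- In the direction d the factor 2B(u(v ∧ a), d ∧ a) equals twice the determinant of v, a, c, d,
  -- which is nonzero, so vanishing of the derivative forces the minor on c, d to vanish.
  have hder := (hP.deriv hd hδ (ha a) (ha c) (ha d) d).2.1
  rw [eval_derivative_linePoly, Finset.sum_eq_zero (fun j _ => by rw [hs, mul_zero]), zero_mul] at hder
  have hm : B (u (w v c)) (w v c) * B (u (w v d)) (w v d) - B (u (w v c)) (w v d) ^ 2 = 0 := by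
    refine (mul_eq_zero.1 hder.symm).resolve_left ?_
    rw [hc, h.pair, det_cycle]
    exact mul_ne_zero two_ne_zero hδ
  -- A kernel vector of the singular symmetric 2 × 2 matrix, giving a second kernel vector x' = s
  -- v∧c + t v∧d beside v ∧ a.
  obtain ⟨s, t, hst, h1, h2⟩ : ∃ s t : ℂ, (s ≠ 0 ∨ t ≠ 0) ∧
      s * B (u (w v c)) (w v c) + t * B (u (w v c)) (w v d) = 0 ∧
      s * B (u (w v c)) (w v d) + t * B (u (w v d)) (w v d) = 0 := by
    by_cases h0 : B (u (w v c)) (w v d) = 0 ∧ B (u (w v d)) (w v d) = 0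
    · exact ⟨0, 1, Or.inr one_ne_zero, by rw [h0.1]; ring, by rw [h0.2]; ring⟩
    · refine ⟨B (u (w v d)) (w v d), -B (u (w v c)) (w v d), ?_, by linear_combination hm, by ring⟩
      by_contra! hcon
      exact h0 ⟨neg_eq_zero.1 hcon.2, hcon.1⟩
  have hsy : ∀ x y, B (u x) y = B (u y) x := fun x y => by rw [hd.adj, hd.symm]
  have hbasis : ∀ z, ∃ r₀ r₁ r₂ r₃ : ℂ, z = r₀ • v + r₁ • a + r₂ • c + r₃ • d := by
    intro z
    have hli := linearIndependent_of_det_ne_zero b hδ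
    have hspan : z ∈ Submodule.span ℂ (Set.range ![v, a, c, d]) := by
      rw [hli.span_eq_top_of_card_eq_finrank (by rw [Module.finrank_eq_card_basis b])]
      trivial
    obtain ⟨r, rfl⟩ := (Submodule.mem_span_range_iff_exists_fun ℂ).1 hspan
    exact ⟨r 0, r 1, r 2, r 3, by rw [Fin.sum_univ_four]; rfl⟩
  obtain ⟨f, hf⟩ : ∃ f, u (s • w v c + t • w v d) = w v f := by
    refine h.exists_eq_wedge hv fun z => ?_
    obtain ⟨r₀, r₁, r₂, r₃, rfl⟩ := hbasis z
    simp only [map_add, map_smul, LinearMap.add_apply, LinearMap.smul_apply, smul_eq_mul, h.self,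
      hsy (w v c) (w v a), hsy (w v d) (w v a), hsy (w v d) (w v c), ha, map_zero]
    linear_combination r₂ * h1 + r₃ * h2
  -- Here K contains v ∧ c = u(v ∧ a), so y = v ∧ a already works.
  by_cases ht : t = 0
  · subst ht
    have hs0 : s ≠ 0 := by simpa using hst
    refine ⟨w v a, hx, ⟨a, rfl⟩, ⟨c, hc⟩, ⟨s⁻¹ • f, ?_⟩⟩
    rw [map_smul, ← hf, zero_smul, add_zero, map_smul, smul_smul, inv_mul_cancel₀ hs0, one_smul, hc]
  obtain ⟨r₀, r₁, r₂, r₃, hr⟩ := hbasis f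
  -- γ removes the v ∧ d term of ux' by means of x', and β is the remaining coefficient of v ∧ c.
  -- Since u(v ∧ a) = v ∧ c, subtracting β v∧a from x' brings its image back into K.
  set γ := r₃ * t⁻¹ with hγ
  set β := r₂ - γ * s with hβ
  have hγt : γ * t = r₃ := by rw [hγ, mul_assoc, inv_mul_cancel₀ ht, mul_one]
  set x' := s • w v c + t • w v d with hx'
  have hux' : u x' = r₁ • w v a + β • w v c + γ • x' := by
    rw [hf, hr, hx', hβ]
    simp only [map_add, map_smul, h.self]
    linear_combination (norm := module) (-hγt) • w v d
  have hz : u (x' - β • w v a) = γ • (x' - β • w v a) + (r₁ + γ * β) • w v a := by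
    rw [map_sub, map_smul, hux', hc]
    module
  refine ⟨x' - β • w v a, ?_, ⟨s • c + t • d - β • a, ?_⟩, ?_⟩
  · intro h0
    have h3 : w v (s • c + t • d - β • a) = 0 := by
      rw [← h0, hx']; simp only [map_add, map_sub, map_smul]
    obtain ⟨r, hr'⟩ := h.exists_eq_smul hv h3
    have hli := linearIndependent_of_det_ne_zero b hδ
    have h4 := Fintype.linearIndependent_iff.1 hli ![-r, -β, s, t] (by
      rw [Fin.sum_univ_four]
      simp only [Matrix.cons_val]
      linear_combination (norm := module) hr') 3
    exact ht (by simpa using h4)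
  · rw [hx']; simp only [map_add, map_sub, map_smul]
  · have h5 : ∃ k, u (x' - β • w v a) = w v k :=
      ⟨γ • (s • c + t • d - β • a) + (r₁ + γ * β) • a, by
        rw [hz, hx']; simp only [map_add, map_sub, map_smul]⟩
    refine ⟨h5, ?_⟩
    obtain ⟨k, hk⟩ := h5
    refine ⟨γ • k + (r₁ + γ * β) • c, ?_⟩
    conv_lhs => rw [hz]
    rw [map_add, map_smul, map_smul, hk, hc, map_add, map_smul, map_smul]

end Kummer

/-! ### The nodes: local structure and count -/

section Nodes

variable {W L : Type*} [AddCommGroup W] [Module ℂ W] [AddCommGroup L] [Module ℂ L]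
  {b : Module.Basis (Fin 4) ℂ W} {w : W →ₗ[ℂ] W →ₗ[ℂ] L} {B : L →ₗ[ℂ] L →ₗ[ℂ] ℂ}
  {u : Module.End ℂ L} {e : Module.Basis (Fin 6) ℂ L} {lam : Fin 6 → ℂ}
  {P : MvPolynomial (Fin 4) ℂ}

theorem ThreeIn.smul {v : W} {x : L} (hx : ThreeIn w u v x) (c : ℂ) : ThreeIn w u v (c • x) := by
  obtain ⟨⟨a, ha⟩, ⟨a', ha'⟩, ⟨a'', ha''⟩⟩ := hx
  exact ⟨⟨c • a, by rw [map_smul, ha]⟩, ⟨c • a', by rw [map_smul, ha', map_smul]⟩,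
    ⟨c • a'', by rw [map_smul, map_smul, ha'', map_smul]⟩⟩

theorem ThreeIn.smul_left {v : W} {x : L} (hx : ThreeIn w u v x) {c : ℂ} (hc : c ≠ 0) :
    ThreeIn w u (c • v) x := by
  have key : ∀ {y : L}, (∃ a, y = w v a) → ∃ a, y = w (c • v) a := by
    rintro y ⟨a, rfl⟩
    refine ⟨c⁻¹ • a, ?_⟩
    rw [map_smul, map_smul, LinearMap.smul_apply, smul_smul, inv_mul_cancel₀ hc, one_smul]
  exact ⟨key hx.1, key hx.2.1, key hx.2.2⟩

/-- Self-adjointness distributes uᵐ with m ≤ 4 as at most u² on each side, where both vectors lie in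
the isotropic space v ∧ W. -/
theorem IsDiag.pow_apply_of_threeIn (h : IsPlucker b w B) (hd : IsDiag B u e lam) {v : W} {x : L}
    (hx : ThreeIn w u v x) : ∀ m < 5, B ((u ^ m) x) x = 0 := by
  obtain ⟨⟨a, ha⟩, ⟨a', ha'⟩, ⟨a'', ha''⟩⟩ := hx
  intro m hm
  interval_cases m
  · rw [pow_zero, Module.End.one_apply, ha, h.wedge_wedge]
  · rw [pow_one, ha', ha, h.wedge_wedge]
  · rw [pow_two, Module.End.mul_apply, ha'', ha, h.wedge_wedge]
  · rw [pow_succ, pow_two, Module.End.mul_apply, Module.End.mul_apply, hd.adj, ha'', ha', h.wedge_wedge]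
  · rw [pow_succ, pow_succ, pow_two, Module.End.mul_apply, Module.End.mul_apply,
      Module.End.mul_apply, hd.adj, hd.adj, ha'', h.wedge_wedge]

theorem ThreeIn.exists_node (h : IsPlucker b w B) (hd : IsDiag B u e lam) {v : W} {x : L}
    (hx0 : x ≠ 0) (hx : ThreeIn w u v x) : ∃ ε, ThreeIn w u v (nodeVec B e lam ε) := by
  obtain ⟨ε, c, hc, rfl⟩ := hd.exists_eq_smul_nodeVec hx0 (hd.pow_apply_of_threeIn h hx)
  refine ⟨ε, ?_⟩
  have := hx.smul c⁻¹
  rwa [smul_smul, inv_mul_cancel₀ hc, one_smul] at this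

theorem IsDiag.det_ne_zero_of_node (hd : IsDiag B u e lam) (b : Module.Basis (Fin 4) ℂ W) {v : W}
    (hv : v ≠ 0) (hw : w v v = 0) {ε : Fin 5 → ℤˣ} {a c d : W} (ha : nodeVec B e lam ε = w v a)
    (hc : u (nodeVec B e lam ε) = w v c) (hd' : u (u (nodeVec B e lam ε)) = w v d) :
    b.det ![v, a, c, d] ≠ 0 := by
  refine det_ne_zero_of_linearIndependent b (Fintype.linearIndependent_iff.2 fun g hg => ?_)
  rw [Fin.sum_univ_four] at hg
  simp only [Matrix.cons_val] at hg
  have h1 := congrArg (w v) hg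
  simp only [map_add, map_smul, hw, smul_zero, zero_add, map_zero, ← ha, ← hc, ← hd'] at h1
  obtain ⟨e1, e2, e3⟩ := hd.linearIndependent_nodeVec ε h1
  rw [e1, e2, e3, zero_smul, zero_smul, zero_smul, add_zero, add_zero, add_zero] at hg
  have e0 := (smul_eq_zero.1 hg).resolve_right hv
  intro i
  fin_cases i
  · exact e0
  · exact e1
  · exact e2
  · exact e3

/-- The vectors x, ux, u²x span v ∧ W, so any other sign vector in it lies in their span, which
determines the signs. -/
theorem IsDiag.eq_of_threeIn (h : IsPlucker b w B) (hd : IsDiag B u e lam) {v : W} (hv : v ≠ 0)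
    {ε ε' : Fin 5 → ℤˣ} (hε : ThreeIn w u v (nodeVec B e lam ε))
    (hε' : ∃ a, nodeVec B e lam ε' = w v a) : ε' = ε := by
  obtain ⟨⟨a, ha⟩, ⟨c, hc⟩, ⟨d, hd'⟩⟩ := hε
  obtain ⟨f, hf⟩ := hε'
  have hδ := hd.det_ne_zero_of_node b hv (h.self v) ha hc hd'
  have hli := linearIndependent_of_det_ne_zero b hδ
  have hspan : f ∈ Submodule.span ℂ (Set.range ![v, a, c, d]) := by
    rw [hli.span_eq_top_of_card_eq_finrank (by rw [Module.finrank_eq_card_basis b])]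
    trivial
  obtain ⟨r, rfl⟩ := (Submodule.mem_span_range_iff_exists_fun ℂ).1 hspan
  refine hd.eq_of_mem_span (a := r 1) (b := r 2) (c := r 3) ?_
  rw [hf, Fin.sum_univ_four]
  simp only [Matrix.cons_val, map_add, map_smul, h.self, smul_zero, zero_add, ← ha, ← hc, ← hd']

/-- At the nodes the discriminant is singular, with Hessian of rank 3. -/
theorem IsDiscriminant.singular_of_node (hP : IsDiscriminant b w B u P) (h : IsPlucker b w B)
    (hd : IsDiag B u e lam) {v : W} (hv : v ≠ 0) {ε : Fin 5 → ℤˣ}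
    (hε : ThreeIn w u v (nodeVec B e lam ε)) :
    (∀ j, MvPolynomial.eval (b.repr v) (MvPolynomial.pderiv j P) = 0) ∧
    (Matrix.of fun j k => MvPolynomial.eval (b.repr v)
      (MvPolynomial.pderiv j (MvPolynomial.pderiv k P))).rank = 3 := by
  obtain ⟨⟨a, ha⟩, ⟨c, hc⟩, ⟨d, hd'⟩⟩ := hε
  have hδ := hd.det_ne_zero_of_node b hv (h.self v) ha hc hd'
  have hac : u (w v a) = w v c := by rw [← ha, hc]
  have hcd : u (w v c) = w v d := by rw [← hc, hd']
  have hder := fun z => hP.deriv hd hδ (by rw [hac, h.wedge_wedge]) (by rw [hac, h.wedge_wedge])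
    (by rw [hac, h.wedge_wedge]) z
  have hder2 := fun z => (hder z).2.2 (by rw [hcd, h.wedge_wedge]) (by rw [hcd, h.wedge_wedge])
  constructor
  · intro j
    have := (hder2 (b j)).1
    rw [eval_derivative_linePoly] at this
    simpa [Finsupp.single_apply] using this
  set δ := b.det ![v, a, c, d] with hδ'
  -- Self-adjointness turns B(u³x, u²x) into B(u⁵x, x), which is normalized to 1.
  have hκ : B (u (w v d)) (w v d) ≠ 0 := by
    have := hd.isotropic_nodeVec ε (m := 5) (by norm_num)
    rw [if_pos rfl] at this
    rw [← hd', hd.symm, ← hd.adj, ← hd.adj, ← hd.adj]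
    rw [show u (u (u (u (u (nodeVec B e lam ε))))) = (u ^ 5) (nodeVec B e lam ε) from rfl, this]
    exact one_ne_zero
  refine rank_eq_three_of_form (T := b.toMatrix ![v, a, c, d]) ?_ hδ hκ fun y => ?_
  · ext j k
    rw [Matrix.transpose_apply, Matrix.of_apply, Matrix.of_apply, pderiv_comm]
  set z : W := y 0 • v + y 1 • a + y 2 • c + y 3 • d with hz
  have hT : (b.toMatrix ![v, a, c, d]).mulVec y = b.repr z := by
    funext i
    simp only [Matrix.mulVec, dotProduct, Module.Basis.toMatrix_apply, Fin.sum_univ_four,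
      Matrix.cons_val, hz, map_add, map_smul, Finsupp.add_apply, Finsupp.smul_apply, smul_eq_mul]
    ring
  have hH : dotProduct (b.repr z) ((Matrix.of fun j k => MvPolynomial.eval (b.repr v)
      (MvPolynomial.pderiv j (MvPolynomial.pderiv k P))).mulVec (b.repr z)) =
      (Polynomial.derivative (Polynomial.derivative (linePoly P (b.repr v) (b.repr z)))).eval 0 := by
    rw [eval_derivative_derivative_linePoly]
    simp only [dotProduct, Matrix.mulVec, Matrix.of_apply]
    refine Finset.sum_congr rfl fun j _ => congrArg _ (Finset.sum_congr rfl fun k _ => ?_)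
    rw [pderiv_comm, mul_comm]
  rw [hT, hH]
  refine mul_right_cancel₀ (pow_ne_zero 2 hδ) ((hder2 z).2.trans ?_)
  have hvv : ∀ p q r : W, B (w v p) (w v q) = 0 := fun p q _ => h.wedge_wedge v p q
  have z12 : ∀ x y s, b.det ![x, y, y, s] = 0 := fun x y s =>
    b.det.map_eq_zero_of_eq _ (i := 1) (j := 2) rfl (by decide)
  have z13 : ∀ x y s, b.det ![x, y, s, y] = 0 := fun x y s =>
    b.det.map_eq_zero_of_eq _ (i := 1) (j := 3) rfl (by decide)
  have z23 : ∀ x y s, b.det ![x, y, s, s] = 0 := fun x y s =>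
    b.det.map_eq_zero_of_eq _ (i := 2) (j := 3) rfl (by decide)
  have z02 : ∀ x y s, b.det ![x, y, x, s] = 0 := fun x y s =>
    b.det.map_eq_zero_of_eq _ (i := 0) (j := 2) rfl (by decide)
  -- As u(v ∧ a) = v ∧ c and u(v ∧ c) = v ∧ d, the pairings are determinants linear in z. The second
  -- derivative thus becomes a multiple of 4y₁y₃ − y₂², of rank 3.
  have e1 : B (u (w v a)) (w z a) = y 3 * δ := by
    rw [hac, hz]
    simp only [map_add, map_smul, LinearMap.add_apply, LinearMap.smul_apply, h.pair, smul_eq_mul,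
      z12, z02, z23, det_cycle]
    ring
  have e2 : B (u (w v c)) (w z c) = y 1 * δ := by
    rw [hcd, hz]
    simp only [map_add, map_smul, LinearMap.add_apply, LinearMap.smul_apply, h.pair, smul_eq_mul,
      z12, z02, z23]
    rw [det_cycle b v c d a, det_cycle]
    ring
  have e3 : B (u (w v a)) (w z c) = 0 := by
    rw [hac, h.pair, z13]
  have e4 : B (u (w v c)) (w z a) = -(y 2 * δ) := by
    rw [hcd, hz]
    simp only [map_add, map_smul, LinearMap.add_apply, LinearMap.smul_apply, h.pair, smul_eq_mul,
      z12, z02, z23]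
    rw [← det_cycle b v d c a, det_cycle, det_cycle, det_swap_last]
    ring
  rw [e1, e2, e3, e4]
  ring

/-- The signs for which the isotropic plane `⟨x, u x, u² x⟩` has the form `v ∧ W`. -/
def nodeSigns (w : W →ₗ[ℂ] W →ₗ[ℂ] L) (B : L →ₗ[ℂ] L →ₗ[ℂ] ℂ) (u : Module.End ℂ L)
    (e : Module.Basis (Fin 6) ℂ L) (lam : Fin 6 → ℂ) : Set (Fin 5 → ℤˣ) :=
  {ε | ∃ v, v ≠ 0 ∧ ThreeIn w u v (nodeVec B e lam ε)}

/-- The planes of ε and of its flip are distinct and share the pencil ⟨n, un⟩. Only two isotropic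
planes contain a given pencil, exactly one of them of the form v ∧ W. -/
theorem mem_nodeSigns_flip (h : IsPlucker b w B) (hd : IsDiag B u e lam) (ε : Fin 5 → ℤˣ) :
    flip ε ∈ nodeSigns w B u e lam ↔ ε ∉ nodeSigns w B u e lam := by
  set x := nodeVec B e lam ε with hx
  set x' := nodeVec B e lam (flip ε) with hx'
  set n := u x - lam 1 • x with hn
  have hn' : u x' - lam 1 • x' = n := hd.sub_smul_nodeVec_flip ε
  have hux : u x = n + lam 1 • x := by rw [hn]; abel
  have hux' : u x' = n + lam 1 • x' := by rw [← hn']; abel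
  have hli : LinearIndependent ℂ ![n, u n] := by
    rw [LinearIndependent.pair_iff]
    intro s t hst
    have h1 := hd.linearIndependent_nodeVec ε (a := -(s * lam 1)) (b := s - t * lam 1) (c := t) (by
      rw [← hst, ← hx, hn, map_sub, map_smul]
      module)
    have ht := h1.2.2
    have h2 := h1.2.1
    rw [ht, zero_mul, sub_zero] at h2
    exact ⟨h2, ht⟩
  have iso : ∀ ε', ∀ m < 5, B ((u ^ m) (nodeVec B e lam ε')) (nodeVec B e lam ε') = 0 :=
    fun ε' m hm => by rw [hd.isotropic_nodeVec ε' (by omega), if_neg (by omega)]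
  have i0 := fun ε' => iso ε' 0 (by norm_num)
  have i1 := fun ε' => iso ε' 1 (by norm_num)
  have i2 := fun ε' => iso ε' 2 (by norm_num)
  have i3 := fun ε' => iso ε' 3 (by norm_num)
  have i4 := fun ε' => iso ε' 4 (by norm_num)
  simp only [pow_zero, Module.End.one_apply, pow_succ, one_mul, Module.End.mul_apply] at i0 i1 i2 i3 i4
  have hadj : ∀ x y, B x (u y) = B (u x) y := fun x y => (hd.adj x y).symm
  have orth1 : ∀ ε', B (nodeVec B e lam ε') (u (nodeVec B e lam ε') - lam 1 • nodeVec B e lam ε') = 0 := by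
    intro ε'
    simp only [map_sub, map_smul, hadj, i0, i1, smul_zero, sub_zero]
  have orth2 : ∀ ε', B (nodeVec B e lam ε')
      (u (u (nodeVec B e lam ε') - lam 1 • nodeVec B e lam ε')) = 0 := by
    intro ε'
    simp only [map_sub, map_smul, hadj, i2, i1, smul_zero, sub_zero]
  constructor
  -- If both planes had this form, the common pencil would force the same point, and then the same
  -- signs.
  · rintro ⟨v', hv', hε'⟩ ⟨v, hv, hε⟩
    have pencil : ∀ {v : W} {y : L}, ThreeIn w u v y → (∃ a, u y - lam 1 • y = w v a) ∧
        ∃ a, u (u y - lam 1 • y) = w v a := by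
      rintro v y ⟨⟨a, ha⟩, ⟨c, hc⟩, ⟨d, hd'⟩⟩
      refine ⟨⟨c - lam 1 • a, ?_⟩, ⟨d - lam 1 • c, ?_⟩⟩
      · rw [map_sub, map_smul, ← ha, ← hc]
      · rw [map_sub, map_sub, map_smul, map_smul, ← hc, ← hd']
    have p1 := pencil hε
    have p2 := pencil hε'
    rw [hn'] at p2
    obtain ⟨c, rfl⟩ := h.eq_smul_of_pencil hv hli p1.1 p1.2 p2.1 p2.2
    refine flip_ne ε (hd.eq_of_threeIn h hv hε ?_)
    obtain ⟨a, ha⟩ := hε'.1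
    exact ⟨c • a, by rw [ha, map_smul, map_smul, LinearMap.smul_apply]⟩
  · intro hε
    have o1 : B x n = 0 := orth1 ε
    have o2 : B x (u n) = 0 := orth2 ε
    have o1' : B x' n = 0 := hn' ▸ orth1 (flip ε)
    have o2' : B x' (u n) = 0 := hn' ▸ orth2 (flip ε)
    have back : ∀ {v : W} {y : L}, u y = n + lam 1 • y → (∃ a, n = w v a) → (∃ a, u n = w v a) →
        (∃ a, y = w v a) → ThreeIn w u v y := by
      rintro v y hy ⟨a, ha⟩ ⟨c, hc⟩ ⟨d, hd'⟩
      have h1 : u y = w v (a + lam 1 • d) := by rw [hy, map_add, map_smul, ← ha, ← hd']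
      refine ⟨⟨d, hd'⟩, ⟨_, h1⟩, ⟨c + lam 1 • (a + lam 1 • d), ?_⟩⟩
      conv_lhs => rw [hy]
      rw [map_add, map_smul, h1, hc]
      simp only [map_add, map_smul]
    rcases h.pencil_dichotomy (x := n) (y := u n) (z := x) (z' := x') hli
      (by rw [hn]; simp only [map_sub, map_smul, LinearMap.sub_apply, LinearMap.smul_apply, hadj,
            hx, i0, i1, i2, smul_zero, sub_zero])
      (by rw [hn]; simp only [map_sub, map_smul, LinearMap.sub_apply, LinearMap.smul_apply, hadj,
            hx, i1, i2, i3, smul_zero, sub_zero])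
      (by rw [hn]; simp only [map_sub, map_smul, LinearMap.sub_apply, LinearMap.smul_apply, hadj,
            hx, i2, i3, i4, smul_zero, sub_zero])
      o1 o2 (i0 _) o1' o2' (i0 _) with ⟨v, hv, h1, h2, h3 | h3⟩ | ⟨r, s, t, hr⟩
    · exact absurd ⟨v, hv, back hux h1 h2 h3⟩ hε
    · exact ⟨v, hv, back hux' h1 h2 h3⟩
    -- Otherwise x' lies in the span of x, n and un, which is contained in ⟨x, ux, u²x⟩.
    · refine absurd (hd.eq_of_mem_span (ε := ε) (ε' := flip ε) (a := r - s * lam 1)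
        (b := s - t * lam 1) (c := t) ?_) (flip_ne ε)
      rw [← hx, ← hx', hr, hn, map_sub, map_smul]
      module

/-- The flip is an involution exchanging this set with its complement among 32 sign vectors. -/
theorem ncard_nodeSigns (h : IsPlucker b w B) (hd : IsDiag B u e lam) :
    (nodeSigns w B u e lam).ncard = 16 := by
  have hcompl : flip '' nodeSigns w B u e lam = (nodeSigns w B u e lam)ᶜ := by
    ext ε
    rw [Set.mem_compl_iff, ← mem_nodeSigns_flip h hd]
    constructor
    · rintro ⟨ε', hε', rfl⟩
      rwa [flip_flip]
    · intro hε
      exact ⟨flip ε, hε, flip_flip ε⟩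
  have h1 := Set.ncard_image_of_injective (nodeSigns w B u e lam)
    (Function.LeftInverse.injective flip_flip)
  have h2 := Set.ncard_add_ncard_compl (nodeSigns w B u e lam)
  rw [← hcompl, h1] at h2
  have h3 : Nat.card (Fin 5 → ℤˣ) = 32 := by
    simp
  omega

end Nodes

/-! ### The Kummer quartic -/

section KummerQuartic

variable {W L : Type*} [AddCommGroup W] [Module ℂ W] [AddCommGroup L] [Module ℂ L]
  {b : Module.Basis (Fin 4) ℂ W} {w : W →ₗ[ℂ] W →ₗ[ℂ] L} {B : L →ₗ[ℂ] L →ₗ[ℂ] ℂ}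
  {u : Module.End ℂ L} {e : Module.Basis (Fin 6) ℂ L} {lam : Fin 6 → ℂ}
  {P : MvPolynomial (Fin 4) ℂ}

theorem IsDiscriminant.singular_iff (hP : IsDiscriminant b w B u P) (h : IsPlucker b w B)
    (hd : IsDiag B u e lam) {v : W} (hv : v ≠ 0) :
    (∀ j, MvPolynomial.eval (b.repr v) (MvPolynomial.pderiv j P) = 0) ↔
      ∃ ε, ThreeIn w u v (nodeVec B e lam ε) := by
  constructor
  · intro hs
    obtain ⟨x, hx0, hx⟩ := hP.exists_threeIn h hd hv hs
    exact hx.exists_node h hd hx0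
  · rintro ⟨ε, hε⟩
    exact (hP.singular_of_node h hd hv hε).1

theorem IsDiscriminant.mem_singularPoints (hP : IsDiscriminant b w B u P) (h : IsPlucker b w B)
    (hd : IsDiag B u e lam) (p : ℙ ℂ W) :
    p ∈ singularPoints b P ↔ ∃ ε, ThreeIn w u p.rep (nodeVec B e lam ε) := by
  rw [← hP.singular_iff h hd p.rep_nonzero]
  simp [singularPoints, zeroLocus]

theorem ThreeIn.mk_rep {v : W} (hv : v ≠ 0) {x : L} (hx : ThreeIn w u v x) :
    ThreeIn w u (Projectivization.mk ℂ v hv).rep x := by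
  obtain ⟨a, ha⟩ := Projectivization.exists_smul_eq_mk_rep ℂ v hv
  rw [← ha]
  exact hx.smul_left a.ne_zero

/-- Signs and points correspond bijectively: v ∧ W determines the signs, and the pencil of x and ux
determines v. -/
theorem IsDiscriminant.ncard_singularPoints (hP : IsDiscriminant b w B u P) (h : IsPlucker b w B)
    (hd : IsDiag B u e lam) : (singularPoints b P).ncard = 16 := by
  rw [← ncard_nodeSigns h hd]
  symm
  refine Set.ncard_congr (fun ε hε => Projectivization.mk ℂ hε.choose hε.choose_spec.1) ?_ ?_ ?_
  · intro ε hε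
    rw [hP.mem_singularPoints h hd]
    exact ⟨ε, hε.choose_spec.2.mk_rep hε.choose_spec.1⟩
  · intro ε ε' hε hε' heq
    have h1 := hε.choose_spec.2.mk_rep hε.choose_spec.1
    have h2 := hε'.choose_spec.2.mk_rep hε'.choose_spec.1
    rw [heq] at h1
    exact hd.eq_of_threeIn h (Projectivization.rep_nonzero _) h2 h1.1
  · intro p hp
    obtain ⟨ε, hε⟩ := (hP.mem_singularPoints h hd p).1 hp
    refine ⟨ε, ⟨p.rep, p.rep_nonzero, hε⟩, ?_⟩
    generalize_proofs h1 h2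
    have h3 := h1.choose_spec.2
    have hli := h.eq_smul_of_pencil (v := p.rep) (v' := h1.choose) (x := nodeVec B e lam ε)
      (y := u (nodeVec B e lam ε)) p.rep_nonzero (by
        rw [LinearIndependent.pair_iff]
        intro s t hst
        have := hd.linearIndependent_nodeVec ε (a := s) (b := t) (c := 0) (by
          rw [hst, zero_smul, add_zero])
        exact ⟨this.1, this.2.1⟩) hε.1 hε.2.1 h3.1 h3.2.1
    obtain ⟨c, hc⟩ := hli
    conv_rhs => rw [← p.mk_rep]
    rw [Projectivization.mk_eq_mk_iff']
    exact ⟨c, hc.symm⟩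

theorem IsDiscriminant.hessian_rank (hP : IsDiscriminant b w B u P) (h : IsPlucker b w B)
    (hd : IsDiag B u e lam) (p : ℙ ℂ W) (hp : p ∈ singularPoints b P) : (hessian b P p).rank = 3 := by
  obtain ⟨ε, hε⟩ := (hP.mem_singularPoints h hd p).1 hp
  exact (hP.singular_of_node h hd p.rep_nonzero hε).2

theorem IsDiscriminant.irreducible (hP : IsDiscriminant b w B u P) (h : IsPlucker b w B)
    (hd : IsDiag B u e lam) : Irreducible P := by
  have hcard := hP.ncard_singularPoints h hd
  have hfin : (singularPoints b P).Finite := Set.finite_of_ncard_ne_zero (by rw [hcard]; norm_num)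
  refine irreducible_of_finite_singular (d := 4) (by norm_num) hP.1 ?_
    (S := (fun p : ℙ ℂ W => (b.repr p.rep : Fin 4 → ℂ)) '' singularPoints b P) (hfin.image _) ?_ ?_
  -- P is nonzero because its Hessian has rank 3 at some point.
  · rintro rfl
    obtain ⟨p, hp⟩ := Set.nonempty_of_ncard_ne_zero (s := singularPoints b 0) (by
      rw [hcard]; norm_num)
    have h1 := hP.hessian_rank h hd p hp
    have h2 : hessian b 0 p = 0 := by
      ext j k; simp [hessian]
    rw [h2, Matrix.rank_zero] at h1
    norm_num at h1
  · rintro ⟨p, -, hp⟩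
    exact p.rep_nonzero (b.repr.map_eq_zero_iff.1 (DFunLike.coe_injective hp))
  · intro c hc hs
    obtain ⟨v, rfl⟩ : ∃ v : W, (b.repr v : Fin 4 → ℂ) = c :=
      ⟨b.equivFun.symm c, by rw [← b.equivFun_apply, LinearEquiv.apply_symm_apply]⟩
    have hv : v ≠ 0 := by
      rintro rfl
      exact hc (by simp)
    obtain ⟨ε, hε⟩ := (hP.singular_iff h hd hv).1 hs
    obtain ⟨a, ha⟩ := Projectivization.exists_smul_eq_mk_rep ℂ v hv
    refine ⟨_, ⟨Projectivization.mk ℂ v hv, (hP.mem_singularPoints h hd _).2 ⟨ε, hε.mk_rep hv⟩, rfl⟩,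
      (a : ℂ)⁻¹, ?_⟩
    have : v = (a : ℂ)⁻¹ • (Projectivization.mk ℂ v hv).rep := by
      rw [← ha, Units.smul_def, smul_smul, inv_mul_cancel₀ a.ne_zero, one_smul]
    conv_lhs => rw [this, map_smul]
    rfl

/-- The surface of degenerate planes `v ∧ W` is a Kummer quartic. -/
theorem isKummerQuartic_of_isPlucker (h : IsPlucker b w B) (hd : IsDiag B u e lam) :
    IsKummerQuartic {p : ℙ ℂ W | ∃ x, x ≠ 0 ∧ (∃ a, x = w p.rep a) ∧ ∃ a, u x = w p.rep a} := by
  obtain ⟨P, hP⟩ := exists_isDiscriminant h hd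
  refine ⟨b, P, hP.1, hP.irreducible h hd, ?_, hP.ncard_singularPoints h hd, hP.hessian_rank h hd⟩
  ext p
  simp only [Set.mem_ofPred_eq, zeroLocus, Set.mem_singleton_iff, forall_eq]
  exact (hP.eval_eq_zero_iff h hd p.rep_nonzero).symm

end KummerQuartic

/-! ### The exterior square of a four-dimensional space and its quadric line complex -/

section ExteriorSquare

variable {W : Type*} [AddCommGroup W] [Module ℂ W]

open ExteriorAlgebra in
theorem ι_mul_ι_mem (a c : W) : ι ℂ a * ι ℂ c ∈ ⋀[ℂ]^2 W := by
  rw [exteriorPower, pow_two]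
  exact Submodule.mul_mem_mul ⟨a, rfl⟩ ⟨c, rfl⟩

open ExteriorAlgebra in
/-- The wedge product `W × W → ⋀² W`. -/
def wedge₂ : W →ₗ[ℂ] W →ₗ[ℂ] ⋀[ℂ]^2 W :=
  LinearMap.mk₂ ℂ (fun a c => ⟨ι ℂ a * ι ℂ c, ι_mul_ι_mem a c⟩)
    (fun a a' c => Subtype.ext (by simp [add_mul]))
    (fun r a c => Subtype.ext (by simp))
    (fun a c c' => Subtype.ext (by simp [mul_add]))
    (fun r a c => Subtype.ext (by simp))

@[simp] theorem coe_wedge₂ (a c : W) : (wedge₂ a c : ExteriorAlgebra ℂ W) =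
    ExteriorAlgebra.ι ℂ a * ExteriorAlgebra.ι ℂ c := rfl

open ExteriorAlgebra in
/-- The volume form on the exterior algebra of a four-dimensional space. -/
def vol (b : Module.Basis (Fin 4) ℂ W) : ExteriorAlgebra ℂ W →ₗ[ℂ] ℂ :=
  liftAlternating (Pi.single 4 b.det)

open ExteriorAlgebra in
theorem ι_mul_four (a c d e : W) :
    ι ℂ a * ι ℂ c * (ι ℂ d * ι ℂ e) = ιMulti ℂ 4 ![a, c, d, e] := by
  simp [ιMulti_apply, mul_assoc]

open ExteriorAlgebra in
theorem vol_ιMulti (b : Module.Basis (Fin 4) ℂ W) (z : Fin 4 → W) :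
    vol b (ιMulti ℂ 4 z) = b.det z := by
  rw [vol, liftAlternating_apply_ιMulti, Pi.single_eq_same]

open ExteriorAlgebra in
theorem ιMulti_four (b : Module.Basis (Fin 4) ℂ W) (z : Fin 4 → W) :
    ιMulti ℂ 4 z = b.det z • ιMulti ℂ 4 b := by
  have : (ιMulti ℂ 4 : W [⋀^Fin 4]→ₗ[ℂ] ExteriorAlgebra ℂ W) =
      (LinearMap.toSpanSingleton ℂ _ (ιMulti ℂ 4 b)).compAlternatingMap b.det := by
    refine b.ext_alternating fun v hv => ?_
    let σ : Equiv.Perm (Fin 4) := Equiv.ofBijective v (Finite.injective_iff_bijective.1 hv)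
    have h1 := (ιMulti ℂ 4 : W [⋀^Fin 4]→ₗ[ℂ] ExteriorAlgebra ℂ W).map_perm b σ
    have h2 := b.det.map_perm b σ
    rw [b.det_self] at h2
    have h3 : (fun i => b (v i)) = b ∘ σ := rfl
    rw [h3, LinearMap.compAlternatingMap_apply, h1, h2, LinearMap.toSpanSingleton_apply]
    rcases Int.units_eq_one_or (Equiv.Perm.sign σ) with hs | hs <;> simp [hs]
  conv_lhs => rw [this]
  rfl

open ExteriorAlgebra in
theorem eq_vol_smul (b : Module.Basis (Fin 4) ℂ W) {x : ExteriorAlgebra ℂ W} (hx : x ∈ ⋀[ℂ]^4 W) :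
    x = vol b x • ιMulti ℂ 4 b := by
  rw [← ιMulti_span_fixedDegree] at hx
  induction hx using Submodule.span_induction with
  | mem y hy =>
    obtain ⟨z, rfl⟩ := hy
    rw [vol_ιMulti, ← ιMulti_four]
  | zero => simp
  | add y z _ _ hy hz => rw [map_add, add_smul, ← hy, ← hz]
  | smul r y _ hy => rw [map_smul, smul_assoc, ← hy]

theorem mul_mem_four {x y : ExteriorAlgebra ℂ W} {m n : ℕ} (hx : x ∈ ⋀[ℂ]^m W) (hy : y ∈ ⋀[ℂ]^n W)
    (h : m + n = 4) : x * y ∈ ⋀[ℂ]^4 W := by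
  rw [ExteriorAlgebra.exteriorPower, ← h, pow_add]
  exact Submodule.mul_mem_mul hx hy

theorem eq_zero_of_vol_eq_zero (b : Module.Basis (Fin 4) ℂ W) {x : ExteriorAlgebra ℂ W}
    (hx : x ∈ ⋀[ℂ]^4 W) (h : vol b x = 0) : x = 0 := by
  rw [eq_vol_smul b hx, h, zero_smul]

/-- The wedge pairing on `⋀² W`. -/
def wedgePairing (b : Module.Basis (Fin 4) ℂ W) : ⋀[ℂ]^2 W →ₗ[ℂ] ⋀[ℂ]^2 W →ₗ[ℂ] ℂ :=
  LinearMap.mk₂ ℂ (fun x y => vol b ((x : ExteriorAlgebra ℂ W) * y))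
    (fun x x' y => by simp [add_mul])
    (fun r x y => by simp)
    (fun x y y' => by simp [mul_add])
    (fun r x y => by simp)

theorem wedgePairing_apply (b : Module.Basis (Fin 4) ℂ W) (x y : ⋀[ℂ]^2 W) :
    wedgePairing b x y = vol b ((x : ExteriorAlgebra ℂ W) * y) := rfl

theorem wedgePairing_eq_zero_iff (b : Module.Basis (Fin 4) ℂ W) (x y : ⋀[ℂ]^2 W) :
    wedgePairing b x y = 0 ↔ (x : ExteriorAlgebra ℂ W) * y = 0 := by
  rw [wedgePairing_apply]
  exact ⟨eq_zero_of_vol_eq_zero b (mul_mem_four x.2 y.2 rfl), fun h => by rw [h, map_zero]⟩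

theorem isPlucker_exteriorSquare (b : Module.Basis (Fin 4) ℂ W) :
    IsPlucker b (wedge₂ (W := W)) (wedgePairing b) where
  self v := Subtype.ext (by simp)
  pair a c d e := by
    rw [wedgePairing_apply, coe_wedge₂, coe_wedge₂, ι_mul_four, vol_ιMulti]
  span := by
    rw [eq_top_iff, ← exteriorPower.ιMulti_span ℂ 2 W]
    refine Submodule.span_mono ?_
    rintro _ ⟨z, rfl⟩
    refine ⟨z 0, z 1, Subtype.ext ?_⟩
    simp [exteriorPower.ιMulti_apply_coe, ExteriorAlgebra.ιMulti_apply]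
    rfl

theorem mem_sigma (p : ℙ ℂ W) (x : ⋀[ℂ]^2 W) : x ∈ sigma p ↔ ∃ a, x = wedge₂ p.rep a := by
  rw [sigma, Submodule.mem_comap, Projectivization.submodule_eq, Submodule.map_span,
    Set.image_singleton, Submodule.mem_span_singleton_mul]
  constructor
  · rintro ⟨_, ⟨a, rfl⟩, ha⟩
    exact ⟨a, Subtype.ext ha.symm⟩
  · rintro ⟨a, rfl⟩
    exact ⟨_, ⟨a, rfl⟩, rfl⟩

theorem exists_eigenbasis {L : Type*} [AddCommGroup L] [Module ℂ L] (hL : Module.finrank ℂ L = 6)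
    (u : Module.End ℂ L) (hu : {μ : ℂ | u.HasEigenvalue μ}.ncard = 6) :
    ∃ (e : Module.Basis (Fin 6) ℂ L) (lam : Fin 6 → ℂ), Function.Injective lam ∧
      (∀ k, u (e k) = lam k • e k) ∧ ∀ μ, u.HasEigenvalue μ ↔ ∃ k, lam k = μ := by
  have hfin : {μ : ℂ | u.HasEigenvalue μ}.Finite :=
    Set.finite_of_ncard_ne_zero (by rw [hu]; norm_num)
  have hcard : hfin.toFinset.card = 6 := by rw [← hu, Set.ncard_eq_toFinset_card _ hfin]
  let φ := (Finset.equivFinOfCardEq hcard).symm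
  have hφ : ∀ k, u.HasEigenvalue (φ k : ℂ) := fun k => hfin.mem_toFinset.1 (φ k).2
  have hinj : Function.Injective fun k => (φ k : ℂ) := Subtype.val_injective.comp φ.injective
  choose v hv using fun k => (hφ k).exists_hasEigenvector
  have hli := Module.End.eigenvectors_linearIndependent' u (fun k => (φ k : ℂ)) hinj v hv
  refine ⟨basisOfLinearIndependentOfCardEqFinrank hli (by rw [hL]; rfl), fun k => (φ k : ℂ), hinj,
    fun k => ?_, fun μ => ⟨fun hμ => ?_, ?_⟩⟩
  · rw [coe_basisOfLinearIndependentOfCardEqFinrank]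
    exact (hv k).apply_eq_smul
  · exact ⟨φ.symm ⟨μ, hfin.mem_toFinset.2 hμ⟩, by simp⟩
  · rintro ⟨k, rfl⟩
    exact hφ k

/-- The quadric line complex and the Kummer quartic of a self-adjoint operator on `⋀² W` with
simple spectrum. -/
theorem exists_quadricLineComplex (b : Module.Basis (Fin 4) ℂ W) {u : Module.End ℂ (⋀[ℂ]^2 W)}
    {e : Module.Basis (Fin 6) ℂ (⋀[ℂ]^2 W)} {lam : Fin 6 → ℂ}
    (hadj : ∀ x y, (u x : ExteriorAlgebra ℂ W) * y = x * u y)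
    (hinj : ∀ x, u x = 0 → x = 0) (heig : ∀ k, u (e k) = lam k • e k)
    (hlam : Function.Injective lam) :
    ∃ F : QuadraticForm ℂ (⋀[ℂ]^2 W), IsQuadricLineComplex F ∧ IsKummerQuartic (associatedKummer F) ∧
      ∀ p, p ∈ associatedKummer F ↔
        ∃ x, x ≠ 0 ∧ (∃ a, x = wedge₂ p.rep a) ∧ ∃ a, u x = wedge₂ p.rep a := by
  have h := isPlucker_exteriorSquare b
  set B := wedgePairing b with hB
  have hd : IsDiag B u e lam :=
    ⟨h.symm, fun x => h.nondeg, fun x y => by rw [hB, wedgePairing_apply, wedgePairing_apply, hadj],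
      heig, hlam⟩
  have hsy : ∀ x y, B (u x) y = B (u y) x := fun x y => by rw [hd.adj, hd.symm]
  -- F(x) = B(ux, x); the self-orthogonality of p ∧ W then identifies degeneracy on p ∧ W with u
  -- returning a nonzero vector to p ∧ W.
  let F : QuadraticForm ℂ (⋀[ℂ]^2 W) := LinearMap.BilinMap.toQuadraticMap (B.comp u)
  have hF : ∀ x, F x = B (u x) x := fun x => rfl
  have hpol : ∀ x y, QuadraticMap.polar F x y = 2 * B (u x) y := by
    intro x y
    rw [QuadraticMap.polar, hF, hF, hF]
    simp only [map_add, LinearMap.add_apply, hsy y x]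
    ring
  have hker : ∀ p, p ∈ associatedKummer F ↔
      ∃ x, x ≠ 0 ∧ (∃ a, x = wedge₂ p.rep a) ∧ ∃ a, u x = wedge₂ p.rep a := by
    intro p
    simp only [associatedKummer, Set.mem_ofPred_eq, mem_sigma]
    constructor
    · rintro ⟨x, hx, hx0, hy⟩
      refine ⟨x, hx0, hx, h.exists_eq_wedge p.rep_nonzero fun y => ?_⟩
      have := hy _ ⟨y, rfl⟩
      rw [hpol] at this
      exact (mul_eq_zero.1 this).resolve_left two_ne_zero
    · rintro ⟨x, hx0, hx, ⟨a, ha⟩⟩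
      refine ⟨x, hx, hx0, ?_⟩
      rintro _ ⟨c, rfl⟩
      rw [hpol, ha, h.wedge_wedge, mul_zero]
  refine ⟨F, ⟨fun x hx => hinj x (h.nondeg fun y => ?_), fun x hx0 hxx hFx => ?_⟩, ?_, hker⟩
  · have := hx y
    rw [hpol] at this
    exact (mul_eq_zero.1 this).resolve_left two_ne_zero
  -- Equal tangent hyperplanes make B(ux, ·) vanish on the kernel of B(x, ·). Then ux is a multiple
  -- of x, an isotropic eigenvector.
  · by_contra! hcon
    have h1 : ∀ y, B x y = 0 → B (u x) y = 0 := by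
      intro y hy
      have := hcon y ((wedgePairing_eq_zero_iff b x y).1 hy)
      rw [hpol] at this
      exact (mul_eq_zero.1 this).resolve_left two_ne_zero
    obtain ⟨y₀, hy₀⟩ : ∃ y, B x y ≠ 0 := by
      by_contra! hc
      exact hx0 (h.nondeg hc)
    refine hd.not_isotropic_eigenvector hx0 (μ := B (u x) y₀ / B x y₀) ?_
      ((wedgePairing_eq_zero_iff b x x).2 hxx)
    refine sub_eq_zero.1 (h.nondeg fun y => ?_)
    have h2 := h1 (y - (B x y / B x y₀) • y₀) (by
      rw [map_sub, map_smul, smul_eq_mul, div_mul_cancel₀ _ hy₀, sub_self])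
    rw [map_sub, map_smul, smul_eq_mul] at h2
    rw [map_sub, map_smul, LinearMap.sub_apply, LinearMap.smul_apply, smul_eq_mul, ← h2]
    ring
  · have : associatedKummer F =
        {p : ℙ ℂ W | ∃ x, x ≠ 0 ∧ (∃ a, x = wedge₂ p.rep a) ∧ ∃ a, u x = wedge₂ p.rep a} :=
      Set.ext hker
    rw [this]
    exact isKummerQuartic_of_isPlucker h hd

end ExteriorSquare

/-! ### Contractions and divisibility in exterior algebras -/

section ExteriorGeneral

variable {M : Type*} [AddCommGroup M] [Module ℂ M]

open ExteriorAlgebra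

theorem ι_mul_mem_succ {n : ℕ} (v : M) {x : ExteriorAlgebra ℂ M} (hx : x ∈ ⋀[ℂ]^n M) :
    ι ℂ v * x ∈ ⋀[ℂ]^(n + 1) M := by
  rw [exteriorPower, pow_succ']
  exact Submodule.mul_mem_mul ⟨v, rfl⟩ hx

theorem exteriorPower_succ_induction {n : ℕ} {p : ExteriorAlgebra ℂ M → Prop}
    (hmul : ∀ v : M, ∀ x ∈ ⋀[ℂ]^n M, p (ι ℂ v * x)) (hadd : ∀ x y, p x → p y → p (x + y))
    {x : ExteriorAlgebra ℂ M} (hx : x ∈ ⋀[ℂ]^(n + 1) M) : p x := by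
  rw [exteriorPower, pow_succ'] at hx
  refine Submodule.mul_induction_on hx ?_ hadd
  rintro _ ⟨v, rfl⟩ y hy
  exact hmul v y hy

theorem mem_exteriorPower_zero {x : ExteriorAlgebra ℂ M} (hx : x ∈ ⋀[ℂ]^0 M) :
    ∃ s : ℂ, x = algebraMap ℂ _ s := by
  rw [exteriorPower, pow_zero] at hx
  obtain ⟨s, rfl⟩ := Submodule.mem_one.1 hx
  exact ⟨s, rfl⟩

theorem mem_exteriorPower_one {x : ExteriorAlgebra ℂ M} (hx : x ∈ ⋀[ℂ]^1 M) :
    ∃ a : M, x = ι ℂ a := by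
  rw [exteriorPower, pow_one] at hx
  obtain ⟨a, rfl⟩ := hx
  exact ⟨a, rfl⟩

theorem ι_mem_exteriorPower_one (a : M) : ι ℂ a ∈ ⋀[ℂ]^1 M := by
  rw [exteriorPower, pow_one]
  exact ⟨a, rfl⟩

theorem ι_mul_ι_swap (a c : M) : ι ℂ a * ι ℂ c = -(ι ℂ c * ι ℂ a) :=
  eq_neg_of_add_eq_zero_left (ι_add_mul_swap a c)

theorem ι_mul_ι_mul_swap (a c : M) (x : ExteriorAlgebra ℂ M) :
    ι ℂ a * (ι ℂ c * x) = -(ι ℂ c * (ι ℂ a * x)) := by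
  rw [← mul_assoc, ι_mul_ι_swap, neg_mul, mul_assoc]

theorem ι_mul_ι_mul_self (a : M) (x : ExteriorAlgebra ℂ M) : ι ℂ a * (ι ℂ a * x) = 0 := by
  rw [← mul_assoc, ι_sq_zero, zero_mul]

theorem ι_mul_comm_of_mem {n : ℕ} (v : M) {x : ExteriorAlgebra ℂ M} (hx : x ∈ ⋀[ℂ]^n M) :
    ι ℂ v * x = (-1 : ℂ) ^ n • (x * ι ℂ v) := by
  induction n generalizing x with
  | zero =>
    obtain ⟨s, rfl⟩ := mem_exteriorPower_zero hx
    rw [pow_zero, one_smul, Algebra.commutes]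
  | succ n ih =>
    refine exteriorPower_succ_induction (p := fun x => ι ℂ v * x = (-1 : ℂ) ^ (n + 1) • (x * ι ℂ v))
      (fun a y hy => ?_) (fun y z hy hz => ?_) hx
    · rw [ι_mul_ι_mul_swap, ih hy, mul_assoc, mul_smul_comm, ← neg_smul, pow_succ]
      congr 1
      ring
    · rw [mul_add, add_mul, smul_add, hy, hz]

/-- Contraction with a linear form. -/
def contract (d : M →ₗ[ℂ] ℂ) : ExteriorAlgebra ℂ M →ₗ[ℂ] ExteriorAlgebra ℂ M :=
  CliffordAlgebra.contractLeft (Q := (0 : QuadraticForm ℂ M)) d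

theorem contract_ι_mul (d : M →ₗ[ℂ] ℂ) (a : M) (x : ExteriorAlgebra ℂ M) :
    contract d (ι ℂ a * x) = d a • x - ι ℂ a * contract d x :=
  CliffordAlgebra.contractLeft_ι_mul (Q := (0 : QuadraticForm ℂ M)) d a x

theorem contract_ι (d : M →ₗ[ℂ] ℂ) (a : M) : contract d (ι ℂ a) = algebraMap ℂ _ (d a) :=
  CliffordAlgebra.contractLeft_ι (Q := (0 : QuadraticForm ℂ M)) d a

theorem contract_algebraMap (d : M →ₗ[ℂ] ℂ) (s : ℂ) : contract d (algebraMap ℂ _ s) = 0 :=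
  CliffordAlgebra.contractLeft_algebraMap (Q := (0 : QuadraticForm ℂ M)) d s

theorem contract_mem {n : ℕ} (d : M →ₗ[ℂ] ℂ) {x : ExteriorAlgebra ℂ M} (hx : x ∈ ⋀[ℂ]^(n + 1) M) :
    contract d x ∈ ⋀[ℂ]^n M := by
  induction n generalizing x with
  | zero =>
    obtain ⟨a, rfl⟩ := mem_exteriorPower_one hx
    rw [contract_ι, exteriorPower, pow_zero]
    exact Submodule.mem_one.2 ⟨_, rfl⟩
  | succ n ih =>
    refine exteriorPower_succ_induction (p := fun x => contract d x ∈ ⋀[ℂ]^(n + 1) M)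
      (fun a y hy => ?_) (fun y z hy hz => ?_) hx
    · rw [contract_ι_mul]
      exact sub_mem (Submodule.smul_mem _ _ hy) (ι_mul_mem_succ a (ih hy))
    · rw [map_add]
      exact add_mem hy hz

/-- Exactness of the Koszul complex. -/
theorem exists_eq_ι_mul {n : ℕ} {v : M} (hv : v ≠ 0) {x : ExteriorAlgebra ℂ M}
    (hx : x ∈ ⋀[ℂ]^(n + 1) M) (h : ι ℂ v * x = 0) : ∃ y ∈ ⋀[ℂ]^n M, x = ι ℂ v * y := by
  -- Contraction with d is a homotopy: applied to v ∧ x = 0 it gives d(v) x = v ∧ (d ⌟ x).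
  obtain ⟨d, hd⟩ := Module.Projective.exists_dual_ne_zero ℂ hv
  refine ⟨(d v)⁻¹ • contract d x, Submodule.smul_mem _ _ (contract_mem d hx), ?_⟩
  have h1 := contract_ι_mul d v x
  rw [h, map_zero] at h1
  rw [mul_smul_comm, ← sub_eq_zero.1 h1.symm, smul_smul, inv_mul_cancel₀ hd, one_smul]

theorem map_subtype_injective (W : Submodule ℂ M) :
    Function.Injective (ExteriorAlgebra.map W.subtype) :=
  map_injective_field W.ker_subtype

theorem contract_map_subtype {W : Submodule ℂ M} {d : M →ₗ[ℂ] ℂ} (hd : ∀ a ∈ W, d a = 0)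
    (x : ExteriorAlgebra ℂ W) : contract d (ExteriorAlgebra.map W.subtype x) = 0 := by
  induction x using CliffordAlgebra.left_induction with
  | algebraMap r =>
    exact (congrArg _ (AlgHom.commutes _ r)).trans (contract_algebraMap d r)
  | add x y hx hy => rw [map_add, map_add, hx, hy, add_zero]
  | ι_mul x a hx =>
    have h1 : ExteriorAlgebra.map W.subtype (ι ℂ a * x) =
        ι ℂ (a : M) * ExteriorAlgebra.map W.subtype x := by
      rw [map_mul, map_apply_ι]; rfl
    exact (congrArg _ h1).trans (by rw [contract_ι_mul, hx, hd _ a.2, zero_smul, mul_zero, sub_zero])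

theorem map_extPow (W : Submodule ℂ M) (n : ℕ) :
    (⋀[ℂ]^n W).map (ExteriorAlgebra.map W.subtype).toLinearMap = extPow W n := by
  rw [exteriorPower, extPow, Submodule.map_pow]
  congr 1
  ext x
  constructor
  · rintro ⟨_, ⟨a, rfl⟩, rfl⟩
    exact ⟨a, a.2, by simp⟩
  · rintro ⟨a, ha, rfl⟩
    exact ⟨_, ⟨⟨a, ha⟩, rfl⟩, by simp⟩

theorem map_subtype_mem (W : Submodule ℂ M) {n : ℕ} {x : ExteriorAlgebra ℂ W} (hx : x ∈ ⋀[ℂ]^n W) :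
    ExteriorAlgebra.map W.subtype x ∈ ⋀[ℂ]^n M := by
  have h1 : ExteriorAlgebra.map W.subtype x ∈ extPow W n := by
    rw [← map_extPow]; exact ⟨x, hx, rfl⟩
  have h2 : W.map (ι ℂ) ≤ LinearMap.range (ι ℂ : M →ₗ[ℂ] ExteriorAlgebra ℂ M) := by
    rintro _ ⟨a, -, rfl⟩
    exact ⟨a, rfl⟩
  exact pow_le_pow_left' h2 n h1

/-- On a four-dimensional space, the wedge pairing `W × ⋀³ W → ⋀⁴ W` is nondegenerate. -/
theorem eq_zero_of_ι_mul_eq_zero (b : Module.Basis (Fin 4) ℂ M) {x : ExteriorAlgebra ℂ M}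
    (hx : x ∈ ⋀[ℂ]^3 M) (h : ∀ v : M, ι ℂ v * x = 0) : x = 0 := by
  obtain ⟨y, hy, rfl⟩ := exists_eq_ι_mul (b.ne_zero 0) hx (h _)
  -- Divisibility by b₀ and b₁ together writes x as −b₁ ∧ b₀ ∧ a. The remaining equations then put a
  -- in ⟨b₀, b₁⟩.
  have h1 := contract_ι_mul (b.coord 1) (b 1) (ι ℂ (b 0) * y)
  rw [h, map_zero, contract_ι_mul] at h1
  simp only [Module.Basis.coord_apply, Module.Basis.repr_self, Finsupp.single_apply] at h1
  obtain ⟨a, ha⟩ := mem_exteriorPower_one (contract_mem (b.coord 1) hy)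
  rw [ha] at h1
  have h2 : ι ℂ (b 0) * y = -(ι ℂ (b 1) * (ι ℂ (b 0) * ι ℂ a)) := by
    have h3 : (0 : ExteriorAlgebra ℂ M) = ι ℂ (b 0) * y + ι ℂ (b 1) * (ι ℂ (b 0) * ι ℂ a) := by
      simpa using h1
    exact eq_neg_of_add_eq_zero_left h3.symm
  have hli : LinearIndependent ℂ ![b 0, b 1] := by
    have := b.linearIndependent.comp (![0, 1] : Fin 2 → Fin 4) (by decide)
    convert this using 1
    funext k; fin_cases k <;> rfl
  obtain ⟨s, t, rfl⟩ := IsPlucker.exists_eq_add b (c := a) hli fun w => by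
    have h4 := h w
    rw [h2, mul_neg, neg_eq_zero] at h4
    have h5 := congrArg (vol b) h4
    rw [(vol b).map_zero, ← mul_assoc, ι_mul_four, vol_ιMulti] at h5
    have h6 := b.det.map_perm ![w, b 1, b 0, a] (Equiv.swap 0 2 * Equiv.swap 2 3)
    rw [h5, smul_zero] at h6
    rw [← h6]
    congr 1
    funext k; fin_cases k <;> rfl
  rw [h2]
  simp only [map_add, map_smul, mul_add, mul_smul_comm, ι_sq_zero, smul_zero, zero_add]
  rw [ι_mul_ι_swap (b 0), mul_neg, ι_mul_ι_mul_self, neg_zero, smul_zero, neg_zero]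

end ExteriorGeneral

/-! ### Coordinates on the exterior algebra of W ⊕ ℂf₁ ⊕ ℂf₂ -/

section Split

open ExteriorAlgebra

variable {V : Type*} [AddCommGroup V] [Module ℂ V]

/-- `V = W ⊕ ℂ f₁ ⊕ ℂ f₂`, with coordinate forms `D₁`, `D₂`. -/
structure IsSplit (W : Submodule ℂ V) (f₁ f₂ : V) (D₁ D₂ : V →ₗ[ℂ] ℂ) : Prop where
  d11 : D₁ f₁ = 1
  d12 : D₁ f₂ = 0
  d21 : D₂ f₁ = 0
  d22 : D₂ f₂ = 1
  w1 : ∀ a ∈ W, D₁ a = 0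
  w2 : ∀ a ∈ W, D₂ a = 0
  decomp : ∀ v, ∃ a : W, v = a + D₁ v • f₁ + D₂ v • f₂

/-- The element `x₀ + f₁ x₁ + f₂ x₂ + f₁ f₂ x₃` of the exterior algebra of `V`. -/
def assemble {W : Submodule ℂ V} (f₁ f₂ : V) (x₀ x₁ x₂ x₃ : ExteriorAlgebra ℂ W) :
    ExteriorAlgebra ℂ V :=
  ExteriorAlgebra.map W.subtype x₀ + ι ℂ f₁ * ExteriorAlgebra.map W.subtype x₁ +
    ι ℂ f₂ * ExteriorAlgebra.map W.subtype x₂ +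
    ι ℂ f₁ * (ι ℂ f₂ * ExteriorAlgebra.map W.subtype x₃)

variable {W : Submodule ℂ V} {f₁ f₂ : V} {D₁ D₂ : V →ₗ[ℂ] ℂ}

theorem assemble_add (x₀ x₁ x₂ x₃ y₀ y₁ y₂ y₃ : ExteriorAlgebra ℂ W) :
    assemble f₁ f₂ x₀ x₁ x₂ x₃ + assemble f₁ f₂ y₀ y₁ y₂ y₃ =
      assemble f₁ f₂ (x₀ + y₀) (x₁ + y₁) (x₂ + y₂) (x₃ + y₃) := by
  simp only [assemble, map_add, mul_add]
  abel

theorem assemble_smul (s : ℂ) (x₀ x₁ x₂ x₃ : ExteriorAlgebra ℂ W) :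
    s • assemble f₁ f₂ x₀ x₁ x₂ x₃ = assemble f₁ f₂ (s • x₀) (s • x₁) (s • x₂) (s • x₃) := by
  simp only [assemble, map_smul, mul_smul_comm, smul_add]

theorem assemble_zero : assemble f₁ f₂ (0 : ExteriorAlgebra ℂ W) 0 0 0 = 0 := by
  simp [assemble]

theorem map_subtype_ι_mul (a : W) (x : ExteriorAlgebra ℂ W) :
    ExteriorAlgebra.map W.subtype (ι ℂ a * x) = ι ℂ (a : V) * ExteriorAlgebra.map W.subtype x := by
  rw [map_mul, map_apply_ι]; rfl

theorem ι_mul_algebraMap (a : V) (s : ℂ) : ι ℂ a * algebraMap ℂ _ s = s • ι ℂ a := by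
  rw [← Algebra.commutes, Algebra.smul_def]

theorem smul_algebraMap (s t : ℂ) :
    s • algebraMap ℂ (ExteriorAlgebra ℂ V) t = algebraMap ℂ _ (s * t) := by
  rw [map_mul, Algebra.smul_def]

theorem ι_mul_assemble (a : W) (s t : ℂ) (x₀ x₁ x₂ x₃ : ExteriorAlgebra ℂ W) :
    ι ℂ ((a : V) + s • f₁ + t • f₂) * assemble f₁ f₂ x₀ x₁ x₂ x₃ =
      assemble f₁ f₂ (ι ℂ a * x₀) (s • x₀ - ι ℂ a * x₁) (t • x₀ - ι ℂ a * x₂)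
        (s • x₂ - t • x₁ + ι ℂ a * x₃) := by
  simp only [assemble, map_add, map_sub, map_smul, map_subtype_ι_mul, add_mul, mul_add, mul_sub,
    smul_mul_assoc, mul_smul_comm, ι_mul_ι_mul_self, smul_zero]
  rw [ι_mul_ι_mul_swap (a : V) f₁, ι_mul_ι_mul_swap (a : V) f₂, ι_mul_ι_mul_swap (a : V) f₁,
    ι_mul_ι_mul_swap (a : V) f₂, ι_mul_ι_mul_swap f₂ f₁, ι_mul_ι_mul_swap f₂ f₁, ι_mul_ι_mul_self]
  simp only [mul_neg, neg_neg, mul_zero, neg_zero, smul_zero, smul_neg]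
  abel

/-- Contraction with D₁ and D₂ kills the exterior algebra of W, so it strips off f₁ and f₂; both
together isolate x₃, and then each alone isolates x₁ and x₂. -/
theorem IsSplit.assemble_eq_zero (h : IsSplit W f₁ f₂ D₁ D₂) {x₀ x₁ x₂ x₃ : ExteriorAlgebra ℂ W}
    (h0 : assemble f₁ f₂ x₀ x₁ x₂ x₃ = 0) : x₀ = 0 ∧ x₁ = 0 ∧ x₂ = 0 ∧ x₃ = 0 := by
  have c1 := fun x => contract_map_subtype h.w1 x
  have c2 := fun x => contract_map_subtype h.w2 x
  have inj : ∀ x : ExteriorAlgebra ℂ W, ExteriorAlgebra.map W.subtype x = 0 → x = 0 := fun x hx =>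
    map_subtype_injective W (hx.trans (map_zero _).symm)
  have e1 := congrArg (contract D₁) h0
  have e2 := congrArg (contract D₂) h0
  simp only [assemble, map_add, contract_ι_mul, h.d11, h.d12, h.d21, h.d22, c1, c2, one_smul,
    zero_smul, mul_zero, sub_zero, zero_sub, zero_add, add_zero, (contract D₁).map_zero,
    (contract D₂).map_zero] at e1 e2
  have e12 := congrArg (contract D₂) e1
  simp only [map_add, contract_ι_mul, h.d22, c2, one_smul, mul_zero, sub_zero, zero_add,
    (contract D₂).map_zero] at e12
  have z3 := inj _ e12
  subst z3
  simp only [map_zero, mul_zero, neg_zero, add_zero] at e1 e2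
  have z1 := inj _ e1
  have z2 := inj _ e2
  subst z1 z2
  simp only [assemble, map_zero, mul_zero, add_zero] at h0
  exact ⟨inj _ h0, rfl, rfl, rfl⟩

theorem assemble_sub (x₀ x₁ x₂ x₃ y₀ y₁ y₂ y₃ : ExteriorAlgebra ℂ W) :
    assemble f₁ f₂ x₀ x₁ x₂ x₃ - assemble f₁ f₂ y₀ y₁ y₂ y₃ =
      assemble f₁ f₂ (x₀ - y₀) (x₁ - y₁) (x₂ - y₂) (x₃ - y₃) := by
  simp only [assemble, map_sub, mul_sub]
  abel

theorem IsSplit.assemble_inj (h : IsSplit W f₁ f₂ D₁ D₂) {x₀ x₁ x₂ x₃ y₀ y₁ y₂ y₃ : ExteriorAlgebra ℂ W}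
    (h0 : assemble f₁ f₂ x₀ x₁ x₂ x₃ = assemble f₁ f₂ y₀ y₁ y₂ y₃) :
    x₀ = y₀ ∧ x₁ = y₁ ∧ x₂ = y₂ ∧ x₃ = y₃ := by
  rw [← sub_eq_zero, assemble_sub] at h0
  have := h.assemble_eq_zero h0
  simpa only [sub_eq_zero] using this

theorem IsSplit.ι_eq_assemble (h : IsSplit W f₁ f₂ D₁ D₂) (v : V) :
    ∃ a : W, ∃ s t : ℂ, v = a + s • f₁ + t • f₂ ∧ ι ℂ v = assemble f₁ f₂ (ι ℂ a) (algebraMap ℂ _ s)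
      (algebraMap ℂ _ t) 0 := by
  obtain ⟨a, ha⟩ := h.decomp v
  refine ⟨a, D₁ v, D₂ v, ha, ?_⟩
  conv_lhs => rw [ha]
  simp [assemble, map_apply_ι, ← Algebra.commutes, Algebra.smul_def]

theorem IsSplit.exists_assemble_two (h : IsSplit W f₁ f₂ D₁ D₂) {τ : ExteriorAlgebra ℂ V}
    (hτ : τ ∈ ⋀[ℂ]^2 V) : ∃ x₀ ∈ ⋀[ℂ]^2 W, ∃ (a c : W) (s : ℂ),
      τ = assemble f₁ f₂ x₀ (ι ℂ a) (ι ℂ c) (algebraMap ℂ _ s) := by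
  refine exteriorPower_succ_induction (p := fun τ => ∃ x₀ ∈ ⋀[ℂ]^2 W, ∃ (a c : W) (s : ℂ),
      τ = assemble f₁ f₂ x₀ (ι ℂ a) (ι ℂ c) (algebraMap ℂ _ s)) (fun v y hy => ?_) ?_ hτ
  · obtain ⟨v', rfl⟩ := mem_exteriorPower_one hy
    obtain ⟨a, s, t, rfl, -⟩ := h.ι_eq_assemble v
    obtain ⟨a', s', t', -, hv'⟩ := h.ι_eq_assemble v'
    refine ⟨ι ℂ a * ι ℂ a', ι_mul_ι_mem _ _, s • a' - s' • a, t • a' - t' • a, s * t' - t * s', ?_⟩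
    rw [hv', ι_mul_assemble]
    simp only [map_sub, map_smul, ι_mul_algebraMap, smul_algebraMap, mul_zero, add_zero]
  · rintro _ _ ⟨x₀, hx, a, c, s, rfl⟩ ⟨y₀, hy, a', c', s', rfl⟩
    exact ⟨x₀ + y₀, add_mem hx hy, a + a', c + c', s + s', by
      rw [assemble_add, map_add, map_add, map_add]⟩

theorem IsSplit.exists_assemble_three (h : IsSplit W f₁ f₂ D₁ D₂) {τ : ExteriorAlgebra ℂ V}
    (hτ : τ ∈ ⋀[ℂ]^3 V) : ∃ x₀ ∈ ⋀[ℂ]^3 W, ∃ x₁ ∈ ⋀[ℂ]^2 W, ∃ x₂ ∈ ⋀[ℂ]^2 W, ∃ a : W,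
      τ = assemble f₁ f₂ x₀ x₁ x₂ (ι ℂ a) := by
  refine exteriorPower_succ_induction (p := fun τ => ∃ x₀ ∈ ⋀[ℂ]^3 W, ∃ x₁ ∈ ⋀[ℂ]^2 W,
      ∃ x₂ ∈ ⋀[ℂ]^2 W, ∃ a : W, τ = assemble f₁ f₂ x₀ x₁ x₂ (ι ℂ a)) (fun v y hy => ?_) ?_ hτ
  · obtain ⟨x₀, hx, a', c', s', rfl⟩ := h.exists_assemble_two hy
    obtain ⟨a, s, t, rfl, -⟩ := h.ι_eq_assemble v
    refine ⟨_, ι_mul_mem_succ a hx, s • x₀ - ι ℂ a * ι ℂ a', sub_mem (Submodule.smul_mem _ _ hx)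
      (ι_mul_ι_mem _ _), t • x₀ - ι ℂ a * ι ℂ c', sub_mem (Submodule.smul_mem _ _ hx)
      (ι_mul_ι_mem _ _), s • c' - t • a' + s' • a, ?_⟩
    rw [ι_mul_assemble]
    simp only [map_sub, map_smul, map_add, ι_mul_algebraMap]
  · rintro _ _ ⟨x₀, hx₀, x₁, hx₁, x₂, hx₂, a, rfl⟩ ⟨y₀, hy₀, y₁, hy₁, y₂, hy₂, c, rfl⟩
    exact ⟨x₀ + y₀, add_mem hx₀ hy₀, x₁ + y₁, add_mem hx₁ hy₁, x₂ + y₂, add_mem hx₂ hy₂, a + c, by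
      rw [assemble_add, map_add]⟩

theorem assemble_mem_two {x₀ : ExteriorAlgebra ℂ W} (hx : x₀ ∈ ⋀[ℂ]^2 W) (a c : W) (s : ℂ) :
    assemble f₁ f₂ x₀ (ι ℂ a) (ι ℂ c) (algebraMap ℂ _ s) ∈ ⋀[ℂ]^2 V := by
  refine add_mem (add_mem (add_mem (map_subtype_mem W hx) ?_) ?_) ?_
  · rw [map_apply_ι]; exact ι_mul_ι_mem _ _
  · rw [map_apply_ι]; exact ι_mul_ι_mem _ _
  · rw [AlgHom.commutes, ← Algebra.commutes, ← Algebra.smul_def, mul_smul_comm]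
    exact Submodule.smul_mem _ _ (ι_mul_ι_mem _ _)

end Split

/-! ### From the Lagrangian A to the pair (φ, u) -/

section Reduction

open ExteriorAlgebra

variable {V : Type*} [AddCommGroup V] [Module ℂ V]

/-- `A ⊆ ⋀³ V` is the sum of the graphs of `φ : W → ⋀³ W` and `u : ⋀² W → ⋀² W`, for the
identifications of `⋀³ V` with `⋀³ W ⊕ f₁ ⋀² W ⊕ f₂ ⋀² W ⊕ f₁ f₂ W`. -/
structure IsGraphPair (W : Submodule ℂ V) (f₁ f₂ : V) (D₁ D₂ : V →ₗ[ℂ] ℂ)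
    (A : Submodule ℂ (ExteriorAlgebra ℂ V)) (φ : W →ₗ[ℂ] ⋀[ℂ]^3 W)
    (u : Module.End ℂ (⋀[ℂ]^2 W)) : Prop extends IsSplit W f₁ f₂ D₁ D₂ where
  isotropic : ∀ α ∈ A, ∀ β ∈ A, α * β = 0
  mem_iff : ∀ (x₀ : ⋀[ℂ]^3 W) (x₁ x₂ : ⋀[ℂ]^2 W) (a : W),
    assemble f₁ f₂ (x₀ : ExteriorAlgebra ℂ W) x₁ x₂ (ι ℂ a) ∈ A ↔ x₀ = φ a ∧ x₂ = u x₁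
  φ_inj : ∀ a, φ a = 0 → a = 0
  u_inj : ∀ x, u x = 0 → x = 0

theorem mem_EPW_mk {A : Submodule ℂ (ExteriorAlgebra ℂ V)} {v : V} (hv : v ≠ 0) :
    Projectivization.mk ℂ v hv ∈ EPW A ↔ ∃ τ ∈ ⋀[ℂ]^2 V, ι ℂ v * τ ∈ A ∧ ι ℂ v * τ ≠ 0 := by
  rw [EPW, Set.mem_ofPred_eq, Submodule.ne_bot_iff, extPow, pow_one, Projectivization.submodule_mk,
    Submodule.map_span, Set.image_singleton]
  constructor
  · rintro ⟨_, ⟨h1, h2⟩, h3⟩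
    obtain ⟨τ, hτ, rfl⟩ := Submodule.mem_span_singleton_mul.1 h1
    exact ⟨τ, hτ, h2, h3⟩
  · rintro ⟨τ, hτ, h2, h3⟩
    exact ⟨_, ⟨Submodule.mem_span_singleton_mul.2 ⟨τ, hτ, rfl⟩, h2⟩, h3⟩

variable {W : Submodule ℂ V} {f₁ f₂ : V} {D₁ D₂ : V →ₗ[ℂ] ℂ}
  {A : Submodule ℂ (ExteriorAlgebra ℂ V)} {φ : W →ₗ[ℂ] ⋀[ℂ]^3 W} {u : Module.End ℂ (⋀[ℂ]^2 W)}

theorem mul_assemble_of_mem {n : ℕ} {x : ExteriorAlgebra ℂ W} (hx : x ∈ ⋀[ℂ]^n W)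
    (x₀ x₁ x₂ x₃ : ExteriorAlgebra ℂ W) :
    ExteriorAlgebra.map W.subtype x * assemble f₁ f₂ x₀ x₁ x₂ x₃ =
      assemble f₁ f₂ (x * x₀) ((-1 : ℂ) ^ n • (x * x₁)) ((-1 : ℂ) ^ n • (x * x₂)) (x * x₃) := by
  have h : ∀ (f : V) (z : ExteriorAlgebra ℂ V), ExteriorAlgebra.map W.subtype x * (ι ℂ f * z) =
      (-1 : ℂ) ^ n • (ι ℂ f * (ExteriorAlgebra.map W.subtype x * z)) := fun f z => by
    rw [← mul_assoc, ← mul_assoc, ι_mul_comm_of_mem f (map_subtype_mem W hx), smul_mul_assoc,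
      smul_smul, ← mul_pow, neg_one_mul, neg_neg, one_pow, one_smul]
  simp only [assemble, mul_add, h, map_smul, map_mul, mul_smul_comm, smul_smul]
  rw [← mul_pow, neg_one_mul, neg_neg, one_pow, one_smul]

theorem assemble_mul_assemble {m n : ℕ} {x₀ x₁ x₂ x₃ : ExteriorAlgebra ℂ W}
    (h₀ : x₀ ∈ ⋀[ℂ]^(m + 1) W) (h₁ : x₁ ∈ ⋀[ℂ]^m W) (h₂ : x₂ ∈ ⋀[ℂ]^m W) (h₃ : x₃ ∈ ⋀[ℂ]^n W)
    (y₀ y₁ y₂ y₃ : ExteriorAlgebra ℂ W) :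
    assemble f₁ f₂ x₀ x₁ x₂ x₃ * assemble f₁ f₂ y₀ y₁ y₂ y₃ =
      assemble f₁ f₂ (x₀ * y₀) (x₁ * y₀ + (-1 : ℂ) ^ (m + 1) • (x₀ * y₁))
        (x₂ * y₀ + (-1 : ℂ) ^ (m + 1) • (x₀ * y₂))
        (x₀ * y₃ + x₃ * y₀ + (-1 : ℂ) ^ m • (x₁ * y₂) - (-1 : ℂ) ^ m • (x₂ * y₁)) := by
  have e : ∀ y₀ y₁ y₂ y₃ : ExteriorAlgebra ℂ W, ι ℂ f₁ * assemble f₁ f₂ y₀ y₁ y₂ y₃ =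
      assemble f₁ f₂ 0 y₀ 0 y₂ := fun y₀ y₁ y₂ y₃ => by
    have := ι_mul_assemble (f₁ := f₁) (f₂ := f₂) (0 : W) 1 0 y₀ y₁ y₂ y₃
    simpa using this
  have e' : ∀ y₀ y₁ y₂ y₃ : ExteriorAlgebra ℂ W, ι ℂ f₂ * assemble f₁ f₂ y₀ y₁ y₂ y₃ =
      assemble f₁ f₂ 0 0 y₀ (-y₁) := fun y₀ y₁ y₂ y₃ => by
    have := ι_mul_assemble (f₁ := f₁) (f₂ := f₂) (0 : W) 0 1 y₀ y₁ y₂ y₃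
    simpa using this
  rw [assemble.eq_1 (x₀ := x₀)]
  simp only [add_mul, mul_assoc]
  rw [mul_assemble_of_mem h₀, mul_assemble_of_mem h₁, mul_assemble_of_mem h₂,
    mul_assemble_of_mem h₃, e, e', e', e, assemble_add, assemble_add, assemble_add]
  congr 1 <;> abel

theorem IsGraphPair.φ_mem (h : IsGraphPair W f₁ f₂ D₁ D₂ A φ u) (a : W) :
    assemble f₁ f₂ (φ a : ExteriorAlgebra ℂ W) 0 0 (ι ℂ a) ∈ A := by
  simpa using (h.mem_iff (φ a) 0 0 a).2 (by simp)

theorem IsGraphPair.u_mem (h : IsGraphPair W f₁ f₂ D₁ D₂ A φ u) (x : ⋀[ℂ]^2 W) :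
    assemble f₁ f₂ (0 : ExteriorAlgebra ℂ W) x (u x) 0 ∈ A := by
  simpa using (h.mem_iff 0 x (u x) 0).2 (by simp)

/-- Isotropy of A⁺: the f₁f₂ component of the product of two elements of the graph of φ must vanish.
-/
theorem IsGraphPair.φ_symm (h : IsGraphPair W f₁ f₂ D₁ D₂ A φ u) (a c : W) :
    ι ℂ a * (φ c : ExteriorAlgebra ℂ W) = ι ℂ c * (φ a : ExteriorAlgebra ℂ W) := by
  have h1 := h.isotropic _ (h.φ_mem a) _ (h.φ_mem c)
  rw [assemble_mul_assemble (m := 2) (φ a).2 (zero_mem _) (zero_mem _)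
    (ι_mem_exteriorPower_one a)] at h1
  have h2 := (h.assemble_eq_zero h1).2.2.2
  rw [ι_mul_comm_of_mem c (φ a).2]
  simp only [mul_zero, smul_zero, add_zero, sub_zero] at h2
  rw [eq_neg_of_add_eq_zero_right h2]
  norm_num

/-- Isotropy of A⁻, in which f₁ ∧ f₂ = −f₂ ∧ f₁ turns the product into x ∧ uy − ux ∧ y. -/
theorem IsGraphPair.u_adj (h : IsGraphPair W f₁ f₂ D₁ D₂ A φ u) (x y : ⋀[ℂ]^2 W) :
    (u x : ExteriorAlgebra ℂ W) * y = x * u y := by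
  have h1 := h.isotropic _ (h.u_mem x) _ (h.u_mem y)
  rw [assemble_mul_assemble (m := 2) (n := 0) (zero_mem _) x.2 (u x).2 (zero_mem _)] at h1
  have h2 := (h.assemble_eq_zero h1).2.2.2
  simp only [mul_zero, zero_add] at h2
  norm_num at h2
  exact (sub_eq_zero.1 h2).symm

/-- The quadratic form `a ↦ a ∧ φ a`. -/
def graphForm (b : Module.Basis (Fin 4) ℂ W) (φ : W →ₗ[ℂ] ⋀[ℂ]^3 W) : QuadraticForm ℂ W :=
  LinearMap.BilinMap.toQuadraticMap <|
    LinearMap.mk₂ ℂ (fun a c => vol b (ι ℂ a * (φ c : ExteriorAlgebra ℂ W)))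
      (fun a a' c => by simp [add_mul])
      (fun r a c => by simp)
      (fun a c c' => by simp [mul_add])
      (fun r a c => by simp)

theorem graphForm_apply (b : Module.Basis (Fin 4) ℂ W) (a : W) :
    graphForm b φ a = vol b (ι ℂ a * (φ a : ExteriorAlgebra ℂ W)) := rfl

theorem graphForm_eq_zero_iff (b : Module.Basis (Fin 4) ℂ W) (a : W) :
    graphForm b φ a = 0 ↔ ι ℂ a * (φ a : ExteriorAlgebra ℂ W) = 0 := by
  rw [graphForm_apply]
  exact ⟨eq_zero_of_vol_eq_zero b (ι_mul_mem_succ a (φ a).2), fun h => by rw [h, map_zero]⟩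

/-- By symmetry the polar form is 2 c ∧ φ(a). The pairing of W with ⋀³W is perfect and φ is
injective. -/
theorem IsGraphPair.isSmoothForm (h : IsGraphPair W f₁ f₂ D₁ D₂ A φ u)
    (b : Module.Basis (Fin 4) ℂ W) : IsSmoothForm (graphForm b φ) := by
  intro a ha
  refine h.φ_inj a (Subtype.ext (eq_zero_of_ι_mul_eq_zero b (φ a).2 fun c => ?_))
  refine eq_zero_of_vol_eq_zero b (ι_mul_mem_succ c (φ a).2) ?_
  have h1 := ha c
  rw [graphForm, LinearMap.BilinMap.polar_toQuadraticMap] at h1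
  simp only [LinearMap.mk₂_apply] at h1
  rw [h.φ_symm] at h1
  linear_combination h1 / 2

/-- For τ = x₀ + f₁c + f₂d + s f₁f₂ the product a ∧ τ keeps the four components apart. Lying in A
means φ(sa) = a ∧ x₀ and u(a ∧ c) = a ∧ d, one condition for each eigenspace of i. -/
theorem IsGraphPair.mk_mem_EPW_of_mem (h : IsGraphPair W f₁ f₂ D₁ D₂ A φ u)
    (b : Module.Basis (Fin 4) ℂ W) (a : W) (ha : (a : V) ≠ 0) :
    Projectivization.mk ℂ (a : V) ha ∈ EPW A ↔ graphForm b φ a = 0 ∨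
      ∃ x, x ≠ 0 ∧ (∃ c, x = wedge₂ a c) ∧ ∃ d, u x = wedge₂ a d := by
  have ha' : a ≠ 0 := fun h0 => ha (by rw [h0]; rfl)
  have key : ∀ x₀ x₁ x₂ x₃ : ExteriorAlgebra ℂ W, ι ℂ (a : V) * assemble f₁ f₂ x₀ x₁ x₂ x₃ =
      assemble f₁ f₂ (ι ℂ a * x₀) (-(ι ℂ a * x₁)) (-(ι ℂ a * x₂)) (ι ℂ a * x₃) := fun _ _ _ _ => by
    simpa using ι_mul_assemble (f₁ := f₁) (f₂ := f₂) a 0 0 _ _ _ _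
  rw [mem_EPW_mk, graphForm_eq_zero_iff]
  constructor
  · rintro ⟨τ, hτ, h1, h2⟩
    obtain ⟨x₀, hx, c, d, s, rfl⟩ := h.exists_assemble_two hτ
    rw [key, ι_mul_algebraMap, ← map_smul] at h1 h2
    have h3 := (h.mem_iff ⟨_, ι_mul_mem_succ a hx⟩ (-wedge₂ a c) (-wedge₂ a d) (s • a)).1 (by
      simpa using h1)
    -- If s = 0 the A⁺ part vanishes, so the A⁻ part must be nonzero; if s ≠ 0, multiplication by a
    -- gives a ∧ φ(a) = 0.
    rcases eq_or_ne s 0 with rfl | hs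
    · refine Or.inr ⟨-wedge₂ a c, fun h0 => h2 ?_, ⟨-c, by simp⟩, -d, by rw [← h3.2, map_neg]⟩
      have h4 := h3.2
      rw [h0, map_zero] at h4
      have h5 := congrArg Subtype.val h3.1
      have h6 := congrArg Subtype.val h4
      have h7 := congrArg Subtype.val h0
      simp only [zero_smul, map_zero, Submodule.coe_neg, coe_wedge₂, Submodule.coe_zero] at h5 h6 h7
      rw [h5, h6, h7, zero_smul, map_zero, assemble_zero]
    · left
      have h5 := congrArg (fun z => s⁻¹ • (ι ℂ a * z)) (congrArg Subtype.val h3.1)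
      simp only [map_smul, Submodule.coe_smul, mul_smul_comm, smul_smul, inv_mul_cancel₀ hs,
        one_smul, ι_mul_ι_mul_self, smul_zero] at h5
      exact h5.symm
  · rintro (h0 | ⟨x, hx, ⟨c, rfl⟩, d, hd⟩)
    -- By exactness φ(a) = a ∧ y, and τ = y + f₁f₂ produces the graph element of φ over a.
    · obtain ⟨y, hy, h1⟩ := exists_eq_ι_mul ha' (φ a).2 h0
      have h2 := assemble_mem_two (f₁ := f₁) (f₂ := f₂) hy 0 0 1
      refine ⟨_, h2, ?_⟩
      rw [key, ← h1]
      simp only [map_zero, mul_zero, neg_zero, map_one, mul_one]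
      exact ⟨h.φ_mem a, fun h3 => ha' (by simpa using (h.assemble_eq_zero h3).2.2.2)⟩
    · have h2 := assemble_mem_two (f₁ := f₁) (f₂ := f₂) (zero_mem _) (-c) (-d) 0
      refine ⟨_, h2, ?_⟩
      rw [key]
      have h3 := h.u_mem (wedge₂ a c)
      rw [hd] at h3
      simp only [map_zero, mul_zero, map_neg, mul_neg, neg_neg]
      exact ⟨h3, fun h4 => hx (Subtype.ext (h.assemble_eq_zero h4).2.1)⟩

/-- The product with τ has no ⋀³W component, so injectivity of φ kills its f₁f₂W component. What is
left is u(s x₀) = t x₀ with x₀ ≠ 0, and s = 0 would give t x₀ = 0. -/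
theorem IsGraphPair.mk_mem_EPW_iff (h : IsGraphPair W f₁ f₂ D₁ D₂ A φ u) (s t : ℂ)
    (hv : s • f₁ + t • f₂ ≠ 0) :
    Projectivization.mk ℂ (s • f₁ + t • f₂) hv ∈ EPW A ↔ s ≠ 0 ∧ u.HasEigenvalue (t / s) := by
  have key : ∀ x₀ x₁ x₂ x₃ : ExteriorAlgebra ℂ W, ι ℂ (s • f₁ + t • f₂) *
      assemble f₁ f₂ x₀ x₁ x₂ x₃ = assemble f₁ f₂ 0 (s • x₀) (t • x₀) (s • x₂ - t • x₁) :=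
    fun _ _ _ _ => by simpa using ι_mul_assemble (f₁ := f₁) (f₂ := f₂) (0 : W) s t _ _ _ _
  rw [mem_EPW_mk]
  constructor
  · rintro ⟨τ, hτ, h1, h2⟩
    obtain ⟨x₀, hx, c, d, r, rfl⟩ := h.exists_assemble_two hτ
    rw [key, ← map_smul, ← map_smul, ← map_sub] at h1 h2
    obtain ⟨x, rfl⟩ : ∃ x : ⋀[ℂ]^2 W, (x : ExteriorAlgebra ℂ W) = x₀ := ⟨⟨x₀, hx⟩, rfl⟩
    have h3 := (h.mem_iff 0 (s • x) (t • x) (s • d - t • c)).1 (by simpa using h1)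
    have h4 := h.φ_inj _ h3.1.symm
    rw [h4, map_zero] at h2
    have hx0 : x ≠ 0 := by
      rintro rfl
      simp [assemble_zero] at h2
    have hs : s ≠ 0 := by
      rintro rfl
      have h5 := h3.2
      rw [zero_smul, map_zero, smul_eq_zero] at h5
      rcases h5 with rfl | h5
      · simp at hv
      · exact hx0 h5
    refine ⟨hs, Module.End.hasEigenvalue_of_hasEigenvector (x := x)
      ⟨Module.End.mem_eigenspace_iff.2 ?_, hx0⟩⟩
    have h5 := h3.2
    rw [map_smul] at h5
    rw [div_eq_inv_mul, mul_smul, h5, smul_smul, inv_mul_cancel₀ hs, one_smul]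
  · rintro ⟨hs, hu⟩
    obtain ⟨x, hx⟩ := hu.exists_hasEigenvector
    have h2 := assemble_mem_two (f₁ := f₁) (f₂ := f₂) x.2 0 0 0
    refine ⟨_, h2, ?_⟩
    rw [key]
    have h3 := h.u_mem (s • x)
    rw [map_smul, hx.apply_eq_smul, smul_smul, mul_div_cancel₀ _ hs] at h3
    simp only [map_zero, smul_zero, sub_zero]
    refine ⟨h3, fun h4 => ?_⟩
    have h5 := (h.assemble_eq_zero h4).2.1
    rw [smul_eq_zero] at h5
    exact hx.2 (Subtype.ext (h5.resolve_left hs))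

end Reduction

/-! ### The eigenspaces of the involution and the two graphs -/

section Involution

open ExteriorAlgebra

theorem eq_zero_of_eq_neg_self {M : Type*} [AddCommGroup M] [Module ℂ M] {x : M} (h : x = -x) :
    x = 0 := by
  have h1 : (2 : ℂ) • x = 0 := by rw [two_smul]; exact add_eq_zero_iff_eq_neg.2 h
  exact (smul_eq_zero.1 h1).resolve_left two_ne_zero

/-- A subspace of `M × N` of the dimension of `N` meeting `M` trivially is a graph over `N`. -/
theorem exists_linearMap_of_finrank_eq {M N : Type*} [AddCommGroup M] [Module ℂ M] [AddCommGroup N]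
    [Module ℂ N] [FiniteDimensional ℂ N] [FiniteDimensional ℂ M] (P : Submodule ℂ (M × N))
    (hdim : Module.finrank ℂ P = Module.finrank ℂ N) (h : ∀ m, (m, (0 : N)) ∈ P → m = 0) :
    ∃ φ : N →ₗ[ℂ] M, ∀ m n, (m, n) ∈ P ↔ m = φ n := by
  let s : P →ₗ[ℂ] N := LinearMap.snd ℂ M N ∘ₗ P.subtype
  have hs : Function.Injective s := by
    rw [← LinearMap.ker_eq_bot, LinearMap.ker_eq_bot']
    rintro ⟨⟨m, n⟩, hmn⟩ (h0 : n = 0)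
    subst h0
    exact Subtype.ext (Prod.ext (h m hmn) rfl)
  let e := LinearEquiv.ofInjectiveOfFinrankEq s hs hdim
  have he : ∀ n, ((e.symm n : P) : M × N).2 = n := fun n => e.apply_symm_apply n
  refine ⟨LinearMap.fst ℂ M N ∘ₗ P.subtype ∘ₗ e.symm.toLinearMap, fun m n => ?_⟩
  constructor
  · intro hmn
    have h1 : e.symm n = ⟨(m, n), hmn⟩ := e.symm_apply_eq.2 rfl
    simp [h1]
  · rintro rfl
    convert (e.symm n).2 using 1
    exact Prod.ext rfl (he n).symm

variable {V : Type*} [AddCommGroup V] [Module ℂ V]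

theorem mem_Vplus {i : V ≃ₗ[ℂ] V} {v : V} : v ∈ Vplus i ↔ i v = v := by
  rw [Vplus, Module.End.mem_eigenspace_iff, one_smul]; rfl

theorem mem_Vminus {i : V ≃ₗ[ℂ] V} {v : V} : v ∈ Vminus i ↔ i v = -v := by
  rw [Vminus, Module.End.mem_eigenspace_iff, neg_one_smul]; rfl

theorem exists_isSplit {i : V ≃ₗ[ℂ] V} (hi : ∀ v, i (i v) = v)
    (f : Module.Basis (Fin 2) ℂ (Vminus i)) :
    ∃ D₁ D₂ : V →ₗ[ℂ] ℂ, IsSplit (Vplus i) (f 0 : V) (f 1) D₁ D₂ := by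
  -- The projector (1 − i)/2 onto V⁻.
  let ρ : V →ₗ[ℂ] Vminus i := LinearMap.codRestrict (Vminus i)
    ((2⁻¹ : ℂ) • (LinearMap.id - (i : V →ₗ[ℂ] V))) fun v => mem_Vminus.2 (by
      simp only [LinearMap.smul_apply, LinearMap.sub_apply, LinearMap.id_apply,
        LinearEquiv.coe_coe, map_smul, map_sub, hi]
      rw [← smul_neg, neg_sub])
  have hρ : ∀ v, ((ρ v : Vminus i) : V) = (2⁻¹ : ℂ) • (v - i v) := fun v => rfl
  have h1 : ∀ v : Vminus i, ρ v = v := fun v => Subtype.ext (by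
    rw [hρ, mem_Vminus.1 v.2]; module)
  have h2 : ∀ a ∈ Vplus i, ρ a = 0 := fun a ha => Subtype.ext (by
    rw [hρ, mem_Vplus.1 ha, sub_self, smul_zero]; rfl)
  refine ⟨f.coord 0 ∘ₗ ρ, f.coord 1 ∘ₗ ρ, ?_, ?_, ?_, ?_, fun a ha => ?_, fun a ha => ?_,
    fun v => ⟨⟨(2⁻¹ : ℂ) • (v + i v), mem_Vplus.2 ?_⟩, ?_⟩⟩
  · simp [h1]
  · simp [h1]
  · simp [h1]
  · simp [h1]
  · simp [h2 a ha]
  · simp [h2 a ha]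
  · rw [map_smul, map_add, hi, add_comm]
  · have h3 := congrArg Subtype.val (f.sum_repr (ρ v))
    rw [Fin.sum_univ_two] at h3
    simp only [Submodule.coe_add, Submodule.coe_smul, hρ] at h3
    rw [add_assoc]
    simp only [LinearMap.comp_apply, Module.Basis.coord_apply]
    rw [h3]
    module

theorem extMap_assemble {i : V ≃ₗ[ℂ] V} {f₁ f₂ : V} (h₁ : f₁ ∈ Vminus i) (h₂ : f₂ ∈ Vminus i)
    (x₀ x₁ x₂ x₃ : ExteriorAlgebra ℂ (Vplus i)) :
    extMap i (assemble f₁ f₂ x₀ x₁ x₂ x₃) = assemble f₁ f₂ x₀ (-x₁) (-x₂) x₃ := by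
  have hj : ∀ x, ExteriorAlgebra.map (i : V →ₗ[ℂ] V) (ExteriorAlgebra.map (Vplus i).subtype x) =
      ExteriorAlgebra.map (Vplus i).subtype x := fun x => by
    rw [← AlgHom.comp_apply, ExteriorAlgebra.map_comp_map]
    congr 2
    ext a
    exact mem_Vplus.1 a.2
  have hf : ∀ f ∈ Vminus i, ExteriorAlgebra.map (i : V →ₗ[ℂ] V) (ι ℂ f) = -ι ℂ f := fun f h => by
    rw [map_apply_ι, LinearEquiv.coe_coe, mem_Vminus.1 h, map_neg]
  simp only [assemble, extMap, AlgHom.toLinearMap_apply, map_add, map_mul, hj, hf _ h₁, hf _ h₂,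
    map_neg, neg_mul, mul_neg, neg_neg]

/-- The map `x ↦ f₁ x + f₂ u(x)` on `⋀² W`. -/
def minusGraph {W : Submodule ℂ V} (f₁ f₂ : V) (u : Module.End ℂ (⋀[ℂ]^2 W)) :
    ⋀[ℂ]^2 W →ₗ[ℂ] ExteriorAlgebra ℂ V where
  toFun x := assemble f₁ f₂ (0 : ExteriorAlgebra ℂ W) x (u x) 0
  map_add' x y := by simp [assemble_add]
  map_smul' r x := by simp [assemble_smul]

/-- The map `(x, a) ↦ x + f₁ f₂ a` on `⋀³ W × W`. -/
def plusMap {W : Submodule ℂ V} (f₁ f₂ : V) : (⋀[ℂ]^3 W × W) →ₗ[ℂ] ExteriorAlgebra ℂ V where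
  toFun z := assemble f₁ f₂ z.1 0 0 (ι ℂ z.2)
  map_add' x y := by simp [assemble_add]
  map_smul' r x := by simp [assemble_smul]

/-- The operator on `⋀² W` corresponding to an operator on `extPow W 2`. -/
theorem exists_transport {W : Submodule ℂ V} (u : Module.End ℂ (extPow W 2)) :
    ∃ (J : ⋀[ℂ]^2 W ≃ₗ[ℂ] extPow W 2) (u' : Module.End ℂ (⋀[ℂ]^2 W)),
      (∀ x, (J x : ExteriorAlgebra ℂ V) = ExteriorAlgebra.map W.subtype x) ∧
      (∀ x, J (u' x) = u (J x)) ∧ ∀ μ, u'.HasEigenvalue μ ↔ u.HasEigenvalue μ := by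
  let J := (Submodule.equivMapOfInjective (ExteriorAlgebra.map W.subtype).toLinearMap
    (map_subtype_injective W) (⋀[ℂ]^2 W)).trans (LinearEquiv.ofEq _ _ (map_extPow W 2))
  have hJ : ∀ x, J (J.symm.conj u x) = u (J x) := fun x => by simp [LinearEquiv.conj_apply]
  refine ⟨J, J.symm.conj u, fun x => rfl, hJ, fun μ => ⟨fun h => ?_, fun h => ?_⟩⟩
  · obtain ⟨x, hx⟩ := h.exists_hasEigenvector
    refine Module.End.hasEigenvalue_of_hasEigenvector (x := J x)
      ⟨Module.End.mem_eigenspace_iff.2 ?_, fun h0 => hx.2 (by simpa using h0)⟩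
    rw [← hJ, hx.apply_eq_smul, map_smul]
  · obtain ⟨x, hx⟩ := h.exists_hasEigenvector
    refine Module.End.hasEigenvalue_of_hasEigenvector (x := J.symm x)
      ⟨Module.End.mem_eigenspace_iff.2 (J.injective ?_), fun h0 => hx.2 (by simpa using h0)⟩
    rw [hJ, LinearEquiv.apply_symm_apply, hx.apply_eq_smul, map_smul, LinearEquiv.apply_symm_apply]

/-- A⁻ ≅ ⋀²W has dimension 6 and A has dimension 10, so A⁺ has dimension 4 = dim W. Avoiding ⋀³W
makes it a graph over W; avoiding ⋀²V⁻ ⊗ W makes φ injective, and A⁻ avoiding f₁ ⊗ ⋀²W makes u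
injective. -/
theorem IsLGStar.exists_isGraphPair (hV : Module.finrank ℂ V = 6) {i : V ≃ₗ[ℂ] V}
    (hi : ∀ v, i (i v) = v) (hplus : Module.finrank ℂ (Vplus i) = 4)
    {A : Submodule ℂ (ExteriorAlgebra ℂ V)} (hA : IsLGStar i A) :
    ∃ (f : Module.Basis (Fin 2) ℂ (Vminus i)) (D₁ D₂ : V →ₗ[ℂ] ℂ)
      (φ : Vplus i →ₗ[ℂ] ⋀[ℂ]^3 (Vplus i)) (u : Module.End ℂ (⋀[ℂ]^2 (Vplus i))),
      IsGraphPair (Vplus i) (f 0 : V) (f 1) D₁ D₂ A φ u ∧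
        {μ : ℂ | u.HasEigenvalue μ}.ncard = 6 := by
  obtain ⟨⟨hle, hiso, hdim⟩, hsup, f, hp3, hp1, hm, u, hu, hcard, -⟩ := hA
  have : FiniteDimensional ℂ V := Module.finite_of_finrank_pos (by omega)
  obtain ⟨D₁, D₂, hS⟩ := exists_isSplit hi f
  obtain ⟨J, u', hJ, hJu, heig⟩ := exists_transport u
  rw [exteriorPower.finrank_eq, hV] at hdim
  have hdimA : Module.finrank ℂ A = 10 := by
    have : Nat.choose 6 3 = 20 := rfl
    omega
  have : FiniteDimensional ℂ A := Module.finite_of_finrank_pos (by omega)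
  have hminus : minusPart i A = LinearMap.range (minusGraph (f 0 : V) (f 1) u') := by
    refine SetLike.coe_injective ?_
    rw [hu]
    ext α
    constructor
    · rintro ⟨x, rfl⟩
      refine ⟨J.symm x, ?_⟩
      simp [minusGraph, assemble, ← hJ, hJu]
    · rintro ⟨x, rfl⟩
      refine ⟨J x, ?_⟩
      simp [minusGraph, assemble, ← hJ, hJu]
  have hminusdim : Module.finrank ℂ (minusPart i A) = 6 := by
    rw [hminus, LinearMap.finrank_range_of_inj, exteriorPower.finrank_eq, hplus]
    · rfl
    · intro x y hxy
      exact Subtype.ext (hS.assemble_inj hxy).2.1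
  have hinf : plusPart i A ⊓ minusPart i A = ⊥ := by
    rw [eq_bot_iff]
    rintro x ⟨⟨-, h1⟩, -, h2⟩
    have h3 := Module.End.mem_eigenspace_iff.1 h1
    rw [Module.End.mem_eigenspace_iff.1 h2] at h3
    exact (Submodule.mem_bot ℂ).2 (eq_zero_of_eq_neg_self (by simpa using h3.symm))
  have hplusdim : Module.finrank ℂ (plusPart i A) = 4 := by
    have : FiniteDimensional ℂ (plusPart i A) := Submodule.finiteDimensional_of_le inf_le_left
    have : FiniteDimensional ℂ (minusPart i A) := Submodule.finiteDimensional_of_le inf_le_left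
    have h1 := Submodule.finrank_sup_add_finrank_inf_eq (plusPart i A) (minusPart i A)
    rw [hinf, ← hsup, finrank_bot, hdimA, hminusdim] at h1
    omega
  -- Invariance under i makes the f₁ and f₂ components equal to their negatives.
  have hplusmem : ∀ x ∈ plusPart i A, ∃ z, x = plusMap (W := Vplus i) (f 0 : V) (f 1) z := by
    rintro x ⟨h1, h2⟩
    obtain ⟨x₀, hx₀, x₁, -, x₂, -, a, rfl⟩ := hS.exists_assemble_three (hle h1)
    have h3 := Module.End.mem_eigenspace_iff.1 h2
    rw [one_smul, extMap_assemble (f 0).2 (f 1).2] at h3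
    have h4 := hS.assemble_inj h3
    exact ⟨(⟨x₀, hx₀⟩, a), by rw [eq_zero_of_eq_neg_self h4.2.1.symm, eq_zero_of_eq_neg_self h4.2.2.1.symm]; rfl⟩
  have hplusmem' : ∀ z, plusMap (W := Vplus i) (f 0 : V) (f 1) z ∈ A →
      plusMap (f 0 : V) (f 1) z ∈ plusPart i A := fun z hz => ⟨hz, by
    rw [SetLike.mem_coe, Module.End.mem_eigenspace_iff, one_smul]
    exact (extMap_assemble (f 0).2 (f 1).2 _ _ _ _).trans (by rw [neg_zero]; rfl)⟩
  have hplusinj : Function.Injective (plusMap (W := Vplus i) (f 0 : V) (f 1)) := fun z z' h => by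
    have h1 := hS.assemble_inj h
    exact Prod.ext (Subtype.ext h1.1) (ι_inj ℂ _ _ |>.1 h1.2.2.2)
  let P := A.comap (plusMap (W := Vplus i) (f 0 : V) (f 1))
  have hPmap : P.map (plusMap (f 0 : V) (f 1)) = plusPart i A := by
    ext x
    constructor
    · rintro ⟨z, hz, rfl⟩
      exact hplusmem' z hz
    · intro hx
      obtain ⟨z, rfl⟩ := hplusmem x hx
      exact ⟨z, hx.1, rfl⟩
  have hPdim : Module.finrank ℂ P = Module.finrank ℂ (Vplus i) := by
    rw [hplus, ← hplusdim, ← hPmap]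
    exact (Submodule.equivMapOfInjective _ hplusinj P).finrank_eq
  obtain ⟨φ, hφ⟩ := exists_linearMap_of_finrank_eq P hPdim fun x hx => by
    have h1 := hplusmem' _ hx
    have h2 : plusMap (f 0 : V) (f 1) (x, (0 : Vplus i)) ∈ extPow (Vplus i) 3 := by
      rw [← map_extPow]
      exact ⟨x, x.2, by simp [plusMap, assemble]⟩
    have h3 : _ ∈ plusPart i A ⊓ extPow (Vplus i) 3 := ⟨h1, h2⟩
    rw [hp3] at h3
    exact Subtype.ext (hS.assemble_eq_zero h3).1
  refine ⟨f, D₁, D₂, φ, u', ⟨hS, hiso, fun x₀ x₁ x₂ a => ⟨fun h => ?_, fun h => ?_⟩, fun a ha => ?_,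
    fun x hx => ?_⟩, ?_⟩
  · rw [hsup] at h
    obtain ⟨y, hy, z, hz, hyz⟩ := Submodule.mem_sup.1 h
    have hyA := hy.1
    obtain ⟨⟨y₀, c⟩, rfl⟩ := hplusmem y hy
    rw [hminus] at hz
    obtain ⟨x, rfl⟩ := hz
    have h1 := (assemble_add _ _ _ _ _ _ _ _).symm.trans hyz
    have h2 := hS.assemble_inj h1
    simp only [zero_add, add_zero] at h2
    obtain ⟨h3, h4, h5, h6⟩ := h2
    have h7 := ι_inj ℂ _ _ |>.1 h6
    have h8 := (hφ y₀ c).1 hyA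
    rw [Subtype.ext h3, h7] at h8
    exact ⟨h8, by rw [← Subtype.ext h4, Subtype.ext h5]⟩
  · obtain ⟨rfl, rfl⟩ := h
    have h1 : plusMap (f 0 : V) (f 1) (φ a, a) ∈ A := (hφ _ a).2 rfl
    have h2 : minusGraph (f 0 : V) (f 1) u' x₁ ∈ minusPart i A := by rw [hminus]; exact ⟨x₁, rfl⟩
    have h3 := add_mem h1 h2.1
    have h4 := assemble_add (f₁ := (f 0 : V)) (f₂ := (f 1 : V)) (φ a : ExteriorAlgebra ℂ (Vplus i))
      0 0 (ι ℂ a) 0 x₁ (u' x₁) 0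
    simp only [add_zero, zero_add] at h4
    rw [← h4]
    exact h3
  · have h1 : plusMap (f 0 : V) (f 1) (0, a) ∈ plusPart i A := hplusmem' _ ((hφ 0 a).2 ha.symm)
    have h2 : plusMap (f 0 : V) (f 1) ((0 : ⋀[ℂ]^3 (Vplus i)), a) ∈
        extPow (Vminus i) 2 * extPow (Vplus i) 1 := by
      have h3 : plusMap (f 0 : V) (f 1) ((0 : ⋀[ℂ]^3 (Vplus i)), a) =
          ι ℂ (f 0 : V) * ι ℂ (f 1 : V) * ι ℂ (a : V) := by
        simp [plusMap, assemble, mul_assoc, map_apply_ι]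
      rw [h3, extPow, extPow, pow_one, pow_two]
      exact Submodule.mul_mem_mul (Submodule.mul_mem_mul ⟨_, (f 0).2, rfl⟩ ⟨_, (f 1).2, rfl⟩)
        ⟨_, a.2, rfl⟩
    have h3 : _ ∈ plusPart i A ⊓ (extPow (Vminus i) 2 * extPow (Vplus i) 1) := ⟨h1, h2⟩
    rw [hp1] at h3
    exact (ι_eq_zero_iff a).1 (hS.assemble_eq_zero h3).2.2.2
  · have h1 : minusGraph (f 0 : V) (f 1) u' x ∈ minusPart i A := by rw [hminus]; exact ⟨x, rfl⟩
    have h2 : minusGraph (f 0 : V) (f 1) u' x ∈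
        extPow (ℂ ∙ (f 0 : V)) 1 * extPow (Vplus i) 2 := by
      have h3 : minusGraph (f 0 : V) (f 1) u' x =
          ι ℂ (f 0 : V) * ExteriorAlgebra.map (Vplus i).subtype x := by
        simp [minusGraph, assemble, hx]
      rw [h3, ← map_extPow (Vplus i), extPow, pow_one]
      exact Submodule.mul_mem_mul ⟨_, Submodule.mem_span_singleton_self _, rfl⟩ ⟨x, x.2, rfl⟩
    have h3 : _ ∈ minusPart i A ⊓ (extPow (ℂ ∙ (f 0 : V)) 1 * extPow (Vplus i) 2) := ⟨h1, h2⟩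
    rw [hm 0] at h3
    exact Subtype.ext (hS.assemble_eq_zero h3).2.1
  · rw [← hcard]
    congr 1
    ext μ
    exact heig μ

end Involution

/-! ### The fixed locus and its isolated points -/

section FixedLocus

variable {V : Type*} [AddCommGroup V] [Module ℂ V]

theorem isZariskiClosed_prod [FiniteDimensional ℂ V] {κ : Type*} (s : Finset κ)
    (ℓ : κ → V →ₗ[ℂ] ℂ) : IsZariskiClosed {p : ℙ ℂ V | ∏ k ∈ s, ℓ k p.rep = 0} := by
  let b := Module.finBasis ℂ V
  let L : κ → MvPolynomial (Fin (Module.finrank ℂ V)) ℂ := fun k =>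
    ∑ j, MvPolynomial.C (ℓ k (b j)) * MvPolynomial.X j
  have hL : ∀ k (v : V), MvPolynomial.eval (b.repr v) (L k) = ℓ k v := fun k v => by
    conv_rhs => rw [← b.sum_repr v, map_sum]
    rw [map_sum]
    refine Finset.sum_congr rfl fun j _ => ?_
    rw [map_mul, MvPolynomial.eval_C, MvPolynomial.eval_X, map_smul, smul_eq_mul, mul_comm]
  refine ⟨_, b, {∏ k ∈ s, L k}, ?_, ?_⟩
  · rintro _ rfl
    refine ⟨∑ _k ∈ s, 1, MvPolynomial.IsHomogeneous.prod _ _ _ fun k _ =>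
      MvPolynomial.IsHomogeneous.sum _ _ _ fun j _ => ?_⟩
    rw [← zero_add 1]
    exact (MvPolynomial.isHomogeneous_C _ _).mul (MvPolynomial.isHomogeneous_X _ _)
  · ext p
    simp only [zeroLocus, Set.mem_ofPred_eq, Set.mem_singleton_iff, forall_eq, map_prod, hL]

theorem projIncl_mk (W : Submodule ℂ V) (a : W) (ha : a ≠ 0) :
    projIncl W (Projectivization.mk ℂ a ha) =
      Projectivization.mk ℂ (a : V) (fun h => ha (Subtype.ext h)) := rfl

theorem projIncl_eq_mk_rep (W : Submodule ℂ V) (r : ℙ ℂ W) :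
    projIncl W r = Projectivization.mk ℂ (r.rep : V) (fun h => r.rep_nonzero (Subtype.ext h)) := by
  conv_lhs => rw [← r.mk_rep]
  rfl

theorem map_eq_self_iff {i : V ≃ₗ[ℂ] V} (hi : ∀ v, i (i v) = v) (p : ℙ ℂ V) :
    Projectivization.map (i : V →ₗ[ℂ] V) i.injective p = p ↔
      (∃ r, p = projIncl (Vplus i) r) ∨ ∃ r, p = projIncl (Vminus i) r := by
  constructor
  · induction p using Projectivization.ind with | h v hv => ?_
    rw [Projectivization.map_mk, Projectivization.mk_eq_mk_iff']
    rintro ⟨c, hc⟩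
    replace hc : c • v = i v := hc
    have h1 : (c * c) • v = (1 : ℂ) • v := by
      rw [mul_smul, hc, ← map_smul, hc, hi, one_smul]
    rcases mul_self_eq_one_iff.1 (smul_left_injective ℂ hv h1) with rfl | rfl
    · rw [one_smul] at hc
      exact Or.inl ⟨Projectivization.mk ℂ ⟨v, mem_Vplus.2 hc.symm⟩
        (fun h => hv (congrArg Subtype.val h)), rfl⟩
    · rw [neg_one_smul] at hc
      exact Or.inr ⟨Projectivization.mk ℂ ⟨v, mem_Vminus.2 hc.symm⟩
        (fun h => hv (congrArg Subtype.val h)), rfl⟩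
  · rintro (⟨r, rfl⟩ | ⟨r, rfl⟩)
    · rw [projIncl_eq_mk_rep, Projectivization.map_mk, Projectivization.mk_eq_mk_iff']
      exact ⟨1, by rw [one_smul]; exact (mem_Vplus.1 r.rep.2).symm⟩
    · rw [projIncl_eq_mk_rep, Projectivization.map_mk, Projectivization.mk_eq_mk_iff']
      exact ⟨-1, by rw [neg_one_smul]; exact (mem_Vminus.1 r.rep.2).symm⟩

variable {M : Type*} [AddCommGroup M] [Module ℂ M]

theorem basis_add_smul_ne_zero (f : Module.Basis (Fin 2) ℂ M) (c : ℂ) : f 0 + c • f 1 ≠ 0 :=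
  fun h => by simpa using congrArg (f.coord 0) h

/-- The point of `ℙ(M)` with inhomogeneous coordinate `c` in a basis of `M`. -/
def linePoint (f : Module.Basis (Fin 2) ℂ M) (c : ℂ) : ℙ ℂ M :=
  Projectivization.mk ℂ (f 0 + c • f 1) (basis_add_smul_ne_zero f c)

theorem linePoint_injective (f : Module.Basis (Fin 2) ℂ M) : Function.Injective (linePoint f) := by
  intro c c' h
  obtain ⟨a, ha⟩ := (Projectivization.mk_eq_mk_iff' ℂ _ _ _ _).1 h
  have h0 := congrArg (f.coord 0) ha
  have h1 := congrArg (f.coord 1) ha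
  simp at h0 h1
  rw [h0, one_mul] at h1
  exact h1.symm

theorem eq_linePoint_iff (f : Module.Basis (Fin 2) ℂ M) (r : ℙ ℂ M) (c : ℂ) :
    r = linePoint f c ↔ f.coord 0 r.rep ≠ 0 ∧ f.coord 1 r.rep / f.coord 0 r.rep = c := by
  constructor
  · rintro rfl
    obtain ⟨a, ha⟩ := Projectivization.exists_smul_eq_mk_rep ℂ _ (basis_add_smul_ne_zero f c)
    rw [linePoint, ← ha]
    have := a.ne_zero
    simp [Units.smul_def]
  · rintro ⟨h0, rfl⟩
    conv_lhs => rw [← r.mk_rep]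
    refine (Projectivization.mk_eq_mk_iff' ℂ _ _ _ _).2 ⟨f.coord 0 r.rep, ?_⟩
    rw [smul_add, smul_smul, mul_div_cancel₀ _ h0]
    conv_rhs => rw [← f.sum_repr r.rep, Fin.sum_univ_two]
    rfl

variable {i : V ≃ₗ[ℂ] V} {A : Submodule ℂ (ExteriorAlgebra ℂ V)}
  {f : Module.Basis (Fin 2) ℂ (Vminus i)} {D₁ D₂ : V →ₗ[ℂ] ℂ}
  {φ : Vplus i →ₗ[ℂ] ⋀[ℂ]^3 (Vplus i)} {u : Module.End ℂ (⋀[ℂ]^2 (Vplus i))}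

theorem IsGraphPair.projIncl_minus_mem_EPW
    (h : IsGraphPair (Vplus i) (f 0 : V) (f 1) D₁ D₂ A φ u) (r : ℙ ℂ (Vminus i)) :
    projIncl (Vminus i) r ∈ EPW A ↔ ∃ c, u.HasEigenvalue c ∧ r = linePoint f c := by
  have h1 : (r.rep : V) = f.coord 0 r.rep • (f 0 : V) + f.coord 1 r.rep • (f 1 : V) := by
    have := congrArg Subtype.val (f.sum_repr r.rep)
    rw [Fin.sum_univ_two] at this
    exact this.symm
  have h2 : (r.rep : V) ≠ 0 := fun h => r.rep_nonzero (Subtype.ext h)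
  have h3 := h2
  rw [h1] at h3
  have h4 : projIncl (Vminus i) r = Projectivization.mk ℂ _ h3 := by
    rw [projIncl_eq_mk_rep]
    congr 1
  rw [h4, h.mk_mem_EPW_iff]
  constructor
  · rintro ⟨h5, h6⟩
    exact ⟨_, h6, (eq_linePoint_iff f r _).2 ⟨h5, rfl⟩⟩
  · rintro ⟨c, h5, h6⟩
    obtain ⟨h7, rfl⟩ := (eq_linePoint_iff f r _).1 h6
    exact ⟨h7, h5⟩

theorem IsGraphPair.fixedLocus_eq (h : IsGraphPair (Vplus i) (f 0 : V) (f 1) D₁ D₂ A φ u)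
    (hi : ∀ v, i (i v) = v) (b : Module.Basis (Fin 4) ℂ (Vplus i)) {lam : Fin 6 → ℂ}
    (hlam : ∀ μ, u.HasEigenvalue μ ↔ ∃ k, lam k = μ) {S : Set (ℙ ℂ (Vplus i))}
    (hS : ∀ p, p ∈ S ↔ ∃ x, x ≠ 0 ∧ (∃ a, x = wedge₂ p.rep a) ∧ ∃ a, u x = wedge₂ p.rep a) :
    fixedLocus i A = Set.range (fun j => projIncl (Vminus i) (linePoint f (lam j))) ∪
      projIncl (Vplus i) '' {p | graphForm b φ p.rep = 0} ∪ projIncl (Vplus i) '' S := by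
  have hp : ∀ r : ℙ ℂ (Vplus i), projIncl (Vplus i) r ∈ EPW A ↔
      graphForm b φ r.rep = 0 ∨ r ∈ S := fun r => by
    rw [projIncl_eq_mk_rep, h.mk_mem_EPW_of_mem b, hS]
  ext p
  constructor
  · rintro ⟨h1, h2⟩
    rcases (map_eq_self_iff hi p).1 h2 with ⟨r, rfl⟩ | ⟨r, rfl⟩
    · rcases (hp r).1 h1 with h3 | h3
      · exact Or.inl (Or.inr ⟨r, h3, rfl⟩)
      · exact Or.inr ⟨r, h3, rfl⟩
    · obtain ⟨c, hc, rfl⟩ := (h.projIncl_minus_mem_EPW r).1 h1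
      obtain ⟨k, rfl⟩ := (hlam c).1 hc
      exact Or.inl (Or.inl ⟨k, rfl⟩)
  · rintro ((⟨k, rfl⟩ | ⟨r, hr, rfl⟩) | ⟨r, hr, rfl⟩)
    · exact ⟨(h.projIncl_minus_mem_EPW _).2 ⟨_, (hlam _).2 ⟨k, rfl⟩, rfl⟩,
        (map_eq_self_iff hi _).2 (Or.inr ⟨_, rfl⟩)⟩
    · exact ⟨(hp r).2 (Or.inl hr), (map_eq_self_iff hi _).2 (Or.inl ⟨_, rfl⟩)⟩
    · exact ⟨(hp r).2 (Or.inr hr), (map_eq_self_iff hi _).2 (Or.inl ⟨_, rfl⟩)⟩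

/-- The product of the five linear forms D₂ − λₖD₁ with k ≠ j vanishes at the other five points and
on all of ℙ(V⁺), but not at the j-th point. -/
theorem isIsolatedPoint_linePoint [FiniteDimensional ℂ V]
    (h : IsSplit (Vplus i) (f 0 : V) (f 1) D₁ D₂) {lam : Fin 6 → ℂ} (hlam : Function.Injective lam)
    {T : Set (ℙ ℂ V)} {R : Set (ℙ ℂ (Vplus i))}
    (hT : T = Set.range (fun j => projIncl (Vminus i) (linePoint f (lam j))) ∪
      projIncl (Vplus i) '' R) (j : Fin 6) :
    IsIsolatedPoint T (projIncl (Vminus i) (linePoint f (lam j))) := by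
  have hq : ∀ j, ∃ a : ℂ, a ≠ 0 ∧ D₁ (projIncl (Vminus i) (linePoint f (lam j))).rep = a ∧
      D₂ (projIncl (Vminus i) (linePoint f (lam j))).rep = a * lam j := fun j => by
    obtain ⟨a, ha⟩ := Projectivization.exists_smul_eq_mk_rep ℂ
      ((f 0 + lam j • f 1 : Vminus i) : V)
      (fun h => basis_add_smul_ne_zero f (lam j) (Subtype.ext h))
    refine ⟨a, a.ne_zero, ?_, ?_⟩
    · rw [linePoint, projIncl_mk, ← ha, Units.smul_def]
      simp [h.d11, h.d12]
    · rw [linePoint, projIncl_mk, ← ha, Units.smul_def]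
      simp [h.d21, h.d22]
  refine ⟨by rw [hT]; exact Or.inl ⟨j, rfl⟩, _,
    isZariskiClosed_prod (Finset.univ.erase j) (fun k => D₂ - lam k • D₁), ?_, ?_⟩
  · rw [Set.mem_ofPred_eq, Finset.prod_eq_zero_iff]
    rintro ⟨k, hk, h0⟩
    obtain ⟨a, ha, h1, h2⟩ := hq j
    simp only [LinearMap.sub_apply, LinearMap.smul_apply, h1, h2, smul_eq_mul] at h0
    have h3 : a * (lam j - lam k) = 0 := by linear_combination h0
    exact Finset.ne_of_mem_erase hk
      (hlam (sub_eq_zero.1 ((mul_eq_zero.1 h3).resolve_left ha))).symm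
  · rintro p ⟨hp, hne⟩
    rw [hT] at hp
    rw [Set.mem_ofPred_eq]
    rcases hp with ⟨k, rfl⟩ | ⟨r, -, rfl⟩
    · obtain ⟨a, ha, h1, h2⟩ := hq k
      refine Finset.prod_eq_zero (i := k) (Finset.mem_erase.2 ⟨?_, Finset.mem_univ k⟩) ?_
      · rintro rfl
        exact hne rfl
      · simp only [LinearMap.sub_apply, LinearMap.smul_apply, h1, h2, smul_eq_mul]
        ring
    · obtain ⟨a, ha⟩ := Projectivization.exists_smul_eq_mk_rep ℂ (r.rep : V)
        (fun h => r.rep_nonzero (Subtype.ext h))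
      -- Every factor vanishes on V⁺; j + 1, taken modulo 6, is just some index other than j.
      refine Finset.prod_eq_zero (i := j + 1) (Finset.mem_erase.2 ⟨by simp, Finset.mem_univ _⟩) ?_
      rw [projIncl_eq_mk_rep, ← ha, Units.smul_def]
      simp [h.w1 _ r.rep.2, h.w2 _ r.rep.2]

end FixedLocus

end EPWFix

end

/-! ### The main theorem -/

theorem mainTheorem5 {V : Type*} [AddCommGroup V] [Module ℂ V]
    (hV : Module.finrank ℂ V = 6)
    (i : V ≃ₗ[ℂ] V) (hi : ∀ v : V, i (i v) = v)
    (hplus : Module.finrank ℂ (EPWFix.Vplus i) = 4)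
    (A : Submodule ℂ (ExteriorAlgebra ℂ V))
    (hinv : A.map (EPWFix.extMap i) = A)
    (hA : EPWFix.IsLGStar i A) :
    ∃ (q : Fin 6 → ℙ ℂ (EPWFix.Vminus i)) (Q S : Set (ℙ ℂ (EPWFix.Vplus i))),
      EPWFix.fixedLocus i A =
        Set.range (fun j => EPWFix.projIncl (EPWFix.Vminus i) (q j)) ∪
          EPWFix.projIncl (EPWFix.Vplus i) '' Q ∪ EPWFix.projIncl (EPWFix.Vplus i) '' S ∧
      Function.Injective q ∧
      (∀ j, EPWFix.IsIsolatedPoint (EPWFix.fixedLocus i A)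
        (EPWFix.projIncl (EPWFix.Vminus i) (q j))) ∧
      EPWFix.IsSmoothQuadric Q ∧
      EPWFix.IsKummerQuartic S ∧
      ∃ F : QuadraticForm ℂ (⋀[ℂ]^2 (EPWFix.Vplus i)),
        EPWFix.IsQuadricLineComplex F ∧ S = EPWFix.associatedKummer F := by
  have : FiniteDimensional ℂ V := Module.finite_of_finrank_pos (by omega)
  obtain ⟨f, D₁, D₂, φ, u, h, hcard⟩ := hA.exists_isGraphPair hV hi hplus
  let b := Module.finBasisOfFinrankEq ℂ (EPWFix.Vplus i) hplus
  have hL : Module.finrank ℂ (⋀[ℂ]^2 (EPWFix.Vplus i)) = 6 := by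
    rw [exteriorPower.finrank_eq, hplus]
    rfl
  obtain ⟨e, lam, hlam, heig, hlam'⟩ := EPWFix.exists_eigenbasis hL u hcard
  obtain ⟨F, hF, hK, hmem⟩ := EPWFix.exists_quadricLineComplex b h.u_adj h.u_inj heig hlam
  have hfix := h.fixedLocus_eq hi b hlam' hmem
  refine ⟨fun j => EPWFix.linePoint f (lam j), _, _, hfix,
    (EPWFix.linePoint_injective f).comp hlam, fun j => ?_, ⟨_, h.isSmoothForm b, rfl⟩, hK, F, hF, rfl⟩
  have hfix' := hfix
  rw [Set.union_assoc, ← Set.image_union] at hfix'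
  exact EPWFix.isIsolatedPoint_linePoint h.toIsSplit hlam hfix' j
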